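/- Work over $\mathbb C$. Let $V$ be a symplectic vector space of finite dimension $k$ (a vector space with a nondegenerate alternating bilinear form) and $W$ an orthogonal vector space of finite dimension $N$ (a vector space with a nondegenerate symmetric bilinear form). Put $$\mathfrak p(V)=\{A\in\operatorname{End}(V) : (Av,w)_V=(v,Aw)_V\ \forall v,w\},\qquad \mathfrak g(V)=\{A\in\operatorname{End}(V) : (Av,w)_V=-(v,Aw)_V\ \forall v,w\},$$ let $\mathbf N=\mathfrak p(V)\oplus\mathfrak p(V)\oplus\operatorname{Hom}(W,V)$, and let $$\mu\colon\mathbf N\to\mathfrak g(V),\qquad \mu(B_1,B_2,i)=[B_1,B_2]+i\,i^*,$$ where $i^*\in\operatorname{Hom}(V,W)$ is the right adjoint of $i$, that is, $(w,i^*v)_W=(iw,v)_V$. Assume $N\ge 4$. Then the following hold. (1) For every $B\in\mathfrak p(V)$ there is a unique point $E(B)$ of the symmetric product $S^{k/2}\mathbb C$ whose double $E(B)+E(B)\in S^k\mathbb C$ is the multiset of eigenvalues of $B$ counted with algebraic multiplicities, and the map $$\tilde\mu\colon\mathbf N\to\mathfrak g(V)\times S^{k/2}\mathbb C,\qquad x=(B_1,B_2,i)\mapsto(\mu(x),E(B_1))$$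 is a flat morphism of algebraic varieties. (2) $\mu\colon\mathbf N\to\mathfrak g(V)$ is a flat morphism. (3) For an integer $l\ge 0$ let $\mu^{-1}(0)_l$ be the locally closed set of all $(B_1,B_2,i)\in\mu^{-1}(0)$ such that $B_1$ has exactly $l$ distinct eigenvalues. Then $\dim\mu^{-1}(0)=\dim\mathbf N-\dim\mathfrak g(V)$, and for $1\le l\le k/2$ $$\dim\mu^{-1}(0)_l=\dim\mathbf N-\dim\mathfrak g(V)-\left(\tfrac k2-l\right),$$ so that $\mu^{-1}(0)_l$ has codimension $\tfrac k2-l$ in $\mu^{-1}(0)$ (codimension meaning the difference of dimensions). If $k>0$, then $\mu^{-1}(0)_l$ is empty for all other $l$. -/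

import Mathlib

namespace SOData

open Module

/-! ### Complex affine varieties, through their points and regular functions -/

/-- The ring of polynomial functions on a finite dimensional complex vector space `X`: the algebra
of functions generated by the linear functionals.  It is the coordinate ring of the affine
space `X`. -/
def polyFun (X : Type*) [AddCommGroup X] [Module ℂ X] : Subalgebra ℂ (X → ℂ) :=
  Algebra.adjoin ℂ (Set.range fun (l : Module.Dual ℂ X) (x : X) => l x)

/-- The quotient map `Y × ℂⁿ → Y × SⁿC` which forgets the order of the `n` coordinates; the points
of the symmetric product `SⁿC` are the multisets of `n` complex numbers. -/
def toSym (Y : Type*) (n : ℕ) (p : Y × (Fin n → ℂ)) : Y × Sym ℂ n :=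
  (p.1, ⟨Multiset.map p.2 Finset.univ.val, by simp⟩)

/-- The coordinate ring of `Y × SⁿC`, where `SⁿC = ℂⁿ // 𝔖ₙ`: the functions whose pullback to
`Y × ℂⁿ` is polynomial, that is, the `𝔖ₙ`-invariant polynomial functions on `Y × ℂⁿ`. -/
def polyFunProdSym (Y : Type*) [AddCommGroup Y] [Module ℂ Y] (n : ℕ) :
    Subalgebra ℂ (Y × Sym ℂ n → ℂ) where
  carrier := {f | f ∘ toSym Y n ∈ polyFun (Y × (Fin n → ℂ))}
  mul_mem' ha hb := (polyFun (Y × (Fin n → ℂ))).mul_mem ha hb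
  add_mem' ha hb := (polyFun (Y × (Fin n → ℂ))).add_mem ha hb
  algebraMap_mem' r := (polyFun (Y × (Fin n → ℂ))).algebraMap_mem r

/-- For affine varieties with sets of points `X`, `Y` and rings of regular functions `A`, `B`:
the map `φ : X → Y` is a morphism (it pulls regular functions back to regular functions) and
this morphism is flat (the comorphism `B → A` is a flat ring homomorphism). -/
def IsFlatMorphism {X Y : Type*} (A : Subalgebra ℂ (X → ℂ)) (B : Subalgebra ℂ (Y → ℂ))
    (φ : X → Y) : Prop :=
  ∃ c : B →ₐ[ℂ] A,
    (∀ (f : B) (x : X), (c f : X → ℂ) x = (f : Y → ℂ) (φ x)) ∧ c.toRingHom.Flat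

/-- The Zariski topology on (the complex points of) a finite dimensional vector space. -/
@[reducible] def zariskiTopology (X : Type*) [AddCommGroup X] [Module ℂ X] : TopologicalSpace X :=
  TopologicalSpace.generateFrom {U | ∃ f ∈ polyFun X, U = {x | f x ≠ 0}}

/-- The dimension of a (locally closed) subset of a finite dimensional vector space: the Krull
dimension of the topology induced by the Zariski topology; it is `⊥` for the empty set. -/
noncomputable def zariskiDim {X : Type*} [AddCommGroup X] [Module ℂ X] (S : Set X) :
    WithBot ℕ∞ :=
  @topologicalKrullDim S ((zariskiTopology X).induced Subtype.val)

/-! ### The space of SO-data and its moment map -/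

section

variable {V W : Type*} [AddCommGroup V] [Module ℂ V] [AddCommGroup W] [Module ℂ W]

/-- `𝔭(V)`: the endomorphisms `A` with `(A v, w) = (v, A w)`. -/
abbrev symPart (ωV : LinearMap.BilinForm ℂ V) : Submodule ℂ (End ℂ V) :=
  LinearMap.selfAdjointSubmodule ωV

/-- `𝔤(V)`, the Lie algebra of the group preserving the form: the endomorphisms `A` with
`(A v, w) = (v, - A w)`. -/
abbrev lieAlg (ωV : LinearMap.BilinForm ℂ V) : Submodule ℂ (End ℂ V) :=
  LinearMap.skewAdjointSubmodule ωV

/-- The vector space `𝐍 = 𝔭(V) ⊕ 𝔭(V) ⊕ Hom(W, V)`, with elements `(B₁, B₂, i)`. -/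
abbrev DataSpace (W : Type*) [AddCommGroup W] [Module ℂ W] (ωV : LinearMap.BilinForm ℂ V) :
    Type _ :=
  symPart ωV × symPart ωV × (W →ₗ[ℂ] V)

variable [FiniteDimensional ℂ W]

/-- The right adjoint `i^* : V → W` of `i : W → V`, characterized by
`(w, i^* v)_W = (i w, v)_V`; see `rightAdjoint_spec`. -/
noncomputable def rightAdjoint (ωV : LinearMap.BilinForm ℂ V) (ωW : LinearMap.BilinForm ℂ W)
    (hW : ωW.Nondegenerate) (i : W →ₗ[ℂ] V) : V →ₗ[ℂ] W :=
  (LinearMap.BilinForm.toDual (LinearMap.BilinForm.flip ωW) hW.flip).symm.toLinearMap ∘ₗ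
    (i.dualMap ∘ₗ LinearMap.BilinForm.flip ωV)

theorem rightAdjoint_spec (ωV : LinearMap.BilinForm ℂ V) (ωW : LinearMap.BilinForm ℂ W)
    (hW : ωW.Nondegenerate) (i : W →ₗ[ℂ] V) (w : W) (v : V) :
    ωW w (rightAdjoint ωV ωW hW i v) = ωV (i w) v := by
  have h := LinearMap.BilinForm.apply_toDual_symm_apply (hB := hW.flip)
    (i.dualMap (LinearMap.BilinForm.flip ωV v)) w
  exact h

theorem moment_mem (ωV : LinearMap.BilinForm ℂ V) (hVa : ωV.IsAlt)
    (ωW : LinearMap.BilinForm ℂ W) (hW : ωW.Nondegenerate) (hWs : ωW.IsSymm)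
    (x : DataSpace W ωV) :
    (x.1 : End ℂ V) * x.2.1 - (x.2.1 : End ℂ V) * x.1 + x.2.2 ∘ₗ rightAdjoint ωV ωW hW x.2.2
      ∈ lieAlg ωV := by
  obtain ⟨⟨B₁, h₁⟩, ⟨B₂, h₂⟩, i⟩ := x
  rw [LinearMap.mem_selfAdjointSubmodule] at h₁ h₂
  rw [LinearMap.mem_skewAdjointSubmodule]
  have h₁' : ∀ a b, ωV (B₁ a) b = ωV a (B₁ b) := fun a b => h₁ a b
  have h₂' : ∀ a b, ωV (B₂ a) b = ωV a (B₂ b) := fun a b => h₂ a b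
  have hneg : ∀ a b, ωV a b = - ωV b a := fun a b => (hVa.neg_eq b a).symm
  intro v w
  have h₃ : ωV (i (rightAdjoint ωV ωW hW i v)) w =
      - ωV v (i (rightAdjoint ωV ωW hW i w)) := by
    rw [← rightAdjoint_spec ωV ωW hW, hneg v, neg_neg, ← rightAdjoint_spec ωV ωW hW]
    exact hWs.eq _ _
  simp [h₁', h₂', h₃]
  ring

/-- The moment map `μ : 𝐍 → 𝔤(V)`, `(B₁, B₂, i) ↦ [B₁, B₂] + i i^*`. -/
noncomputable def moment (ωV : LinearMap.BilinForm ℂ V) (hVa : ωV.IsAlt)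
    (ωW : LinearMap.BilinForm ℂ W) (hW : ωW.Nondegenerate) (hWs : ωW.IsSymm)
    (x : DataSpace W ωV) : lieAlg ωV :=
  ⟨(x.1 : End ℂ V) * x.2.1 - (x.2.1 : End ℂ V) * x.1 + x.2.2 ∘ₗ rightAdjoint ωV ωW hW x.2.2,
    moment_mem ωV hVa ωW hW hWs x⟩

/-- `μ⁻¹(0)`. -/
def zeroFibre (ωV : LinearMap.BilinForm ℂ V) (hVa : ωV.IsAlt)
    (ωW : LinearMap.BilinForm ℂ W) (hW : ωW.Nondegenerate) (hWs : ωW.IsSymm) :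
    Set (DataSpace W ωV) :=
  {x | moment ωV hVa ωW hW hWs x = 0}

/-- `μ⁻¹(0)_l`: the part of `μ⁻¹(0)` where `B₁` has exactly `l` distinct eigenvalues. -/
def stratum (ωV : LinearMap.BilinForm ℂ V) (hVa : ωV.IsAlt)
    (ωW : LinearMap.BilinForm ℂ W) (hW : ωW.Nondegenerate) (hWs : ωW.IsSymm) (l : ℕ) :
    Set (DataSpace W ωV) :=
  {x | x ∈ zeroFibre ωV hVa ωW hW hWs ∧ {a : ℂ | End.HasEigenvalue (x.1 : End ℂ V) a}.ncard = l}

end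

end SOData

/-! Write n = k/2. In coordinates the entries of μ are homogeneous of degree 2. The characteristic
polynomial of B₁ is a square q², and the elementary symmetric functions of the n roots of q, which
are the coordinates of E(B₁), are homogeneous of degrees 1, …, n. For homogeneous polynomials f₁, …,
f_r of positive degree on affine d-space, flatness follows from dim V(f) ≤ d - r. Indeed f then
extends to a system of parameters at the origin, so it is a regular sequence there, and a graded
Nakayama argument makes the polynomial ring free over ℂ[f] (`flat_aeval_of_isHomogeneous`). Both
flatness statements thus reduce to upper bounds for dimensions of zero fibres.

Upper bounds come from counting parameters: a chain of primes is no longer than the transcendence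
degree of the point at its bottom. Let (B₁, B₂, i) be a point of μ = 0 over a field, and let L be a
subfield containing the eigenvalues of B₁ (`trRank_datum_le`). - B₁ has a normal form with entries
in L, made of hyperbolic pairs of Jordan chains (`exists_isHyperbolicChains`). Differentiating the
conjugation shows that B₁ has transcendence degree at most dim 𝔭 - dim(𝔭 ∩ centralizer of B₁). - In
a chain basis the commutator telescopes along antidiagonals. For a pair of chains of length n_j this
leaves two vectors a, b of N power series with a·a, a·b and b·b divisible by X^{n_j}. Such jets
depend on at most n_j(2N - 3) parameters (`trRank_union_jets_le`), and this is where N ≥ 4 enters. -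
Given B₁ and i, the equation is inhomogeneous linear in B₂, with solutions modelled on 𝔭 ∩
centralizer of B₁.

The centralizer terms cancel, and the total is at most dim 𝔭 + n(2N - 3) = dim 𝐍 - dim 𝔤 - n over L.
If the eigenvalues are algebraic over d elements, the dimension over ℂ is at most d more
(`MatrixDatum.ringKrullDim_quotient_add_le`). Taking d = n handles μ, d = 0 handles the zero fibre
of μ̃, and d = l handles the strata.

Lower bounds come from Krull's height theorem, applied at the origin for μ⁻¹(0). For a stratum one
starts at a point (B₁, 0, 0) at which 0 is a root of q of multiplicity n - l + 1 and the other roots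
are simple. Having a root of multiplicity greater than n - l means the vanishing of n - l + 1
polynomials in one extra variable t. Since q is monic, forgetting t is a finite map, so this costs
at most n - l dimensions. Hankel determinants of power sums of the roots of q express the number of
distinct eigenvalues by polynomial equations and inequations. -/

namespace SOData

open Module

/-! ### Regular sequences modulo an ideal -/

/-- The list is a (weakly) regular sequence on `R ⧸ I`. -/
def RegularModulo {R : Type*} [CommRing R] : Ideal R → List R → Prop
  | _, [] => True
  | I, x :: xs => (∀ a, x * a ∈ I → a ∈ I) ∧ RegularModulo (I ⊔ Ideal.span {x}) xs

section RegularModulo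

variable {R : Type*} [CommRing R]

theorem regularModulo_append (I : Ideal R) (xs ys : List R) :
    RegularModulo I (xs ++ ys) ↔ RegularModulo I xs ∧ RegularModulo (I ⊔ Ideal.ofList xs) ys := by
  induction xs generalizing I with
  | nil => simp [RegularModulo]
  | cons x xs ih => simp [RegularModulo, ih, and_assoc, sup_assoc]

theorem mem_sup_span_singleton {I : Ideal R} {x c : R} :
    c ∈ I ⊔ Ideal.span {x} ↔ ∃ i ∈ I, ∃ d, i + x * d = c := by
  simp [Submodule.mem_sup, Ideal.mem_span_singleton, Dvd.dvd]

/-- Let K be the ideal of all c with bc ∈ I. Regularity of b modulo I + (a), followed by cancelling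
a, gives K ≤ I + aK, and Nakayama's lemma then gives K ≤ I. This is why a has to lie in the Jacobson
radical. -/
theorem RegularModulo.swap [IsNoetherianRing R] {I : Ideal R} {a b : R} {xs : List R}
    (ha : a ∈ (⊥ : Ideal R).jacobson) (h : RegularModulo I (a :: b :: xs)) :
    RegularModulo I (b :: a :: xs) := by
  obtain ⟨h1, h2, h3⟩ := h
  have hb : ∀ c, b * c ∈ I → c ∈ I := by
    let K : Ideal R :=
      { carrier := {c | b * c ∈ I}
        zero_mem' := by simp
        add_mem' := fun {x y} hx hy => by
          simp only [Set.mem_ofPred_eq, mul_add] at *; exact I.add_mem hx hy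
        smul_mem' := fun r x hx => by
          simp only [Set.mem_ofPred_eq, smul_eq_mul] at *
          rw [mul_left_comm]; exact I.mul_mem_left _ hx }
    have hK : K ≤ I := by
      refine Submodule.le_of_le_smul_of_le_jacobson_bot (I := Ideal.span {a})
        (IsNoetherian.noetherian K) (by simpa [Ideal.span_le] using ha) ?_
      intro c hc
      have hc' : b * c ∈ I := hc
      obtain ⟨i, hi, d, rfl⟩ := mem_sup_span_singleton.1 (h2 c (Ideal.mem_sup_left hc'))
      have hd : d ∈ K := by
        apply h1
        have : a * (b * d) = b * (i + a * d) - b * i := by ring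
        rw [this]
        exact I.sub_mem hc' (I.mul_mem_left _ hi)
      refine Submodule.add_mem_sup hi ?_
      exact Submodule.smul_mem_smul (Ideal.mem_span_singleton_self a) hd
    exact fun c hc => hK hc
  refine ⟨hb, fun c hc => ?_, ?_⟩
  · obtain ⟨i, hi, d, hd⟩ := mem_sup_span_singleton.1 hc
    have : b * d ∈ I ⊔ Ideal.span {a} :=
      mem_sup_span_singleton.2 ⟨-i, I.neg_mem hi, c, by rw [← hd]; ring⟩
    obtain ⟨i', hi', e, rfl⟩ := mem_sup_span_singleton.1 (h2 d this)
    have h4 : c - b * e ∈ I := by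
      apply h1
      have : a * (c - b * e) = i + b * i' := by rw [mul_sub, ← hd]; ring
      rw [this]
      exact I.add_mem hi (I.mul_mem_left _ hi')
    exact mem_sup_span_singleton.2 ⟨_, h4, e, by ring⟩
  · rwa [sup_assoc, sup_comm (Ideal.span {b}), ← sup_assoc]

theorem RegularModulo.move_last [IsNoetherianRing R] {I : Ideal R} {xs : List R} {g : R}
    (hxs : ∀ x ∈ xs, x ∈ (⊥ : Ideal R).jacobson) (h : RegularModulo I (xs ++ [g])) :
    RegularModulo I (g :: xs) := by
  induction xs generalizing I with
  | nil => simpa using h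
  | cons x xs ih =>
    have h' : RegularModulo I (x :: g :: xs) :=
      ⟨h.1, ih (fun y hy => hxs y (List.mem_cons_of_mem _ hy)) h.2⟩
    exact h'.swap (hxs x List.mem_cons_self)

theorem RegularModulo.move_first [IsNoetherianRing R] {I : Ideal R} {xs : List R} {g : R}
    (hg : g ∈ (⊥ : Ideal R).jacobson) (h : RegularModulo I (g :: xs)) :
    RegularModulo I (xs ++ [g]) := by
  induction xs generalizing I with
  | nil => simpa using h
  | cons x xs ih => exact ⟨(h.swap hg).1, ih (h.swap hg).2⟩

/-- Some power of l is a multiple of f modulo I, so anything killed by f is killed by that power of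
l. The last element of a regular sequence may therefore be replaced by any element with l in the
radical of the new ideal. -/
theorem RegularModulo.exchange {I : Ideal R} {l f : R} (h : RegularModulo I [l])
    (hl : l ∈ (I ⊔ Ideal.span {f}).radical) : RegularModulo I [f] := by
  refine ⟨fun a ha => ?_, trivial⟩
  obtain ⟨n, hn⟩ := hl
  obtain ⟨i, hi, d, hd⟩ := mem_sup_span_singleton.1 hn
  have key : l ^ n * a ∈ I := by
    rw [← hd]
    have : (i + f * d) * a = a * i + d * (f * a) := by ring
    rw [this]
    exact I.add_mem (I.mul_mem_left _ hi) (I.mul_mem_left _ ha)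
  clear hn hd
  induction n with
  | zero => simpa using key
  | succ n ih => exact ih (h.1 _ (by rwa [pow_succ', mul_assoc] at key))

open IsLocalRing in
-- Prime avoidance provides g outside all minimal primes of I and of J. If a non-maximal prime q
-- contained K and g, for K one of I, J, it would lie strictly above a minimal prime of K. The
-- maximal ideal would then have height at least 2 in R/K, against Krull's principal ideal theorem
-- for the given parameter.
theorem exists_common_parameter [IsLocalRing R] [IsNoetherianRing R] {I J : Ideal R} {x y : R}
    (hI : I ≤ maximalIdeal R) (hJ : J ≤ maximalIdeal R)
    (hx : x ∈ maximalIdeal R) (hy : y ∈ maximalIdeal R)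
    (hIx : maximalIdeal R ≤ (I ⊔ Ideal.span {x}).radical)
    (hJy : maximalIdeal R ≤ (J ⊔ Ideal.span {y}).radical)
    (hI' : ¬ maximalIdeal R ≤ I.radical) (hJ' : ¬ maximalIdeal R ≤ J.radical) :
    ∃ g ∈ maximalIdeal R, maximalIdeal R ≤ (I ⊔ Ideal.span {g}).radical ∧
      maximalIdeal R ≤ (J ⊔ Ideal.span {g}).radical := by
  have hfin : (I.minimalPrimes ∪ J.minimalPrimes).Finite :=
    I.finite_minimalPrimes_of_isNoetherianRing.union J.finite_minimalPrimes_of_isNoetherianRing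
  have hne : ∀ K : Ideal R, ¬ maximalIdeal R ≤ K.radical → ∀ p ∈ K.minimalPrimes,
      ¬ maximalIdeal R ≤ p := by
    intro K hK p hp hle
    have hpm : p = maximalIdeal R :=
      le_antisymm (le_maximalIdeal hp.1.1.ne_top) hle
    apply hK
    rw [Ideal.radical_eq_sInf]
    refine le_sInf fun q hq => ?_
    have := hq.2
    rw [← hpm]
    exact hp.2 ⟨hq.2, hq.1⟩ (by rw [hpm]; exact le_maximalIdeal hq.2.ne_top)
  have hnot : ¬ ((maximalIdeal R : Set R) ⊆ ⋃ p ∈ I.minimalPrimes ∪ J.minimalPrimes, (p : Set R)) := by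
    rw [Ideal.subset_union_prime_finite hfin ⊥ ⊥ (fun p hp _ _ => by
      rcases hp with hp | hp <;> exact hp.1.1)]
    rintro ⟨p, hp | hp, hle⟩
    · exact hne I hI' p hp hle
    · exact hne J hJ' p hp hle
  obtain ⟨g, hg, hgn⟩ := Set.not_subset.1 hnot
  simp only [Set.mem_iUnion, not_exists] at hgn
  have main : ∀ (K : Ideal R) (z : R), K ≤ maximalIdeal R → z ∈ maximalIdeal R →
      maximalIdeal R ≤ (K ⊔ Ideal.span {z}).radical →
      (∀ p ∈ K.minimalPrimes, g ∉ p) → maximalIdeal R ≤ (K ⊔ Ideal.span {g}).radical := by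
    intro K z hK hz hKz hgK
    rw [Ideal.radical_eq_sInf]
    refine le_sInf fun q hq => ?_
    have := hq.2
    have hKq : K ≤ q := le_sup_left.trans hq.1
    have hgq : g ∈ q := hq.1 (Ideal.mem_sup_right (Ideal.mem_span_singleton_self g))
    obtain ⟨p, hp, hpq⟩ := Ideal.exists_minimalPrimes_le hKq
    have := hp.1.1
    by_contra hcon
    have hqm : q < maximalIdeal R :=
      lt_of_le_of_ne (le_maximalIdeal hq.2.ne_top) (fun h => hcon h.ge)
    have hpq' : p < q := lt_of_le_of_ne hpq (fun h => hgK p hp (h ▸ hgq))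
    have hmin : maximalIdeal R ∈ (K ⊔ Ideal.span {z}).minimalPrimes := by
      refine ⟨⟨inferInstance, sup_le hK (by simpa [Ideal.span_le] using hz)⟩, ?_⟩
      intro r hr _
      exact hKz.trans ((Ideal.IsPrime.radical_le_iff hr.1).2 hr.2)
    have hht := Ideal.map_height_le_one_of_mem_minimalPrimes hmin
    let φ := Ideal.Quotient.mk K
    have hφ : Function.Surjective φ := Ideal.Quotient.mk_surjective
    have hker : ∀ {s : Ideal R}, K ≤ s → RingHom.ker φ ≤ s := fun h => by
      rwa [Ideal.mk_ker]
    have hpK : K ≤ p := hp.1.2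
    have := Ideal.map_isPrime_of_surjective hφ (hker hpK)
    have := Ideal.map_isPrime_of_surjective hφ (hker hKq)
    have := Ideal.map_isPrime_of_surjective hφ (hker hK)
    have hlt : ∀ {s t : Ideal R}, K ≤ s → K ≤ t → s < t → s.map φ < t.map φ := by
      intro s t hs ht hst
      refine lt_of_le_of_ne (Ideal.map_mono hst.le) fun h => hst.ne ?_
      have := congrArg (Ideal.comap φ) h
      rwa [Ideal.comap_map_of_surjective' _ hφ, Ideal.comap_map_of_surjective' _ hφ,
        sup_eq_left.2 (hker hs), sup_eq_left.2 (hker ht)] at this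
    have h1 := Ideal.height_add_one_le_of_lt_of_isPrime (hlt hpK hKq hpq')
    have h2 := Ideal.height_add_one_le_of_lt_of_isPrime (hlt hKq hK hqm)
    have h3 : (1 : ℕ∞) ≤ (q.map φ).height := le_trans (by simp) h1
    have h4 : (1 + 1 : ℕ∞) ≤ 1 := le_trans (by gcongr) (h2.trans hht)
    exact absurd h4 (by decide)
  exact ⟨g, hg, main I x hI hx hIx (fun p hp => hgn p (Or.inl hp)),
    main J y hJ hy hJy (fun p hp => hgn p (Or.inr hp))⟩

theorem ofList_le_iff {xs : List R} {I : Ideal R} : Ideal.ofList xs ≤ I ↔ ∀ x ∈ xs, x ∈ I := by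
  simp [Ideal.ofList, Ideal.span_le, Set.subset_def]

open IsLocalRing in
/-- In a noetherian local ring, if one system of parameters is a regular sequence, then
so is every other. -/
theorem RegularModulo.of_systemOfParameters [IsLocalRing R] [IsNoetherianRing R] (n : ℕ)
    (I : Ideal R) (xs ys : List R) (hxn : xs.length = n) (hyn : ys.length = n)
    (hI : I ≤ maximalIdeal R)
    (hx : ∀ x ∈ xs, x ∈ maximalIdeal R) (hy : ∀ y ∈ ys, y ∈ maximalIdeal R)
    (hIx : maximalIdeal R ≤ (I ⊔ Ideal.ofList xs).radical)
    (hIy : maximalIdeal R ≤ (I ⊔ Ideal.ofList ys).radical)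
    (hmin : ∀ zs : List R, (∀ z ∈ zs, z ∈ maximalIdeal R) →
      maximalIdeal R ≤ (I ⊔ Ideal.ofList zs).radical → n ≤ zs.length)
    (h : RegularModulo I xs) : RegularModulo I ys := by
  induction n generalizing I xs ys with
  | zero =>
    rw [List.length_eq_zero_iff] at hyn
    subst hyn
    trivial
  | succ n ih =>
    obtain ⟨xs, x, rfl⟩ := (List.eq_nil_or_concat xs).resolve_left (by rintro rfl; simp at hxn)
    obtain ⟨ys, y, rfl⟩ := (List.eq_nil_or_concat ys).resolve_left (by rintro rfl; simp at hyn)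
    simp only [List.concat_eq_append, List.length_append, List.length_singleton,
      Nat.add_right_cancel_iff, List.mem_append, List.mem_singleton] at hxn hyn hx hy h hIx hIy ⊢
    have hx' : ∀ z ∈ xs, z ∈ maximalIdeal R := fun z hz => hx z (Or.inl hz)
    have hy' : ∀ z ∈ ys, z ∈ maximalIdeal R := fun z hz => hy z (Or.inl hz)
    simp only [Ideal.ofList_append, Ideal.ofList_singleton, ← sup_assoc] at hIx hIy
    -- A common last parameter g links the two systems: replace x by g, move g to the front, apply
    -- the induction hypothesis modulo g, move g back, and replace it by y. Minimality of the length
    -- shows that neither truncated system is already one of parameters.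
    obtain ⟨g, hg, hgx, hgy⟩ := exists_common_parameter
      (sup_le hI (ofList_le_iff.2 hx')) (sup_le hI (ofList_le_iff.2 hy'))
      (hx x (Or.inr rfl)) (hy y (Or.inr rfl)) hIx hIy
      (fun hc => by have := hmin xs hx' hc; omega) (fun hc => by have := hmin ys hy' hc; omega)
    rw [regularModulo_append] at h ⊢
    have h1 : RegularModulo I (xs ++ [g]) :=
      (regularModulo_append _ _ _).2 ⟨h.1, h.2.exchange (hgx (hx x (Or.inr rfl)))⟩
    have hjac : maximalIdeal R ≤ (⊥ : Ideal R).jacobson := (jacobson_eq_maximalIdeal _ bot_ne_top).ge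
    have h2 := h1.move_last (fun z hz => hjac (hx' z hz))
    have hcomm : ∀ zs : List R, I ⊔ Ideal.span {g} ⊔ Ideal.ofList zs =
        I ⊔ Ideal.ofList zs ⊔ Ideal.span {g} := fun zs => by
      rw [sup_assoc, sup_comm (Ideal.span {g}), ← sup_assoc]
    have h3 : RegularModulo (I ⊔ Ideal.span {g}) ys := by
      refine ih _ xs ys hxn hyn (sup_le hI (by simpa [Ideal.span_le] using hg)) hx' hy'
        (by rwa [hcomm]) (by rwa [hcomm]) ?_ h2.2
      intro zs hzs hz
      have := hmin (g :: zs) (by simpa using ⟨hg, hzs⟩) (by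
        rwa [Ideal.ofList_cons, ← sup_assoc])
      simpa using this
    have h4 := RegularModulo.move_first (hjac hg) (show RegularModulo I (g :: ys) from ⟨h2.1, h3⟩)
    rw [regularModulo_append] at h4
    exact ⟨h4.1, h4.2.exchange (hIy hg)⟩

end RegularModulo

end SOData

/-! ### Linear independence over a regular sequence; heights in polynomial rings -/

namespace SOData

open Module

/-- A relation with coefficients in k[f] is first read modulo f 0, where induction on r kills the
terms constant in the first variable. What remains is divisible by f 0, which is cancelled by
regularity, and the degree in the first variable drops. -/
theorem RegularModulo.polynomial_independent {k S : Type*} [Field k] [CommRing S] [Algebra k S]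
    {r : ℕ} (f : Fin r → S) (I : Ideal S) (h : RegularModulo I (List.ofFn f)) {ι : Type*} (t : ι → S)
    (ht : ∀ c : ι →₀ k, (c.sum fun s a => a • t s) ∈ I ⊔ Ideal.span (Set.range f) → c = 0)
    (p : ι →₀ MvPolynomial (Fin r) k)
    (hp : (p.sum fun s q => MvPolynomial.aeval f q * t s) ∈ I) : p = 0 := by
  induction r generalizing I with
  | zero =>
    let e := MvPolynomial.isEmptyAlgEquiv k (Fin 0)
    have he : ∀ q, MvPolynomial.aeval f q = algebraMap k S (e q) := by
      intro q
      obtain ⟨c, rfl⟩ := MvPolynomial.C_surjective (Fin 0) q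
      rw [MvPolynomial.aeval_C]
      congr 1
      exact (e.commutes c).symm
    have h1 := ht (p.mapRange e (map_zero _)) (by
      rw [Finsupp.sum_mapRange_index (by simp)]
      apply Ideal.mem_sup_left
      simpa only [he, Algebra.smul_def] using hp)
    ext1 s
    have h2 := DFunLike.congr_fun h1 s
    simpa using h2
  | succ r ih =>
    rw [List.ofFn_succ] at h
    let e := MvPolynomial.finSuccEquiv k r
    let ev : Polynomial (MvPolynomial (Fin r) k) →+* S :=
      Polynomial.eval₂RingHom (MvPolynomial.aeval (fun i : Fin r => f i.succ)).toRingHom (f 0)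
    have hev : ∀ q, MvPolynomial.aeval f q = ev (e q) := by
      intro q
      have : (MvPolynomial.aeval f : MvPolynomial (Fin (r+1)) k →ₐ[k] S).toRingHom
          = ev.comp (e : _ →+* _) := by
        apply MvPolynomial.ringHom_ext
        · intro c
          simp [ev, e, MvPolynomial.finSuccEquiv_apply]
        · intro i
          refine Fin.cases ?_ (fun j => ?_) i
          · simp [ev, e, MvPolynomial.finSuccEquiv_X_zero]
          · simp [ev, e, MvPolynomial.finSuccEquiv_X_succ]
      exact RingHom.congr_fun this q
    have hrange : I ⊔ Ideal.span {f 0} ⊔ Ideal.span (Set.range fun i : Fin r => f i.succ) =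
        I ⊔ Ideal.span (Set.range f) := by
      rw [sup_assoc, ← Ideal.span_union]
      congr 2
      ext x
      simp only [Set.mem_union, Set.mem_singleton_iff, Set.mem_range, Fin.exists_fin_succ, eq_comm]
    have key : ∀ (D : ℕ) (P : ι →₀ Polynomial (MvPolynomial (Fin r) k)),
        (∀ s, (P s).degree < D) → (P.sum fun s q => ev q * t s) ∈ I → P = 0 := by
      intro D
      induction D with
      | zero =>
        intro P hP _
        ext1 s
        simpa [Polynomial.degree_eq_bot, Nat.WithBot.lt_zero_iff] using hP s
      | succ D ihD =>
        intro P hP hPI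
        let P0 : ι →₀ MvPolynomial (Fin r) k := P.mapRange (fun q => q.coeff 0) (by simp)
        let P1 : ι →₀ Polynomial (MvPolynomial (Fin r) k) := P.mapRange Polynomial.divX (by simp)
        have hsplit : (P.sum fun s q => ev q * t s) = f 0 * (P1.sum fun s q => ev q * t s) +
            P0.sum fun s q => MvPolynomial.aeval (fun i : Fin r => f i.succ) q * t s := by
          have hs1 : (P1.sum fun s q => ev q * t s) = P.sum fun s q => ev q.divX * t s :=
            Finsupp.sum_mapRange_index (by simp)
          have hs0 : (P0.sum fun s q => MvPolynomial.aeval (fun i : Fin r => f i.succ) q * t s) =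
              P.sum fun s q => MvPolynomial.aeval (fun i : Fin r => f i.succ) (q.coeff 0) * t s :=
            Finsupp.sum_mapRange_index (by simp)
          rw [hs1, hs0, Finsupp.mul_sum, ← Finsupp.sum_add]
          refine Finsupp.sum_congr fun s _ => ?_
          conv_lhs => rw [← Polynomial.divX_mul_X_add (P s)]
          simp only [map_add, map_mul, ev, Polynomial.coe_eval₂RingHom, Polynomial.eval₂_X,
            Polynomial.eval₂_C]
          simp only [AlgHom.toRingHom_eq_coe, RingHom.coe_coe]
          ring
        have hP0 : P0 = 0 := by
          refine ih (fun i => f i.succ) (I ⊔ Ideal.span {f 0}) h.2 (by rwa [hrange]) P0 ?_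
          rw [hsplit] at hPI
          refine mem_sup_span_singleton.2 ⟨_, hPI, -(P1.sum fun s q => ev q * t s), by ring⟩
        have hP1 : P1 = 0 := by
          refine ihD P1 (fun s => ?_) (h.1 _ ?_)
          · by_cases hs : P s = 0
            · simp [P1, hs, Polynomial.divX_zero]
            · have h1 := Polynomial.degree_divX_lt hs
              have h2 := hP s
              simp only [P1, Finsupp.mapRange_apply]
              by_cases hd : (P s).divX = 0
              · simp [hd]
              · rw [Polynomial.degree_eq_natDegree hs] at h1 h2
                rw [Polynomial.degree_eq_natDegree hd] at h1 ⊢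
                norm_cast at *
                omega
          · rw [hsplit, hP0] at hPI
            simpa using hPI
        ext1 s
        rw [← Polynomial.divX_mul_X_add (P s)]
        have h1 : (P s).divX = 0 := by simpa [P1] using DFunLike.congr_fun hP1 s
        have h2 : (P s).coeff 0 = 0 := DFunLike.congr_fun hP0 s
        rw [h1, h2]; simp
    have h1 := key ((p.support.sup fun s => (e (p s)).natDegree) + 1)
      (p.mapRange e (map_zero _)) (fun s => by
        rw [Finsupp.mapRange_apply]
        refine lt_of_le_of_lt Polynomial.degree_le_natDegree ?_
        norm_cast
        by_cases hs : s ∈ p.support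
        · exact Nat.lt_succ_of_le (Finset.le_sup (f := fun s => (e (p s)).natDegree) hs)
        · rw [Finsupp.notMem_support_iff.1 hs]; simp) (by
        rw [Finsupp.sum_mapRange_index (by simp)]
        simpa only [hev] using hp)
    ext1 s
    have h2 := DFunLike.congr_fun h1 s
    simpa using h2

theorem RegularModulo.map_localization {R S : Type*} [CommRing R] [CommRing S] [Algebra R S]
    (M : Submonoid R) [IsLocalization M S] {I : Ideal R} {xs : List R} (h : RegularModulo I xs) :
    RegularModulo (I.map (algebraMap R S)) (xs.map (algebraMap R S)) := by
  induction xs generalizing I with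
  | nil => trivial
  | cons x xs ih =>
    refine ⟨fun a ha => ?_, ?_⟩
    · obtain ⟨b, s, rfl⟩ := IsLocalization.exists_mk'_eq M a
      rw [IsLocalization.mul_mk'_eq_mk'_of_mul, IsLocalization.mk'_mem_map_algebraMap_iff M] at ha
      obtain ⟨u, hu, hu'⟩ := ha
      rw [IsLocalization.mk'_mem_map_algebraMap_iff M]
      exact ⟨u, hu, h.1 _ (by rwa [mul_left_comm] at hu')⟩
    · have := ih h.2
      rwa [Ideal.map_sup, Ideal.map_span, Set.image_singleton] at this

section MvPolynomial

variable {k : Type*} [Field k] {σ : Type*}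

theorem regularModulo_X (s : Set σ) (l : List σ) (hl : l.Nodup) (hs : ∀ i ∈ l, i ∉ s) :
    RegularModulo (Ideal.span (MvPolynomial.X '' s : Set (MvPolynomial σ k)))
      (l.map MvPolynomial.X) := by
  induction l generalizing s with
  | nil => trivial
  | cons i l ih =>
    refine ⟨fun a ha => ?_, ?_⟩
    · rw [MvPolynomial.mem_ideal_span_X_image] at ha ⊢
      intro m hm
      obtain ⟨j, hj, hmj⟩ := ha (Finsupp.single i 1 + m) (by
        rw [MvPolynomial.mem_support_iff, MvPolynomial.coeff_X_mul]
        exact MvPolynomial.mem_support_iff.1 hm)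
      refine ⟨j, hj, ?_⟩
      have hij : i ≠ j := by rintro rfl; exact hs i List.mem_cons_self hj
      simpa [Finsupp.single_apply, hij] using hmj
    · rw [← Ideal.span_union, Set.union_comm, ← Set.image_singleton, ← Set.image_union]
      refine ih _ hl.of_cons fun j hj => ?_
      rintro (rfl | h)
      · exact (List.nodup_cons.1 hl).1 hj
      · exact hs j (List.mem_cons_of_mem _ hj) h

/-- All maximal ideals of a polynomial ring over an algebraically closed field have
the same height. -/
theorem height_ker_aeval [IsAlgClosed k] [Finite σ] (a : σ → k) :
    (RingHom.ker (MvPolynomial.aeval a : MvPolynomial σ k →ₐ[k] k)).height = Nat.card σ := by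
  have : FiniteRingKrullDim (MvPolynomial σ k) := by
    rw [finiteRingKrullDim_iff_ne_bot_and_top, MvPolynomial.ringKrullDim_of_isNoetherianRing,
      ringKrullDim_eq_zero_of_field, zero_add]
    exact ⟨by exact_mod_cast WithBot.coe_ne_bot, by
      intro h
      have h2 : ((Nat.card σ : ℕ∞) : WithBot ℕ∞) = ((⊤ : ℕ∞) : WithBot ℕ∞) := h
      exact ENat.natCast_ne_top _ (WithBot.coe_injective h2)⟩
  -- Some maximal ideal attains the Krull dimension. By the Nullstellensatz it belongs to a point b,
  -- and a translation of affine space carries b to a.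
  obtain ⟨p, hp, hpd⟩ := Ideal.exists_isMaximal_height (R := MvPolynomial σ k)
  rw [MvPolynomial.ringKrullDim_of_isNoetherianRing, ringKrullDim_eq_zero_of_field, zero_add] at hpd
  have hpd' : p.height = Nat.card σ := WithBot.coe_injective hpd
  obtain ⟨b, rfl⟩ := MvPolynomial.isMaximal_iff_eq_vanishingIdeal_singleton.1 hp
  let tr : (σ → k) → (MvPolynomial σ k →ₐ[k] MvPolynomial σ k) := fun c =>
    MvPolynomial.aeval fun i => MvPolynomial.X i + MvPolynomial.C (c i)
  have htr : ∀ c, (tr (-c)).comp (tr c) = AlgHom.id k _ := fun c => by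
    ext i; simp [tr]
  let e : MvPolynomial σ k ≃ₐ[k] MvPolynomial σ k :=
    AlgEquiv.ofAlgHom (tr (a - b)) (tr (-(a - b))) (by simpa using htr (-(a-b))) (htr _)
  have he : ∀ p, MvPolynomial.aeval b (e p) = (MvPolynomial.aeval a p : k) := by
    intro p
    have : (MvPolynomial.aeval b : MvPolynomial σ k →ₐ[k] k).comp (tr (a - b)) =
        MvPolynomial.aeval a := by
      ext i; simp [tr]
    exact DFunLike.congr_fun this p
  rw [← hpd', ← RingEquiv.height_comap e.toRingEquiv (MvPolynomial.vanishingIdeal k {b})]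
  congr 1
  ext p
  rw [RingHom.mem_ker, Ideal.mem_comap, MvPolynomial.mem_vanishingIdeal_singleton_iff, ← he p]
  rfl

end MvPolynomial

end SOData

/-! ### Systems of parameters in the local ring at the origin -/

namespace SOData

open Module

section LocalRing

open IsLocalRing

theorem maximalIdeal_le_radical_iff {R : Type*} [CommRing R] [IsLocalRing R] {I : Ideal R} :
    maximalIdeal R ≤ I.radical ↔ ∀ q : Ideal R, q.IsPrime → I ≤ q → maximalIdeal R ≤ q := by
  rw [Ideal.radical_eq_sInf, le_sInf_iff]
  exact ⟨fun h q hq hI => h q ⟨hI, hq⟩, fun h q hq => h q hq.2 hq.1⟩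

theorem height_maximalIdeal_le_length {R : Type*} [CommRing R] [IsLocalRing R] [IsNoetherianRing R]
    (zs : List R) (hz : ∀ z ∈ zs, z ∈ maximalIdeal R)
    (h : maximalIdeal R ≤ (Ideal.ofList zs).radical) :
    (maximalIdeal R).height ≤ zs.length := by
  classical
  have h1 : maximalIdeal R ∈ (Ideal.span (zs.toFinset : Set R)).minimalPrimes := by
    have h2 : Ideal.span (zs.toFinset : Set R) = Ideal.ofList zs := by
      simp [Ideal.ofList]
    rw [h2]
    refine ⟨⟨inferInstance, ofList_le_iff.2 hz⟩, fun q hq _ => ?_⟩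
    exact maximalIdeal_le_radical_iff.1 h q hq.1 hq.2
  refine (Ideal.height_le_card_of_mem_minimalPrimes_span_finset h1).trans ?_
  exact_mod_cast List.toFinset_card_le zs

/-- By the converse of Krull's height theorem, the maximal ideal of R/I is minimal over as many
elements as its height. Their lifts to R are the list g. -/
theorem exists_parameters {R : Type*} [CommRing R] [IsLocalRing R] [IsNoetherianRing R]
    (I : Ideal R) (hI : I ≤ maximalIdeal R) :
    ∃ g : List R, (∀ z ∈ g, z ∈ maximalIdeal R) ∧
      maximalIdeal R ≤ (I ⊔ Ideal.ofList g).radical ∧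
      ((g.length : ℕ∞) : WithBot ℕ∞) ≤ ringKrullDim (R ⧸ I) := by
  classical
  let φ := Ideal.Quotient.mk I
  have hφ : Function.Surjective φ := Ideal.Quotient.mk_surjective
  have hker : RingHom.ker φ ≤ maximalIdeal R := by rwa [Ideal.mk_ker]
  have hp : ((maximalIdeal R).map φ).IsPrime := Ideal.map_isPrime_of_surjective hφ hker
  obtain ⟨s, hs, hcard⟩ := Ideal.exists_finset_card_eq_height_of_isNoetherianRing
    ((maximalIdeal R).map φ)
  choose lift hlift using hφ
  refine ⟨s.toList.map lift, ?_, ?_, ?_⟩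
  · intro z hz
    obtain ⟨t, ht, rfl⟩ := List.mem_map.1 hz
    have h1 : t ∈ (maximalIdeal R).map φ := hs.1.2 (Ideal.subset_span (by simpa using ht))
    have h2 : lift t ∈ ((maximalIdeal R).map φ).comap φ := by
      rw [Ideal.mem_comap, hlift]; exact h1
    rwa [Ideal.comap_map_of_surjective' _ Ideal.Quotient.mk_surjective, sup_eq_left.2 hker] at h2
  · rw [maximalIdeal_le_radical_iff]
    intro q hq hle
    have hqI : RingHom.ker φ ≤ q := by rw [Ideal.mk_ker]; exact le_sup_left.trans hle
    have hq' : (q.map φ).IsPrime :=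
      Ideal.map_isPrime_of_surjective Ideal.Quotient.mk_surjective hqI
    have hsq : Ideal.span (s : Set (R ⧸ I)) ≤ q.map φ := by
      rw [Ideal.span_le]
      intro t ht
      rw [SetLike.mem_coe, ← hlift t]
      refine Ideal.mem_map_of_mem _ (ofList_le_iff.1 (le_sup_right.trans hle) _ ?_)
      exact List.mem_map_of_mem (by simpa using ht)
    have h1 := hs.2 ⟨hq', hsq⟩ (Ideal.map_mono (le_maximalIdeal hq.ne_top))
    have h2 := Ideal.comap_mono (f := φ) h1
    rw [Ideal.comap_map_of_surjective' _ Ideal.Quotient.mk_surjective,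
      Ideal.comap_map_of_surjective' _ Ideal.Quotient.mk_surjective, sup_eq_left.2 hker,
      sup_eq_left.2 hqI] at h2
    exact h2
  · rw [List.length_map, Finset.length_toList]
    rw [hcard]
    exact Ideal.height_le_ringKrullDim_of_isPrime

end LocalRing

section Origin

open MvPolynomial IsLocalRing

variable {k : Type*} [Field k] {σ : Type*}

theorem ker_aeval_zero_eq_span :
    RingHom.ker (aeval (0 : σ → k) : MvPolynomial σ k →ₐ[k] k) =
      Ideal.span (X '' (Set.univ : Set σ)) := by
  ext p
  rw [mem_ideal_span_X_image, RingHom.mem_ker]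
  have : aeval (0 : σ → k) p = coeff 0 p := by
    simp [constantCoeff_eq]
  rw [this]
  constructor
  · intro h m hm
    by_contra hcon
    push Not at hcon
    have : m = 0 := by ext i; simpa using hcon i trivial
    rw [this, MvPolynomial.mem_support_iff] at hm
    exact hm h
  · intro h
    by_contra hcon
    obtain ⟨i, _, hi⟩ := h 0 (MvPolynomial.mem_support_iff.2 hcon)
    simp at hi

instance (a : σ → k) : (RingHom.ker (aeval a : MvPolynomial σ k →ₐ[k] k)).IsPrime :=
  RingHom.ker_isPrime _

variable (k σ) in
/-- The local ring of affine space at the origin. -/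
abbrev LocalRingAtOrigin : Type _ :=
  Localization.AtPrime (RingHom.ker (aeval (0 : σ → k) : MvPolynomial σ k →ₐ[k] k))

theorem ringKrullDim_quotient_map_le {R S : Type*} [CommRing R] [CommRing S] [Algebra R S]
    (M : Submonoid R) [IsLocalization M S] (I : Ideal R) :
    ringKrullDim (S ⧸ I.map (algebraMap R S)) ≤ ringKrullDim (R ⧸ I) := by
  let ψ : R ⧸ I →+* S ⧸ I.map (algebraMap R S) :=
    Ideal.quotientMap _ (algebraMap R S) Ideal.le_comap_map
  refine Order.krullDim_le_of_strictMono (PrimeSpectrum.comap ψ) ?_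
  refine Monotone.strictMono_of_injective (fun p q h => Ideal.comap_mono h) ?_
  have h1 : Function.Injective
      (PrimeSpectrum.comap ((Ideal.Quotient.mk (I.map (algebraMap R S))).comp (algebraMap R S))) := by
    rw [PrimeSpectrum.comap_comp]
    exact (PrimeSpectrum.localization_comap_injective S M).comp
      (PrimeSpectrum.comap_injective_of_surjective _ Ideal.Quotient.mk_surjective)
  have h2 : (Ideal.Quotient.mk (I.map (algebraMap R S))).comp (algebraMap R S) =
      ψ.comp (Ideal.Quotient.mk I) := by
    ext x; simp [ψ]
  rw [h2, PrimeSpectrum.comap_comp] at h1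
  exact h1.of_comp

/-- By the dimension hypothesis, f followed by parameters of the quotient is a list of exactly dim S
elements, hence a system of parameters. The variables form another one, and they are visibly a
regular sequence, so the extended list is regular too. -/
theorem regularModulo_localRingAtOrigin [IsAlgClosed k] [Fintype σ] {r : ℕ}
    (f : Fin r → MvPolynomial σ k) (hf : ∀ j, aeval (0 : σ → k) (f j) = 0)
    (hdim : ringKrullDim (MvPolynomial σ k ⧸ Ideal.span (Set.range f)) + (r : WithBot ℕ∞) ≤
      (Fintype.card σ : WithBot ℕ∞)) :
    RegularModulo (⊥ : Ideal (LocalRingAtOrigin k σ))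
      (List.ofFn fun j => algebraMap _ (LocalRingAtOrigin k σ) (f j)) := by
  classical
  set m0 := RingHom.ker (aeval (0 : σ → k) : MvPolynomial σ k →ₐ[k] k) with hm0
  let S := LocalRingAtOrigin k σ
  let F : List S := List.ofFn fun j => algebraMap _ S (f j)
  have hmem : ∀ p : MvPolynomial σ k, aeval (0 : σ → k) p = 0 →
      algebraMap _ S p ∈ maximalIdeal S := fun p hp => by
    rw [IsLocalization.AtPrime.to_map_mem_maximal_iff S m0]
    exact hp
  have hht : (maximalIdeal S).height = Fintype.card σ := by
    have h1 : ringKrullDim S = m0.height := IsLocalization.AtPrime.ringKrullDim_eq_height m0 S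
    rw [← maximalIdeal_height_eq_ringKrullDim] at h1
    rw [WithBot.coe_injective h1, hm0, height_ker_aeval, Nat.card_eq_fintype_card]
  have hF : ∀ z ∈ F, z ∈ maximalIdeal S := by
    intro z hz
    obtain ⟨j, rfl⟩ := (List.mem_ofFn' _ _).1 hz
    exact hmem _ (hf j)
  have hFspan : Ideal.ofList F = (Ideal.span (Set.range f)).map (algebraMap _ S) := by
    rw [Ideal.map_span, ← Set.range_comp, Ideal.ofList]
    congr 1
    ext z
    exact List.mem_ofFn' _ _
  obtain ⟨g, hg, hgm, hgd⟩ := exists_parameters (Ideal.ofList F) (ofList_le_iff.2 hF)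
  have hmin : ∀ zs : List S, (∀ z ∈ zs, z ∈ maximalIdeal S) →
      maximalIdeal S ≤ (⊥ ⊔ Ideal.ofList zs).radical → Fintype.card σ ≤ zs.length := by
    intro zs hzs h
    rw [bot_sup_eq] at h
    have := height_maximalIdeal_le_length zs hzs h
    rw [hht] at this
    exact_mod_cast this
  have hmem' : ∀ z ∈ F ++ g, z ∈ maximalIdeal S := by
    intro z hz
    rcases List.mem_append.1 hz with h | h
    exacts [hF z h, hg z h]
  have hrad : maximalIdeal S ≤ (⊥ ⊔ Ideal.ofList (F ++ g)).radical := by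
    rwa [bot_sup_eq, Ideal.ofList_append]
  have hlen : (F ++ g).length = Fintype.card σ := by
    refine le_antisymm ?_ (hmin _ hmem' hrad)
    have h1 : ((g.length : ℕ∞) : WithBot ℕ∞) ≤
        ringKrullDim (MvPolynomial σ k ⧸ Ideal.span (Set.range f)) := by
      refine hgd.trans ?_
      rw [hFspan]
      exact ringKrullDim_quotient_map_le m0.primeCompl _
    have h2 := (add_le_add_left h1 (r : WithBot ℕ∞)).trans hdim
    have h3 : g.length + r ≤ Fintype.card σ := by exact_mod_cast h2
    simp only [List.length_append, F, List.length_ofFn]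
    omega
  have hX : RegularModulo (⊥ : Ideal S)
      ((Finset.univ.toList.map (X : σ → MvPolynomial σ k)).map (algebraMap _ S)) := by
    have := (regularModulo_X (k := k) (∅ : Set σ) Finset.univ.toList (Finset.nodup_toList _)
      (by simp)).map_localization (S := S) m0.primeCompl
    simpa using this
  refine ((regularModulo_append _ _ g).1 (RegularModulo.of_systemOfParameters (Fintype.card σ) ⊥
    _ (F ++ g) (by simp) hlen bot_le ?_ hmem' ?_ hrad hmin hX)).1
  · intro z hz
    simp only [List.mem_map, Finset.mem_toList, Finset.mem_univ, true_and] at hz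
    obtain ⟨_, ⟨i, rfl⟩, rfl⟩ := hz
    exact hmem _ (by simp)
  · refine le_trans ?_ Ideal.le_radical
    have hspan : m0 = Ideal.span (X '' (Set.univ : Set σ)) := ker_aeval_zero_eq_span
    have hmax : maximalIdeal S = m0.map (algebraMap _ S) :=
      (Localization.AtPrime.map_eq_maximalIdeal (I := m0)).symm
    rw [bot_sup_eq, hmax, congrArg (Ideal.map (algebraMap _ S)) hspan, Ideal.map_span]
    refine Ideal.span_mono ?_
    rintro _ ⟨_, ⟨i, _, rfl⟩, rfl⟩
    simp

end Origin

end SOData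

/-! ### Flatness of homogeneous polynomial maps -/

namespace SOData

open Module

section Homogeneous

open MvPolynomial

variable {k : Type*} [Field k] {σ : Type*}

attribute [local instance] MvPolynomial.gradedAlgebra in
theorem homogeneousComponent_mul_right {p q : MvPolynomial σ k} {j : ℕ} (hq : q.IsHomogeneous j)
    (n : ℕ) : homogeneousComponent n (p * q) =
      if j ≤ n then homogeneousComponent (n - j) p * q else 0 := by
  have h := DirectSum.coe_decompose_mul_of_right_mem (homogeneousSubmodule σ k) (a := p) n
    ((mem_homogeneousSubmodule j q).2 hq)
  have h1 : ∀ (x : MvPolynomial σ k) i,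
      (DirectSum.decompose (homogeneousSubmodule σ k) x i : MvPolynomial σ k) =
        homogeneousComponent i x := fun x i => decomposition.decompose'_apply x i
  rwa [h1, h1] at h

variable {ι : Type*} [Fintype ι] {f : ι → MvPolynomial σ k} {d : ι → ℕ}

theorem homogeneousComponent_mem_span (hf : ∀ j, (f j).IsHomogeneous (d j))
    {a : MvPolynomial σ k} (ha : a ∈ Ideal.span (Set.range f)) (n : ℕ) :
    ∃ b : ι → MvPolynomial σ k, homogeneousComponent n a =
      ∑ j, (if d j ≤ n then homogeneousComponent (n - d j) (b j) * f j else 0) := by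
  obtain ⟨b, rfl⟩ := Ideal.mem_span_range_iff_exists_fun.1 ha
  refine ⟨b, ?_⟩
  rw [map_sum]
  exact Finset.sum_congr rfl fun j _ => homogeneousComponent_mul_right (hf j) n

theorem homogeneousComponent_mem (hf : ∀ j, (f j).IsHomogeneous (d j))
    {a : MvPolynomial σ k} (ha : a ∈ Ideal.span (Set.range f)) (n : ℕ) :
    homogeneousComponent n a ∈ Ideal.span (Set.range f) := by
  obtain ⟨b, hb⟩ := homogeneousComponent_mem_span hf ha n
  rw [hb]
  refine Ideal.sum_mem _ fun j _ => ?_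
  split_ifs
  · exact Ideal.mul_mem_left _ _ (Ideal.subset_span ⟨j, rfl⟩)
  · exact Ideal.zero_mem _

/-- A homogeneous ideal is recovered from its localization at the origin. If sa ∈ I with s(0) ≠ 0,
the degree n component of sa is s(0)aₙ plus multiples of lower components of a, and induction on n
puts every aₙ in I. -/
theorem mem_span_of_map_mem (hf : ∀ j, (f j).IsHomogeneous (d j)) {a : MvPolynomial σ k}
    (ha : algebraMap _ (LocalRingAtOrigin k σ) a ∈
      (Ideal.span (Set.range f)).map (algebraMap _ (LocalRingAtOrigin k σ))) :
    a ∈ Ideal.span (Set.range f) := by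
  set I := Ideal.span (Set.range f)
  obtain ⟨s, hs, hsa⟩ := (IsLocalization.algebraMap_mem_map_algebraMap_iff
    (RingHom.ker (aeval (0 : σ → k) : MvPolynomial σ k →ₐ[k] k)).primeCompl _ I a).1 ha
  have hs0 : constantCoeff s ≠ 0 := by
    intro h
    refine hs ?_
    change aeval (0 : σ → k) s = 0
    simpa using h
  have key : ∀ n, homogeneousComponent n a ∈ I := by
    intro n
    induction n using Nat.strong_induction_on with
    | _ n ih =>
      have h1 := homogeneousComponent_mem hf hsa n
      have h2 : homogeneousComponent n (s * a) = ∑ j ∈ Finset.range (a.totalDegree + 1),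
          (if j ≤ n then homogeneousComponent (n - j) s * homogeneousComponent j a else 0) := by
        conv_lhs => rw [← sum_homogeneousComponent a, Finset.mul_sum, map_sum]
        exact Finset.sum_congr rfl fun j _ =>
          homogeneousComponent_mul_right (homogeneousComponent_isHomogeneous j a) n
      by_cases hn : n ∈ Finset.range (a.totalDegree + 1)
      · rw [h2, ← Finset.add_sum_erase _ _ hn] at h1
        have h3 : ∑ j ∈ (Finset.range (a.totalDegree + 1)).erase n,
            (if j ≤ n then homogeneousComponent (n - j) s * homogeneousComponent j a else 0) ∈ I := by
          refine Ideal.sum_mem _ fun j hj => ?_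
          split_ifs with hjn
          · exact Ideal.mul_mem_left _ _ (ih j (lt_of_le_of_ne hjn (Finset.mem_erase.1 hj).1))
          · exact Ideal.zero_mem _
        have h4 := (Ideal.add_mem_iff_left _ h3).1 h1
        rw [if_pos le_rfl, Nat.sub_self, homogeneousComponent_zero] at h4
        have h5 := Ideal.mul_mem_left I (C (constantCoeff s)⁻¹) h4
        rwa [← mul_assoc, ← C_mul, ← constantCoeff_eq, inv_mul_cancel₀ hs0, C_1, one_mul] at h5
      · rw [homogeneousComponent_eq_zero]
        · exact Ideal.zero_mem _
        · simpa using hn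
  rw [← sum_homogeneousComponent a]
  exact Ideal.sum_mem _ fun j _ => key j

/-- The polynomial ring is free over ℂ[f]-type coefficients, with a basis of monomials lifting a
k-basis of the quotient by I. Independence comes from the regular sequence at the origin, and
generation from a graded form of Nakayama's lemma. -/
theorem flat_aeval_of_isHomogeneous_fin [IsAlgClosed k] [Fintype σ] {r : ℕ}
    {f : Fin r → MvPolynomial σ k} {d : Fin r → ℕ}
    (hd : ∀ j, 0 < d j) (hf : ∀ j, (f j).IsHomogeneous (d j))
    (hdim : ringKrullDim (MvPolynomial σ k ⧸ Ideal.span (Set.range f)) + (r : WithBot ℕ∞) ≤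
      (Fintype.card σ : WithBot ℕ∞)) :
    (aeval f : MvPolynomial (Fin r) k →ₐ[k] MvPolynomial σ k).toRingHom.Flat := by
  classical
  set I := Ideal.span (Set.range f) with hI
  have hf0 : ∀ j, aeval (0 : σ → k) (f j) = 0 := by
    intro j
    have h1 : coeff 0 (f j) = 0 := (hf j).coeff_eq_zero (by simpa using (hd j).ne)
    simp [constantCoeff_eq, h1]
  have hreg := regularModulo_localRingAtOrigin f hf0 hdim
  let v : (σ →₀ ℕ) → MvPolynomial σ k ⧸ I := fun m => Ideal.Quotient.mk I (monomial m 1)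
  obtain ⟨κ, a, ha, hspan, hli⟩ := exists_linearIndependent' k v
  let t : κ → MvPolynomial σ k := fun s => monomial (a s) 1
  let φ := (aeval f : MvPolynomial (Fin r) k →ₐ[k] MvPolynomial σ k)
  letI : Algebra (MvPolynomial (Fin r) k) (MvPolynomial σ k) := φ.toRingHom.toAlgebra
  have hsmul : ∀ (q : MvPolynomial (Fin r) k) (p : MvPolynomial σ k), q • p = aeval f q * p :=
    fun q p => rfl
  have hmk : ∀ c : κ →₀ k, Ideal.Quotient.mk I (c.sum fun s x => x • t s) =
      Finsupp.linearCombination k (v ∘ a) c := by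
    intro c
    rw [Finsupp.linearCombination_apply, Finsupp.sum, Finsupp.sum, map_sum]
    rfl
  have hind : LinearIndependent (MvPolynomial (Fin r) k) t := by
    rw [linearIndependent_iff]
    intro p hp
    refine hreg.polynomial_independent _ ⊥ (fun s => algebraMap _ (LocalRingAtOrigin k σ) (t s))
      ?_ p ?_
    · intro c hc
      rw [bot_sup_eq, Set.range_comp' (algebraMap _ (LocalRingAtOrigin k σ)) f, ← Ideal.map_span] at hc
      have h1 : (c.sum fun s x => x • t s) ∈ I := by
        refine mem_span_of_map_mem hf ?_
        rw [Finsupp.sum, map_sum]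
        simpa only [Finsupp.sum, Algebra.smul_def, map_mul, ← IsScalarTower.algebraMap_apply]
          using hc
      have h2 := hmk c
      rw [Ideal.Quotient.eq_zero_iff_mem.2 h1] at h2
      exact linearIndependent_iff.1 hli c h2.symm
    · rw [Finsupp.linearCombination_apply] at hp
      have h1 := congrArg (algebraMap _ (LocalRingAtOrigin k σ)) hp
      rw [map_zero, Finsupp.sum, map_sum] at h1
      rw [Submodule.mem_bot, ← h1, Finsupp.sum]
      refine Finset.sum_congr rfl fun s _ => ?_
      rw [hsmul, map_mul]
      congr 1
      have : (aeval (fun j => algebraMap _ (LocalRingAtOrigin k σ) (f j)) :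
          MvPolynomial (Fin r) k →ₐ[k] _) =
          (IsScalarTower.toAlgHom k (MvPolynomial σ k) (LocalRingAtOrigin k σ)).comp (aeval f) := by
        ext j; simp
      rw [this]; rfl
  let N := Submodule.span (MvPolynomial (Fin r) k) (Set.range t)
  have hcomp : ∀ (c : κ →₀ k) n, homogeneousComponent n (c.sum fun s x => x • t s) ∈ N := by
    intro c n
    rw [Finsupp.sum, map_sum]
    refine Submodule.sum_mem _ fun s _ => ?_
    rw [map_smul]
    have h1 : ∀ p ∈ N, c s • p ∈ N := by
      intro p hp
      have : c s • p = (C (c s) : MvPolynomial (Fin r) k) • p := by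
        rw [hsmul, aeval_C, Algebra.smul_def]
      rw [this]
      exact N.smul_mem _ hp
    refine h1 _ ?_
    have h2 : t s ∈ homogeneousSubmodule σ k (a s).degree :=
      (mem_homogeneousSubmodule _ _).2 (isHomogeneous_monomial _ rfl)
    rw [homogeneousComponent_of_mem h2]
    split_ifs
    · exact Submodule.subset_span ⟨s, rfl⟩
    · exact N.zero_mem
  have hhom : ∀ n (p : MvPolynomial σ k), p.IsHomogeneous n → p ∈ N := by
    intro n
    induction n using Nat.strong_induction_on with
    | _ n ih =>
      intro p hp
      have h1 : Ideal.Quotient.mk I p ∈ Submodule.span k (Set.range (v ∘ a)) := by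
        rw [hspan, ← support_sum_monomial_coeff p, map_sum]
        refine Submodule.sum_mem _ fun m _ => ?_
        have : Ideal.Quotient.mk I (monomial m (coeff m p)) = coeff m p • v m := by
          have h3 : monomial m (coeff m p) = coeff m p • monomial m (1 : k) := by
            rw [smul_monomial, smul_eq_mul, mul_one]
          rw [h3]; rfl
        rw [this]
        exact Submodule.smul_mem _ _ (Submodule.subset_span ⟨m, rfl⟩)
      obtain ⟨c, hc⟩ := Finsupp.mem_span_range_iff_exists_finsupp.1 h1
      have h2 : p - (c.sum fun s x => x • t s) ∈ I := by
        rw [← Ideal.Quotient.eq, hmk, ← hc, Finsupp.linearCombination_apply]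
      obtain ⟨b, hb⟩ := homogeneousComponent_mem_span hf h2 n
      rw [map_sub, homogeneousComponent_of_mem ((mem_homogeneousSubmodule n p).2 hp),
        if_pos rfl, sub_eq_iff_eq_add] at hb
      rw [hb]
      -- The cofactors of the f j have degree n - d j, which is below n because d j is positive, so
      -- they are already in N.
      refine N.add_mem (Submodule.sum_mem _ fun j _ => ?_) (hcomp c n)
      split_ifs with hj
      · have h4 : homogeneousComponent (n - d j) (b j) * f j =
            (X j : MvPolynomial (Fin r) k) • homogeneousComponent (n - d j) (b j) := by
          rw [hsmul, aeval_X, mul_comm]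
        rw [h4]
        exact N.smul_mem _ (ih _ (Nat.sub_lt_self (hd j) hj) _
          (homogeneousComponent_isHomogeneous _ _))
      · exact N.zero_mem
  have htop : ⊤ ≤ N := by
    intro p _
    rw [← sum_homogeneousComponent p]
    exact Submodule.sum_mem _ fun n _ => hhom n _ (homogeneousComponent_isHomogeneous n p)
  have := Module.Free.of_basis (Basis.mk hind htop)
  exact (inferInstance : Module.Flat (MvPolynomial (Fin r) k) (MvPolynomial σ k))

/-- Homogeneous polynomials of positive degree whose common zero locus has the
expected dimension define a flat morphism. -/
theorem flat_aeval_of_isHomogeneous [IsAlgClosed k] [Fintype σ]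
    (hd : ∀ j, 0 < d j) (hf : ∀ j, (f j).IsHomogeneous (d j))
    (hdim : ringKrullDim (MvPolynomial σ k ⧸ Ideal.span (Set.range f)) +
      (Fintype.card ι : WithBot ℕ∞) ≤ (Fintype.card σ : WithBot ℕ∞)) :
    (aeval f : MvPolynomial ι k →ₐ[k] MvPolynomial σ k).toRingHom.Flat := by
  let e := Fintype.equivFin ι
  have h1 := flat_aeval_of_isHomogeneous_fin (f := f ∘ e.symm) (d := d ∘ e.symm) (fun _ => hd _)
    (fun _ => hf _) (by
      rw [Set.range_comp, e.symm.range_eq_univ, Set.image_univ]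
      exact hdim)
  have h2 : (aeval f : MvPolynomial ι k →ₐ[k] MvPolynomial σ k).toRingHom =
      (aeval (f ∘ e.symm) : MvPolynomial _ k →ₐ[k] MvPolynomial σ k).toRingHom.comp
        (renameEquiv k e).toRingEquiv.toRingHom := by
    ext i
    · simp
    · simp
  rw [h2]
  exact RingHom.Flat.comp (RingHom.Flat.of_bijective (renameEquiv k e).bijective) h1

end Homogeneous

end SOData

/-! ### Transcendence degree as the rank of the algebraic matroid -/

namespace SOData

open Module

section Rank

variable {k K : Type*} [Field k] [Field K] [Algebra k K]

variable (k) in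
/-- The transcendence degree over `k` of the subfield generated by `S`. -/
noncomputable def trRank (S : Set K) : ℕ∞ := (AlgebraicIndependent.matroid k K).eRk S

variable (k) in
/-- The algebraic closure in `K` of the subfield generated by `S`. -/
noncomputable def algCl (S : Set K) : IntermediateField k K :=
  (algebraicClosure (IntermediateField.adjoin k S) K).restrictScalars k

open scoped IntermediateField.algebraAdjoinAdjoin in
theorem mem_algCl {S : Set K} {x : K} :
    x ∈ algCl k S ↔ x ∈ (AlgebraicIndependent.matroid k K).closure S := by
  rw [AlgebraicIndependent.matroid_closure_eq, SetLike.mem_coe, Subalgebra.mem_algebraicClosure,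
    IsFractionRing.isAlgebraic_iff (Algebra.adjoin k S) (IntermediateField.adjoin k S) K]
  exact mem_algebraicClosure_iff

theorem mem_algCl_of_isAlgebraic {S : Set K} {x : K} (h : IsAlgebraic (algCl k S) x) :
    x ∈ algCl k S := by
  have h2 : IsAlgebraic (algebraicClosure (IntermediateField.adjoin k S) K) x := h
  exact mem_algebraicClosure_iff.2 (IsAlgebraic.restrictScalars _ h2)

theorem mem_algCl_of_isAlgebraic_subalgebra {S : Set K} {F : Type*} [CommRing F]
    [Algebra F K] {x : K} (A : Subalgebra F K) (hA : ∀ a ∈ A, a ∈ algCl k S)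
    (h : IsAlgebraic A x) : x ∈ algCl k S := by
  obtain ⟨p, hp, hx⟩ := h
  refine mem_algCl_of_isAlgebraic ?_
  let φ : A →+* algCl k S := (algebraMap A K).codRestrict (algCl k S) (fun a => hA a a.2)
  have hφ : Function.Injective φ := fun a b hab =>
    Subtype.val_injective (congrArg (fun z : algCl k S => (z : K)) hab)
  refine ⟨p.map φ, (Polynomial.map_ne_zero_iff hφ).2 hp, ?_⟩
  rw [Polynomial.aeval_def, Polynomial.eval₂_map]
  exact hx

theorem coe_algCl (S : Set K) :
    (algCl k S : Set K) = (AlgebraicIndependent.matroid k K).closure S :=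
  Set.ext fun _ => mem_algCl

theorem subset_algCl (S : Set K) : S ⊆ algCl k S := by
  rw [coe_algCl]
  exact Matroid.subset_closure _ _ (by simp)

theorem algCl_mono {S T : Set K} (h : S ⊆ T) : (algCl k S : Set K) ⊆ algCl k T := by
  rw [coe_algCl, coe_algCl]
  exact Matroid.closure_subset_closure _ h

theorem trRank_mono {S T : Set K} (h : S ⊆ T) : trRank k S ≤ trRank k T :=
  Matroid.eRk_mono _ h

theorem trRank_mono_algCl {S T : Set K} (h : S ⊆ algCl k T) : trRank k S ≤ trRank k T := by
  rw [coe_algCl] at h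
  exact (Matroid.eRk_mono _ h).trans (Matroid.eRk_closure_eq _ _).le

theorem trRank_union_le (S T : Set K) : trRank k (S ∪ T) ≤ trRank k S + T.encard :=
  Matroid.eRk_union_le_eRk_add_encard _ _ _

theorem trRank_union_range_le {ι κ : Type*} [Finite κ] (S : Set K) (x : ι → K) (y : κ → K)
    (h : ∀ i, x i ∈ algCl k (S ∪ Set.range y)) :
    trRank k (S ∪ Set.range x) ≤ trRank k S + Nat.card κ := by
  have h1 : trRank k (S ∪ Set.range x) ≤ trRank k (S ∪ Set.range y) := by
    refine trRank_mono_algCl (Set.union_subset ?_ ?_)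
    · exact Set.subset_union_left.trans (subset_algCl _)
    · rintro _ ⟨i, rfl⟩; exact h i
  refine h1.trans ((trRank_union_le S _).trans ?_)
  gcongr
  rw [← Set.image_univ]
  refine (Set.encard_image_le _ _).trans ?_
  rw [Set.encard_univ, ENat.card_eq_coe_natCard]

/-- Linear equations over the field generated by `S` bound the rank. -/
theorem trRank_union_range_le_finrank {ι : Type*} [Fintype ι] (S : Set K) (x : ι → K)
    (E : Submodule (algCl k S) (ι → algCl k S))
    (hE : ∀ Y : ι → algCl k S,
      (∀ v : ι → algCl k S, ∑ i, (v i : K) * x i ∈ algCl k S → ∑ i, v i * Y i = 0) → Y ∈ E) :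
    trRank k (S ∪ Set.range x) ≤ trRank k S + finrank (algCl k S) E := by
  classical
  let F := algCl k S
  let ev : (ι → F) →ₗ[F] K := Fintype.linearCombination F x
  have hev : ∀ v, ev v = ∑ i, (v i : K) * x i := fun v => by
    simp [ev, Fintype.linearCombination_apply, Algebra.smul_def]
  -- R consists of the linear forms over F whose value at x lies in F. Coordinates forming a basis
  -- modulo R determine all entries of x over F. Their number is the dimension of the orthogonal
  -- complement of R, and `hE` says that this complement lies in E.
  let R : Submodule F (ι → F) := (LinearMap.range (Algebra.linearMap F K)).comap ev
  have hR : ∀ v, v ∈ R ↔ ev v ∈ F := fun v => by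
    simp [R, Subtype.exists]
  obtain ⟨κ, a, ha, hspan, hli⟩ := exists_linearIndependent' F
    (fun i : ι => R.mkQ (Pi.single i 1))
  have : Finite κ := Finite.of_injective a ha
  have : Fintype κ := Fintype.ofFinite κ
  have hcard : Nat.card κ ≤ finrank F E := by
    have h1 : Nat.card κ ≤ finrank F ((ι → F) ⧸ R) := by
      rw [Nat.card_eq_fintype_card]; exact hli.fintype_card_le_finrank
    let B : LinearMap.BilinForm F (ι → F) := dotProductBilin F F
    have hB : B.Nondegenerate := by
      refine ⟨fun v hv => dotProduct_eq_zero_iff.1 hv, fun v hv => dotProduct_eq_zero_iff.1 ?_⟩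
      intro w
      rw [dotProduct_comm]
      exact hv w
    have h2 : B.orthogonal R ≤ E := by
      intro Y hY
      refine hE Y fun v hv => ?_
      have := LinearMap.BilinForm.mem_orthogonal_iff.1 hY v ((hR v).2 (by rwa [hev]))
      exact this
    have h3 := LinearMap.BilinForm.finrank_orthogonal hB (W := R)
    have h4 := Submodule.finrank_mono h2
    have h5 := R.finrank_quotient_add_finrank
    have h6 : finrank F ((ι → F) ⧸ R) = finrank F (B.orthogonal R) := by omega
    exact h1.trans (h6.le.trans h4)
  have key : ∀ i, x i ∈ algCl k (S ∪ Set.range (x ∘ a)) := by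
    intro i
    have h1 : R.mkQ (Pi.single i 1) ∈ Submodule.span F (Set.range
        ((fun i : ι => R.mkQ (Pi.single i 1)) ∘ a)) := by
      rw [hspan]; exact Submodule.subset_span ⟨i, rfl⟩
    obtain ⟨c, hc⟩ := (Submodule.mem_span_range_iff_exists_fun F).1 h1
    have h2 : Pi.single i 1 - ∑ j, c j • (Pi.single (a j) 1 : ι → F) ∈ R := by
      rw [← Submodule.ker_mkQ R, LinearMap.mem_ker, map_sub, map_sum, ← hc, sub_eq_zero]
      simp
    rw [hR, map_sub, map_sum] at h2
    have h3 : ∀ j, ev (Pi.single j 1) = x j := fun j => by simp [ev]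
    simp only [map_smul, h3] at h2
    have hsub := algCl_mono (k := k) (Set.subset_union_left (s := S) (t := Set.range (x ∘ a)))
    have h4 : ∑ j, c j • x (a j) ∈ algCl k (S ∪ Set.range (x ∘ a)) := by
      refine sum_mem fun j _ => ?_
      rw [Algebra.smul_def]
      exact mul_mem (hsub (c j).2) (subset_algCl _ (Or.inr ⟨j, rfl⟩))
    have := add_mem (hsub h2) h4
    simpa using this
  refine (trRank_union_range_le S x (x ∘ a) key).trans ?_
  gcongr

/-- An algebraic relation makes one coordinate algebraic over the others, so that coordinate can be
dropped. -/
theorem trRank_union_le_of_dependent {ι : Type*} [Fintype ι] (S : Set K) (x : ι → K)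
    (hx : ¬ AlgebraicIndependent (algCl k S) x) :
    trRank k (S ∪ Set.range x) + 1 ≤ trRank k S + Fintype.card ι := by
  have h1 : ∃ (t : Set ι) (i : ι), i ∉ t ∧ IsAlgebraic (Algebra.adjoin (algCl k S) (x '' t)) (x i) := by
    by_contra! h
    exact hx (algebraicIndependent_of_finite_type' (algebraMap (algCl k S) K).injective
      fun t _ _ i hi => h t i hi)
  obtain ⟨t, i, hit, hi⟩ := h1
  have h2 : ∀ j, x j ∈ algCl k (S ∪ Set.range fun j : {j // j ≠ i} => x j) := by
    intro j
    by_cases hj : j = i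
    · subst hj
      refine mem_algCl_of_isAlgebraic_subalgebra _ (fun a ha => ?_) hi
      induction ha using Algebra.adjoin_induction with
      | mem a ha =>
        obtain ⟨l, hl, rfl⟩ := ha
        exact subset_algCl _ (Or.inr ⟨⟨l, fun h => hit (h ▸ hl)⟩, rfl⟩)
      | algebraMap r => exact algCl_mono Set.subset_union_left r.2
      | add a b _ _ ha hb => exact add_mem ha hb
      | mul a b _ _ ha hb => exact mul_mem ha hb
    · exact subset_algCl _ (Or.inr ⟨⟨j, hj⟩, rfl⟩)
  have h3 := trRank_union_range_le S x _ h2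
  have h4 : Nat.card {j // j ≠ i} + 1 = Fintype.card ι := by
    classical
    rw [Nat.card_eq_fintype_card, Fintype.card_subtype_compl, Fintype.card_subtype_eq]
    have := Fintype.card_pos_iff.2 ⟨i⟩
    omega
  calc _ ≤ trRank k S + Nat.card {j // j ≠ i} + 1 := by gcongr
    _ = _ := by rw [add_assoc, ← h4]; norm_cast

/-- A transcendence basis of T over L, together with S, determines T algebraically over k. This
allows the eigenvalues to be adjoined to the constants at the price of as many parameters as they
need. -/
theorem trRank_le_of_tower {S T : Set K} (L : IntermediateField k K)
    (hL : (L : Set K) ⊆ algCl k S) : trRank k (S ∪ T) ≤ S.encard + trRank L T := by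
  obtain ⟨I, hI⟩ := (AlgebraicIndependent.matroid L K).exists_isBasis' T
  have h1 : trRank k (S ∪ T) ≤ trRank k (S ∪ I) := by
    refine trRank_mono_algCl (Set.union_subset (Set.subset_union_left.trans (subset_algCl _)) ?_)
    intro x hx
    have h2 : x ∈ algCl L I := by
      rw [mem_algCl, hI.closure_eq_closure]
      exact Matroid.mem_closure_of_mem' _ hx
    have h3 : IsAlgebraic (IntermediateField.adjoin L I) x := mem_algebraicClosure_iff.1 h2
    refine mem_algCl_of_isAlgebraic_subalgebra
      (IntermediateField.adjoin L I).toSubalgebra (fun a ha => ?_) h3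
    induction ha using IntermediateField.adjoin_induction with
    | mem a ha => exact subset_algCl _ (Or.inr ha)
    | algebraMap r => exact algCl_mono Set.subset_union_left (hL r.2)
    | add a b _ _ ha hb => exact add_mem ha hb
    | mul a b _ _ ha hb => exact mul_mem ha hb
    | inv a _ ha => exact inv_mem ha
  refine h1.trans ((Matroid.eRk_le_encard _ _).trans ((Set.encard_union_le _ _).trans ?_))
  rw [trRank, ← hI.encard_eq_eRk]

theorem le_trRank_of_algebraicIndependent {n : ℕ} {S : Set K} (y : Fin n → K)
    (hy : AlgebraicIndependent k y) (hS : ∀ i, y i ∈ algCl k S) : (n : ℕ∞) ≤ trRank k S := by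
  have h1 : (AlgebraicIndependent.matroid k K).Indep (Set.range y) := by
    rw [AlgebraicIndependent.matroid_indep_iff]
    exact hy.coe_range
  have h2 : trRank k (Set.range y) ≤ trRank k S := by
    refine trRank_mono_algCl ?_
    rintro _ ⟨i, rfl⟩; exact hS i
  refine le_trans ?_ h2
  rw [trRank, h1.eRk_eq_encard, ← Set.image_univ, hy.injective.injOn.encard_image]
  simp

end Rank

end SOData

/-! ### Chains of primes and transcendence degree of points -/

namespace SOData

open Module

section Chain

/-- Going down one step from Q to P adds an element q of Q outside P. Were q algebraic over the
earlier elements modulo P, a relation with nonzero constant coefficient would exist. That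
coefficient vanishes modulo Q, against the independence of the earlier elements there. -/
theorem exists_algebraicIndependent_quotient {k R : Type*} [Field k] [CommRing R] [Algebra k R]
    (n : ℕ) (p : LTSeries (PrimeSpectrum R)) (hn : p.length = n) :
    ∃ y : Fin n → R, AlgebraicIndependent k
      (fun i => Ideal.Quotient.mkₐ k p.head.asIdeal (y i)) := by
  induction n generalizing p with
  | zero =>
    refine ⟨Fin.elim0, ?_⟩
    rw [algebraicIndependent_empty_type_iff]
    exact (algebraMap k (R ⧸ p.head.asIdeal)).injective
  | succ n ih =>
    have hne : p.length ≠ 0 := by omega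
    have hlt : p.head < (p.tail hne).head := by
      rw [RelSeries.head_tail, RelSeries.head]
      exact p.strictMono (by
        rw [Fin.lt_def, Fin.val_one']
        simp only [Fin.val_zero]
        rw [Nat.mod_eq_of_lt] <;> omega)
    obtain ⟨y, hy⟩ := ih (p.tail hne) (by rw [RelSeries.tail_length]; omega)
    set P := p.head.asIdeal
    set Q := (p.tail hne).head.asIdeal
    have hPQ : P < Q := hlt
    obtain ⟨q, hqQ, hqP⟩ := Set.exists_of_ssubset hPQ
    let f : (R ⧸ P) →ₐ[k] (R ⧸ Q) := Ideal.Quotient.factorₐ k hPQ.le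
    have hy' : AlgebraicIndependent k (f ∘ fun i => Ideal.Quotient.mkₐ k P (y i)) := hy
    have h0 := hy'.of_comp
    have h1 : Transcendental (Algebra.adjoin k (Set.range fun i => Ideal.Quotient.mkₐ k P (y i)))
        (Ideal.Quotient.mkₐ k P q) := by
      intro halg
      have hq0 : Ideal.Quotient.mkₐ k P q ≠ 0 := fun h => hqP (Ideal.Quotient.eq_zero_iff_mem.1 h)
      obtain ⟨g, hg0, hg⟩ :=
        halg.exists_nonzero_coeff_and_aeval_eq_zero (mem_nonZeroDivisors_of_ne_zero hq0)
      have h2 : f (g.coeff 0 : R ⧸ P) = 0 := by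
        have h3 := congrArg f hg
        rw [← g.divX_mul_X_add, map_add, map_mul, Polynomial.aeval_X, Polynomial.aeval_C, map_add,
          map_mul, map_zero] at h3
        have h4 : f (Ideal.Quotient.mkₐ k P q) = 0 := Ideal.Quotient.eq_zero_iff_mem.2 hqQ
        rw [h4, mul_zero, zero_add] at h3
        exact h3
      have h5 : ∀ a ∈ Algebra.adjoin k (Set.range fun i => Ideal.Quotient.mkₐ k P (y i)),
          f a = 0 → a = 0 := by
        intro a ha ha0
        rw [Algebra.adjoin_range_eq_range_aeval] at ha
        obtain ⟨F, rfl⟩ := ha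
        have h6 : MvPolynomial.aeval (f ∘ fun i => Ideal.Quotient.mkₐ k P (y i)) F = 0 :=
          (MvPolynomial.comp_aeval_apply _ f F).symm.trans ha0
        rw [hy'.eq_zero_of_aeval_eq_zero F h6, map_zero]
      exact hg0 (Subtype.ext (h5 _ (g.coeff 0).2 h2))
    have h2 := AlgebraicIndependent.option_iff.2 ⟨h0, h1⟩
    refine ⟨Fin.cons q y, ?_⟩
    have h3 := h2.comp _ (finSuccEquiv n).injective
    convert! h3 using 2 with i
    refine Fin.cases ?_ (fun j => ?_) i <;> simp

variable {k R K : Type*} [Field k] [CommRing R] [Algebra k R] [Field K] [Algebra k K]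

theorem mem_algCl_range_of_adjoin_eq_top {ι : Type*} {x : ι → R}
    (hx : Algebra.adjoin k (Set.range x) = ⊤) (χ : R →ₐ[k] K) (r : R) :
    χ r ∈ algCl k (Set.range (χ ∘ x)) := by
  have hr : r ∈ Algebra.adjoin k (Set.range x) := hx ▸ Algebra.mem_top
  induction hr using Algebra.adjoin_induction with
  | mem a ha =>
    obtain ⟨l, rfl⟩ := ha
    exact subset_algCl _ ⟨l, rfl⟩
  | algebraMap r => rw [AlgHom.commutes]; exact (algCl k _).algebraMap_mem r
  | add a b _ _ ha hb => rw [map_add]; exact add_mem ha hb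
  | mul a b _ _ ha hb => rw [map_mul]; exact mul_mem ha hb

theorem length_le_trRank {ι : Type*} {x : ι → R} (hx : Algebra.adjoin k (Set.range x) = ⊤)
    (p : LTSeries (PrimeSpectrum R)) (χ : R →ₐ[k] K)
    (hχ : RingHom.ker χ = p.head.asIdeal) : (p.length : ℕ∞) ≤ trRank k (Set.range (χ ∘ x)) := by
  obtain ⟨y, hy⟩ := exists_algebraicIndependent_quotient (k := k) p.length p rfl
  let g : (R ⧸ p.head.asIdeal) →ₐ[k] K :=
    Ideal.Quotient.liftₐ _ χ (fun a ha => by rwa [← hχ] at ha)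
  have hg : Function.Injective g := by
    rw [injective_iff_map_eq_zero]
    intro a ha
    obtain ⟨r, rfl⟩ := Ideal.Quotient.mk_surjective a
    exact Ideal.Quotient.eq_zero_iff_mem.2 (hχ ▸ ha)
  refine le_trRank_of_algebraicIndependent (g ∘ fun i => Ideal.Quotient.mkₐ k p.head.asIdeal (y i))
    (hy.map' hg) fun i => ?_
  exact mem_algCl_range_of_adjoin_eq_top hx χ (y i)

end Chain

section Dimension

universe u

variable {k : Type*} {R : Type u} [Field k] [CommRing R] [Algebra k R]

/-- A prime ideal is the kernel of a point with values in an algebraically closed field. -/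
theorem exists_algHom_ker_eq (P : PrimeSpectrum R) :
    ∃ (K : Type u) (_ : Field K) (_ : Algebra k K) (_ : IsAlgClosed K) (χ : R →ₐ[k] K),
      RingHom.ker χ = P.asIdeal := by
  let K := AlgebraicClosure (FractionRing (R ⧸ P.asIdeal))
  refine ⟨K, inferInstance, inferInstance, inferInstance,
    (IsScalarTower.toAlgHom k (R ⧸ P.asIdeal) K).comp (Ideal.Quotient.mkₐ k P.asIdeal), ?_⟩
  ext r
  have hinj : Function.Injective (algebraMap (R ⧸ P.asIdeal) K) := by
    rw [IsScalarTower.algebraMap_eq (R ⧸ P.asIdeal) (FractionRing (R ⧸ P.asIdeal)) K]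
    exact (algebraMap (FractionRing (R ⧸ P.asIdeal)) K).injective.comp
      (IsFractionRing.injective _ _)
  rw [RingHom.mem_ker]
  change algebraMap (R ⧸ P.asIdeal) K (Ideal.Quotient.mk _ r) = 0 ↔ _
  rw [map_eq_zero_iff _ hinj, Ideal.Quotient.eq_zero_iff_mem]

/-- The bottom prime of a chain in R/I is the kernel of a point with values in an algebraically
closed field. The coordinates of that point have transcendence degree at least the length of the
chain, so bounding all such points suffices. -/
theorem ringKrullDim_quotient_le_of_trRank {ι : Type*} {x : ι → R}
    (hx : Algebra.adjoin k (Set.range x) = ⊤) (I : Ideal R) (d : ℕ)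
    (h : ∀ (K : Type u) [Field K] [Algebra k K] [IsAlgClosed K] (χ : R →ₐ[k] K),
      I ≤ RingHom.ker χ → trRank k (Set.range (χ ∘ x)) ≤ d) :
    ringKrullDim (R ⧸ I) ≤ d := by
  refine iSup_le fun p => ?_
  let p' : LTSeries (PrimeSpectrum R) := p.map (PrimeSpectrum.comap (Ideal.Quotient.mk I))
    (Monotone.strictMono_of_injective (fun _ _ h => Ideal.comap_mono h)
      (PrimeSpectrum.comap_injective_of_surjective _ Ideal.Quotient.mk_surjective))
  obtain ⟨K, _, _, _, χ, hχ⟩ := exists_algHom_ker_eq (k := k) p'.head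
  have h1 := length_le_trRank hx p' χ hχ
  have h2 : I ≤ RingHom.ker χ := by
    rw [hχ]
    intro a ha
    change Ideal.Quotient.mk I a ∈ p.head.asIdeal
    rw [Ideal.Quotient.eq_zero_iff_mem.2 ha]
    exact zero_mem _
  have h3 : (p.length : ℕ∞) ≤ d := h1.trans (h K χ h2)
  exact_mod_cast h3

end Dimension

end SOData

/-! ### Parameter counts for vectors under linear and quadratic equations -/

namespace SOData

open Module

theorem enat_le_add_of_add_le {t r : ℕ∞} {m N d : ℕ} (h : t + m ≤ r + N) (hd : N ≤ d + m) :
    t ≤ r + d := by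
  refine (ENat.add_le_add_iff_right (ENat.natCast_ne_top m)).1 (h.trans ?_)
  rw [add_assoc]
  gcongr
  exact_mod_cast hd

section VectorRank

variable {k K : Type*} [Field k] [Field K] [Algebra k K]

theorem linearIndependent_of_algCl {κ ι : Type*} {S : Set K} {A : κ → ι → algCl k S}
    (hA : LinearIndependent K fun i j => (A i j : K)) : LinearIndependent (algCl k S) A := by
  have h1 := hA.restrict_scalars' (algCl k S)
  let ψ : (ι → algCl k S) →ₗ[algCl k S] (ι → K) := (Algebra.linearMap (algCl k S) K).compLeft ι
  exact LinearIndependent.of_comp ψ h1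

variable {ι : Type*} [Fintype ι]

/-- Independent linear equations lower the rank of a vector. -/
theorem trRank_union_range_add_card_le {κ : Type*} [Fintype κ] (S : Set K) (x : ι → K)
    (A : κ → ι → K) (hA : ∀ i j, A i j ∈ algCl k S) (hli : LinearIndependent K A)
    (hx : ∀ i, ∑ j, A i j * x j ∈ algCl k S) :
    trRank k (S ∪ Set.range x) + Fintype.card κ ≤ trRank k S + Fintype.card ι := by
  let A' : Matrix κ ι (algCl k S) := fun i j => ⟨A i j, hA i j⟩
  have hli' : LinearIndependent (algCl k S) A' := linearIndependent_of_algCl hli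
  have h1 := trRank_union_range_le_finrank S x (LinearMap.ker A'.mulVecLin) fun Y hY => by
    rw [LinearMap.mem_ker]
    ext1 i
    exact hY (A' i) (hx i)
  have h2 := A'.mulVecLin.finrank_range_add_finrank_ker
  have h3 : finrank (algCl k S) (LinearMap.range A'.mulVecLin) = Fintype.card κ :=
    LinearIndependent.rank_matrix hli'
  rw [h3, finrank_fintype_fun_eq_card] at h2
  calc _ ≤ trRank k S + finrank (algCl k S) (LinearMap.ker A'.mulVecLin) + Fintype.card κ := by
        gcongr
    _ = _ := by rw [← h2, add_assoc, add_comm (Fintype.card κ)]; norm_cast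

theorem trRank_union_range_add_one_le_of_linear (S : Set K) (a x : ι → K)
    (ha : ∀ j, a j ∈ algCl k S) (ha0 : a ≠ 0) (hx : ∑ j, a j * x j ∈ algCl k S) :
    trRank k (S ∪ Set.range x) + 1 ≤ trRank k S + Fintype.card ι := by
  have := trRank_union_range_add_card_le (κ := Unit) S x (fun _ => a) (fun _ => ha)
    (LinearIndependent.of_subsingleton () ha0) (fun _ => hx)
  simpa using this

theorem trRank_union_range_add_two_le_of_linear (S : Set K) (a b x : ι → K)
    (ha : ∀ j, a j ∈ algCl k S) (hb : ∀ j, b j ∈ algCl k S) (ha0 : a ≠ 0)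
    (hab : ∀ c : K, b ≠ c • a) (hx : ∑ j, a j * x j ∈ algCl k S)
    (hx' : ∑ j, b j * x j ∈ algCl k S) :
    trRank k (S ∪ Set.range x) + 2 ≤ trRank k S + Fintype.card ι := by
  have := trRank_union_range_add_card_le (κ := Fin 2) S x ![a, b]
    (Fin.forall_fin_two.2 ⟨ha, hb⟩)
    ((LinearIndependent.pair_iff' ha0).2 fun c h => hab c h.symm)
    (Fin.forall_fin_two.2 ⟨hx, hx'⟩)
  simpa using this

theorem trRank_union_range_add_one_le_of_isotropic [Nonempty ι] (S : Set K) (x : ι → K)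
    (hx : ∑ j, x j * x j = 0) :
    trRank k (S ∪ Set.range x) + 1 ≤ trRank k S + Fintype.card ι := by
  classical
  refine trRank_union_le_of_dependent S x fun h => ?_
  have h1 := h.eq_zero_of_aeval_eq_zero (∑ j, MvPolynomial.X j * MvPolynomial.X j) (by simpa)
  obtain ⟨j⟩ := ‹Nonempty ι›
  have h2 := congrArg (MvPolynomial.eval (Pi.single j 1)) h1
  simp [Pi.single_apply] at h2

/-- Eliminate a coordinate with nonzero coefficient in a. The quadric becomes Σ vⱼ² + (Σ cⱼvⱼ)² in
the remaining variables. With at least two variables left this form is not zero, so it is a second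
condition. -/
theorem trRank_union_range_add_two_le_of_isotropic [CharZero k] (hι : 3 ≤ Fintype.card ι)
    (S : Set K) (a x : ι → K)
    (ha : ∀ j, a j ∈ algCl k S) (ha0 : a ≠ 0) (hax : ∑ j, a j * x j = 0)
    (hx : ∑ j, x j * x j = 0) :
    trRank k (S ∪ Set.range x) + 2 ≤ trRank k S + Fintype.card ι := by
  classical
  obtain ⟨i, hi⟩ := Function.ne_iff.1 ha0
  rw [Pi.zero_apply] at hi
  have hsum : ∀ f : ι → K, ∑ j, f j = f i + ∑ j : {j // j ≠ i}, f j := fun f => by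
    rw [← Finset.add_sum_erase _ _ (Finset.mem_univ i)]
    congr 1
    exact Finset.sum_subtype _ (by simp) f
  let c : {j // j ≠ i} → algCl k S := fun j => -(⟨a j, ha j⟩ / ⟨a i, ha i⟩)
  have hxi : x i = ∑ j : {j // j ≠ i}, (c j : K) * x j := by
    rw [hsum] at hax
    have h1 : x i = -(∑ j : {j // j ≠ i}, a j * x j) / a i := by
      field_simp
      linear_combination hax
    rw [h1, neg_div, Finset.sum_div, ← Finset.sum_neg_distrib]
    refine Finset.sum_congr rfl fun j _ => ?_
    simp only [c]
    push_cast
    ring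
  have hcard : Fintype.card {j // j ≠ i} + 1 = Fintype.card ι := by
    rw [Fintype.card_subtype_compl, Fintype.card_subtype_eq]
    omega
  have h1 : trRank k (S ∪ Set.range fun j : {j // j ≠ i} => x j) + 1 ≤
      trRank k S + Fintype.card {j // j ≠ i} := by
    refine trRank_union_le_of_dependent S _ fun h => ?_
    let P : MvPolynomial {j // j ≠ i} (algCl k S) := ∑ j, MvPolynomial.X j * MvPolynomial.X j +
      (∑ j, MvPolynomial.C (c j) * MvPolynomial.X j) * (∑ j, MvPolynomial.C (c j) * MvPolynomial.X j)
    have hP : P = 0 := by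
      refine h.eq_zero_of_aeval_eq_zero P ?_
      rw [hsum, hxi] at hx
      simp only [P, map_add, map_sum, map_mul, MvPolynomial.aeval_X, MvPolynomial.aeval_C]
      rw [add_comm]
      exact hx
    have hev : ∀ v : {j // j ≠ i} → algCl k S,
        ∑ j, v j * v j + (∑ j, c j * v j) * (∑ j, c j * v j) = 0 := fun v => by
      have := congrArg (MvPolynomial.eval v) hP
      simpa [P] using this
    have hlt : 1 < Fintype.card {j // j ≠ i} := by omega
    obtain ⟨p, q, hpq⟩ := Fintype.one_lt_card_iff.1 hlt
    have e1 := hev (Pi.single p 1)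
    have e2 := hev (Pi.single q 1)
    have e3 := hev (Pi.single p 1 + Pi.single q 1)
    simp only [Pi.add_apply, mul_add, add_mul, Finset.sum_add_distrib, Pi.single_apply, mul_ite,
      mul_one, mul_zero, Finset.sum_ite_eq', Finset.mem_univ, if_true, if_neg hpq,
      if_neg hpq.symm] at e1 e2 e3
    have : CharZero (algCl k S) := charZero_of_injective_algebraMap (algebraMap k _).injective
    have e4 : 2 * (c p * c q) = 0 := by linear_combination e3 - e1 - e2
    have e5 : c p * c q = 0 := by simpa using e4
    -- If the form vanished, then c p² = c q² = -1 while c p · c q = 0 by polarization, and (c p · c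
    -- q)² would be both 1 and 0.
    have e6 : (1 : algCl k S) = 0 := by
      linear_combination (c p * c q) * e5 + e2 - (c q * c q) * e1
    exact one_ne_zero e6
  have h2 : trRank k (S ∪ Set.range x) ≤ trRank k (S ∪ Set.range fun j : {j // j ≠ i} => x j) := by
    refine trRank_mono_algCl (Set.union_subset (Set.subset_union_left.trans (subset_algCl _)) ?_)
    rintro _ ⟨j, rfl⟩
    by_cases hj : j = i
    · subst hj
      rw [hxi]
      exact sum_mem fun l _ => mul_mem (algCl_mono Set.subset_union_left (c l).2)
        (subset_algCl _ (Or.inr ⟨l, rfl⟩))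
    · exact subset_algCl _ (Or.inr ⟨⟨j, hj⟩, rfl⟩)
  calc _ ≤ trRank k (S ∪ Set.range fun j : {j // j ≠ i} => x j) + 1 + 1 := by
        rw [add_assoc, one_add_one_eq_two]; gcongr
    _ ≤ trRank k S + Fintype.card {j // j ≠ i} + 1 := by gcongr
    _ = _ := by rw [add_assoc, ← hcard]; norm_cast

end VectorRank

end SOData

/-! ### Jets of pairs of vectors spanning an isotropic subspace -/

namespace SOData

open Module

open PowerSeries in
/-- The polynomial of the terms of degree less than `j`. -/
noncomputable def lowPart {K : Type*} [Field K] (j : ℕ) (w : PowerSeries K) : PowerSeries K :=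
  PowerSeries.mk fun i => if i < j then PowerSeries.coeff i w else 0

/-- The coefficients of degree less than `n` of a vector of power series. -/
def entries {K ι : Type*} [Field K] (n : ℕ) (v : ι → PowerSeries K) : Set K :=
  {x | ∃ j < n, ∃ i, PowerSeries.coeff j (v i) = x}

section Jets

open PowerSeries (X coeff)

variable {k K : Type*} [Field k] [Field K] [Algebra k K] {ι : Type*}

theorem eq_lowPart_add (j : ℕ) (w : PowerSeries K) :
    w = lowPart j w + X ^ j * PowerSeries.mk fun i => coeff (i + j) w := by
  ext i
  rw [map_add, PowerSeries.coeff_X_pow_mul', lowPart, PowerSeries.coeff_mk]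
  split_ifs with h1 h2 h2
  · omega
  · simp
  · simp [Nat.sub_add_cancel h2]
  · omega

/-- The coefficient of order j of a product is affine in the order j coefficient of w, with slope
the constant term of u. Hence beyond order 0 the quadratic jet equations are linear in the new
coefficients. -/
theorem coeff_mul_lowPart (j : ℕ) (u w : PowerSeries K) :
    coeff j (u * w) = coeff j (u * lowPart j w) + coeff 0 u * coeff j w := by
  conv_lhs => rw [eq_lowPart_add j w]
  rw [mul_add, map_add, mul_left_comm, PowerSeries.coeff_X_pow_mul', if_pos le_rfl, Nat.sub_self]
  simp

theorem coeff_mul_self_lowPart {j : ℕ} (hj : 0 < j) (w : PowerSeries K) :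
    coeff j (w * w) = coeff j (lowPart j w * lowPart j w) + 2 * (coeff 0 w * coeff j w) := by
  rw [coeff_mul_lowPart j w w, mul_comm w, coeff_mul_lowPart j _ w]
  have : coeff 0 (lowPart j w) = coeff 0 w := by simp [lowPart, hj]
  rw [this]
  ring

theorem coeff_mul_mem {j : ℕ} {u w : PowerSeries K} (L : IntermediateField k K)
    (hu : ∀ p ≤ j, coeff p u ∈ L) (hw : ∀ p ≤ j, coeff p w ∈ L) : coeff j (u * w) ∈ L := by
  rw [PowerSeries.coeff_mul]
  refine sum_mem fun p hp => ?_
  rw [Finset.HasAntidiagonal.mem_antidiagonal] at hp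
  exact mul_mem (hu _ (by omega)) (hw _ (by omega))

theorem coeff_lowPart_mem {j : ℕ} {w : PowerSeries K} (L : IntermediateField k K)
    (hw : ∀ p < j, coeff p w ∈ L) (p : ℕ) : coeff p (lowPart j w) ∈ L := by
  rw [lowPart, PowerSeries.coeff_mk]
  split_ifs with h
  · exact hw p h
  · exact zero_mem _

theorem entries_zero (v : ι → PowerSeries K) : entries 0 v = ∅ := by
  ext; simp [entries]

theorem entries_succ (n : ℕ) (v : ι → PowerSeries K) :
    entries (n + 1) v = entries n v ∪ Set.range fun i => coeff n (v i) := by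
  ext x
  simp only [entries, Set.mem_ofPred_eq, Set.mem_union, Set.mem_range]
  constructor
  · rintro ⟨j, hj, i, rfl⟩
    rcases Nat.lt_succ_iff_lt_or_eq.1 hj with h | rfl
    · exact Or.inl ⟨j, h, i, rfl⟩
    · exact Or.inr ⟨i, rfl⟩
  · rintro (⟨j, hj, i, rfl⟩ | ⟨i, rfl⟩)
    · exact ⟨j, by omega, i, rfl⟩
    · exact ⟨n, by omega, i, rfl⟩

theorem trRank_union_entries_le (T : Set K) (v : ι → PowerSeries K) (d : ℕ → ℕ) (n : ℕ)
    (h : ∀ j < n, trRank k ((T ∪ entries j v) ∪ Set.range fun i => coeff j (v i)) ≤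
      trRank k (T ∪ entries j v) + d j) :
    trRank k (T ∪ entries n v) ≤ trRank k T + (∑ j ∈ Finset.range n, d j : ℕ) := by
  induction n with
  | zero => simp [entries_zero]
  | succ n ih =>
    rw [entries_succ, ← Set.union_assoc, Finset.sum_range_succ]
    refine (h n (by omega)).trans ?_
    push_cast
    rw [← add_assoc]
    gcongr
    exact_mod_cast ih fun j hj => h j (by omega)

variable [Fintype ι]

/-- Each order costs one parameter: at order 0 the vector a₀ lies on a quadric, and at order j > 0
the scalar a₀·aⱼ is determined by the earlier coefficients, with a₀ ≠ 0. -/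
theorem trRank_union_entries_le_of_isotropic [CharZero k] (T : Set K) (a : ι → PowerSeries K)
    (n : ℕ) (ha0 : (fun i => coeff 0 (a i)) ≠ 0) (haa : X ^ n ∣ ∑ i, a i * a i) :
    trRank k (T ∪ entries n a) ≤ trRank k T + (n * (Fintype.card ι - 1) : ℕ) := by
  have : CharZero K := charZero_of_injective_algebraMap (algebraMap k K).injective
  have hne : Nonempty ι := by
    by_contra h
    rw [not_nonempty_iff] at h
    exact ha0 (Subsingleton.elim _ _)
  rw [PowerSeries.X_pow_dvd_iff] at haa
  have h := trRank_union_entries_le (k := k) T a (fun _ => Fintype.card ι - 1) n fun j hj => by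
    have hcoeff := haa j hj
    rw [map_sum] at hcoeff
    refine enat_le_add_of_add_le (m := 1) (N := Fintype.card ι) ?_ (by omega)
    rcases Nat.eq_zero_or_pos j with rfl | hj0
    · refine trRank_union_range_add_one_le_of_isotropic _ _ ?_
      simpa using hcoeff
    · have hmem : ∀ i p, p < j → coeff p (a i) ∈ algCl k (T ∪ entries j a) := fun i p hp =>
        subset_algCl _ (Or.inr ⟨p, hp, i, rfl⟩)
      refine trRank_union_range_add_one_le_of_linear _ (fun i => coeff 0 (a i)) _
        (fun i => hmem i 0 hj0) ha0 ?_
      have h1 : ∑ i, coeff 0 (a i) * coeff j (a i) =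
          (2 : K)⁻¹ * -(∑ i, coeff j (lowPart j (a i) * lowPart j (a i))) := by
        rw [Finset.sum_congr rfl fun i _ => coeff_mul_self_lowPart hj0 (a i),
          Finset.sum_add_distrib, ← Finset.mul_sum] at hcoeff
        rw [eq_inv_mul_iff_mul_eq₀ two_ne_zero]
        linear_combination hcoeff
      rw [h1]
      have h2 : (2 : K)⁻¹ ∈ algCl k (T ∪ entries j a) := inv_mem (ofNat_mem _ 2)
      refine mul_mem h2 (neg_mem (sum_mem fun i _ => ?_))
      exact coeff_mul_mem _ (fun p _ => coeff_lowPart_mem _ (hmem i) p)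
        (fun p _ => coeff_lowPart_mem _ (hmem i) p)
  simpa [Finset.sum_const] using h

/-- Here a is already known. At every order below m the scalar a₀·bⱼ is determined. Below r, b·b = 0
adds a second condition, which for j > 0 fixes b₀·bⱼ. This is independent of the first because b₀ is
not a multiple of a₀. At order 0 the isotropic vector b₀ lies in the hyperplane orthogonal to a₀. -/
theorem trRank_union_entries_le_of_orthogonal [CharZero k] (hι : 3 ≤ Fintype.card ι) (T : Set K)
    (a b : ι → PowerSeries K) (m r : ℕ) (hrm : r ≤ m) (haT : entries m a ⊆ algCl k T)
    (ha0 : (fun i => coeff 0 (a i)) ≠ 0)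
    (hb0 : 0 < m → ∀ t : K, (fun i => coeff 0 (b i)) ≠ t • fun i => coeff 0 (a i))
    (hab : X ^ m ∣ ∑ i, a i * b i) (hbb : X ^ r ∣ ∑ i, b i * b i) :
    trRank k (T ∪ entries m b) ≤ trRank k T +
      (r * (Fintype.card ι - 2) + (m - r) * (Fintype.card ι - 1) : ℕ) := by
  have : CharZero K := charZero_of_injective_algebraMap (algebraMap k K).injective
  rw [PowerSeries.X_pow_dvd_iff] at hab hbb
  have h := trRank_union_entries_le (k := k) T b
    (fun j => if j < r then Fintype.card ι - 2 else Fintype.card ι - 1) m fun j hj => by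
    have hmema : ∀ i p, p ≤ j → coeff p (a i) ∈ algCl k (T ∪ entries j b) := fun i p hp =>
      algCl_mono Set.subset_union_left (haT ⟨p, by omega, i, rfl⟩)
    have hmemb : ∀ i p, p < j → coeff p (b i) ∈ algCl k (T ∪ entries j b) := fun i p hp =>
      subset_algCl _ (Or.inr ⟨p, hp, i, rfl⟩)
    have hcoeff := hab j hj
    rw [map_sum] at hcoeff
    rw [Finset.sum_congr rfl fun i _ => coeff_mul_lowPart j (a i) (b i),
      Finset.sum_add_distrib] at hcoeff
    have hlin : ∑ i, coeff 0 (a i) * coeff j (b i) ∈ algCl k (T ∪ entries j b) := by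
      rw [eq_neg_of_add_eq_zero_right hcoeff]
      exact neg_mem (sum_mem fun i _ => coeff_mul_mem _ (hmema i)
        (fun p _ => coeff_lowPart_mem _ (hmemb i) p))
    split_ifs with hjr
    · refine enat_le_add_of_add_le (m := 2) (N := Fintype.card ι) ?_ (by omega)
      have hcoeff' := hbb j hjr
      rw [map_sum] at hcoeff'
      rcases Nat.eq_zero_or_pos j with rfl | hj0
      · refine trRank_union_range_add_two_le_of_isotropic hι _ (fun i => coeff 0 (a i)) _
          (fun i => hmema i 0 le_rfl) ha0 ?_ ?_
        · simpa [lowPart] using hab 0 hj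
        · simpa using hcoeff'
      · refine trRank_union_range_add_two_le_of_linear _ (fun i => coeff 0 (a i))
          (fun i => coeff 0 (b i)) _ (fun i => hmema i 0 hj0.le) (fun i => hmemb i 0 hj0) ha0
          (hb0 (by omega)) hlin ?_
        have h1 : ∑ i, coeff 0 (b i) * coeff j (b i) =
            (2 : K)⁻¹ * -(∑ i, coeff j (lowPart j (b i) * lowPart j (b i))) := by
          rw [Finset.sum_congr rfl fun i _ => coeff_mul_self_lowPart hj0 (b i),
            Finset.sum_add_distrib, ← Finset.mul_sum] at hcoeff'
          rw [eq_inv_mul_iff_mul_eq₀ two_ne_zero]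
          linear_combination hcoeff'
        rw [h1]
        have h2 : (2 : K)⁻¹ ∈ algCl k (T ∪ entries j b) := inv_mem (ofNat_mem _ 2)
        refine mul_mem h2 (neg_mem (sum_mem fun i _ => ?_))
        exact coeff_mul_mem _ (fun p _ => coeff_lowPart_mem _ (hmemb i) p)
          (fun p _ => coeff_lowPart_mem _ (hmemb i) p)
    · refine enat_le_add_of_add_le (m := 1) (N := Fintype.card ι) ?_ (by omega)
      exact trRank_union_range_add_one_le_of_linear _ (fun i => coeff 0 (a i)) _
        (fun i => hmema i 0 (Nat.zero_le _)) ha0 hlin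
  refine h.trans (le_of_eq ?_)
  congr 2
  obtain ⟨q, rfl⟩ := Nat.exists_eq_add_of_le hrm
  rw [Finset.sum_range_add, Nat.add_sub_cancel_left]
  congr 1
  · rw [Finset.sum_congr rfl fun j hj => if_pos (Finset.mem_range.1 hj)]
    simp
  · simp

omit [Fintype ι] in
-- Subtract multiples of a from b as long as the leading vector of the remainder is proportional to
-- a₀. The order s measures how closely b follows a, and c is a polynomial with s coefficients.
theorem exists_eq_mul_add_X_pow_mul (a b : ι → PowerSeries K) (n : ℕ) :
    ∃ s ≤ n, ∃ (c : PowerSeries K) (b' : ι → PowerSeries K),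
      (∀ i, b i = c * a i + X ^ s * b' i) ∧ (∀ j, s ≤ j → coeff j c = 0) ∧
      (s < n → ∀ t : K, (fun i => coeff 0 (b' i)) ≠ t • fun i => coeff 0 (a i)) := by
  induction n with
  | zero => exact ⟨0, le_rfl, 0, b, by simp, by simp, by simp⟩
  | succ n ih =>
    obtain ⟨s, hs, c, b', h1, h2, h3⟩ := ih
    by_cases h : ∃ t : K, (fun i => coeff 0 (b' i)) = t • fun i => coeff 0 (a i)
    · have hsn : s = n := by
        by_contra hne
        obtain ⟨t, ht⟩ := h
        exact h3 (by omega) t ht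
      obtain ⟨t, ht⟩ := h
      have h4 : ∀ i, ∃ b'' : PowerSeries K, b' i = PowerSeries.C t * a i + X * b'' := fun i => by
        have h5 : X ∣ b' i - PowerSeries.C t * a i := by
          rw [PowerSeries.X_dvd_iff, map_sub, map_mul, PowerSeries.constantCoeff_C]
          have := congrFun ht i
          simpa [sub_eq_zero] using this
        obtain ⟨b'', hb''⟩ := h5
        exact ⟨b'', by rw [← hb'']; ring⟩
      choose b'' hb'' using h4
      refine ⟨n + 1, le_rfl, c + X ^ n * PowerSeries.C t, b'', fun i => ?_, fun j hj => ?_,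
        fun h => absurd h (lt_irrefl _)⟩
      · rw [h1, hb'', hsn]; ring
      · rw [map_add, h2 j (by omega), PowerSeries.coeff_X_pow_mul', if_pos (by omega),
          PowerSeries.coeff_C, if_neg (by omega), add_zero]
    · exact ⟨s, by omega, c, b', h1, h2, fun _ t ht => h ⟨t, ht⟩⟩

/-- Write b = ca + X^s b'. The parameters are those of a, the s coefficients of c, and b' to order n
- s. The equations on b become a·b' = 0 modulo X^{n-s} and b'·b' = 0 modulo X^{n-2s}. -/
theorem trRank_union_jets_le_of_ne_zero [CharZero k] (hι : 4 ≤ Fintype.card ι) (S : Set K) (n : ℕ)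
    (a b : ι → PowerSeries K) (haa : X ^ n ∣ ∑ i, a i * a i) (hab : X ^ n ∣ ∑ i, a i * b i)
    (hbb : X ^ n ∣ ∑ i, b i * b i) (ha0 : (fun i => coeff 0 (a i)) ≠ 0) :
    trRank k (S ∪ entries n a ∪ entries n b) ≤ trRank k S + (n * (2 * Fintype.card ι - 3) : ℕ) := by
  obtain ⟨s, hs, c, b', hb, hc, hb0⟩ := exists_eq_mul_add_X_pow_mul a b n
  set N := Fintype.card ι
  let C : Set K := Set.range fun j : Fin s => coeff j.1 c
  have hXs : (X : PowerSeries K) ^ s ≠ 0 := pow_ne_zero _ PowerSeries.X_ne_zero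
  have hab' : X ^ (n - s) ∣ ∑ i, a i * b' i := by
    have h1 : ∑ i, a i * b i = c * ∑ i, a i * a i + X ^ s * ∑ i, a i * b' i := by
      rw [Finset.mul_sum, Finset.mul_sum, ← Finset.sum_add_distrib]
      exact Finset.sum_congr rfl fun i _ => by rw [hb]; ring
    rw [h1, dvd_add_right (haa.mul_left _)] at hab
    rwa [← Nat.add_sub_cancel' hs, pow_add, mul_dvd_mul_iff_left hXs] at hab
  have hbb' : X ^ (n - 2 * s) ∣ ∑ i, b' i * b' i := by
    rcases le_or_gt (2 * s) n with h2s | h2s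
    swap
    · rw [Nat.sub_eq_zero_of_le h2s.le, pow_zero]; exact one_dvd _
    have h1 : ∑ i, b i * b i = c ^ 2 * ∑ i, a i * a i + (2 * c) * (X ^ s * ∑ i, a i * b' i) +
        X ^ (2 * s) * ∑ i, b' i * b' i := by
      simp only [Finset.mul_sum, ← Finset.sum_add_distrib]
      exact Finset.sum_congr rfl fun i _ => by rw [hb]; ring
    have h3 : X ^ n ∣ X ^ s * ∑ i, a i * b' i := by
      rw [← Nat.add_sub_cancel' hs, pow_add, mul_dvd_mul_iff_left hXs]
      exact hab'
    rw [h1, dvd_add_right (dvd_add (haa.mul_left _) (h3.mul_left _))] at hbb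
    rwa [← Nat.add_sub_cancel' h2s, pow_add,
      mul_dvd_mul_iff_left (pow_ne_zero _ PowerSeries.X_ne_zero)] at hbb
  have hsub : S ∪ entries n a ∪ entries n b ⊆ algCl k (S ∪ entries n a ∪ C ∪ entries (n - s) b') := by
    refine Set.union_subset (fun x hx => subset_algCl _ (Or.inl (Or.inl hx))) ?_
    rintro _ ⟨j, hj, i, rfl⟩
    rw [hb, map_add]
    refine add_mem (coeff_mul_mem _ (fun p _ => ?_) (fun p hp => ?_)) ?_
    · rcases lt_or_ge p s with h | h
      · exact subset_algCl _ (Or.inl (Or.inr ⟨⟨p, h⟩, rfl⟩))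
      · rw [hc p h]; exact zero_mem _
    · exact subset_algCl _ (Or.inl (Or.inl (Or.inr ⟨p, by omega, i, rfl⟩)))
    · rw [PowerSeries.coeff_X_pow_mul']
      split_ifs with h
      · exact subset_algCl _ (Or.inr ⟨j - s, by omega, i, rfl⟩)
      · exact zero_mem _
  have e1 := trRank_union_entries_le_of_isotropic (k := k) S a n ha0 haa
  have e2 : trRank k (S ∪ entries n a ∪ C) ≤ trRank k (S ∪ entries n a) + s := by
    refine (trRank_union_le _ _).trans ?_
    gcongr
    have := Set.encard_image_le (fun j : Fin s => coeff j.1 c) Set.univ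
    rw [Set.image_univ, Set.encard_univ] at this
    simpa using this
  have e3 := trRank_union_entries_le_of_orthogonal (k := k) (by omega : 3 ≤ Fintype.card ι)
    (S ∪ entries n a ∪ C) a b' (n - s) (n - 2 * s) (by omega)
    (by
      rintro _ ⟨j, hj, i, rfl⟩
      exact subset_algCl _ (Or.inl (Or.inr ⟨j, by omega, i, rfl⟩)))
    ha0 (fun h => hb0 (by omega)) hab' hbb'
  -- For 2s ≤ n the left side equals n(2N - 3) - s(N - 4), so N ≥ 4 is exactly what is needed. For
  -- 2s > n it equals 2n(N - 1) - s(N - 2), and n < 2s ≤ s(N - 2).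
  have key : n * (N - 1) + s + ((n - 2 * s) * (N - 2) + (n - s - (n - 2 * s)) * (N - 1)) ≤
      n * (2 * N - 3) := by
    obtain ⟨M, hM⟩ : ∃ M, N = M + 4 := ⟨N - 4, by omega⟩
    rw [hM]
    rcases le_or_gt (2 * s) n with h2s | h2s
    · obtain ⟨q, rfl⟩ := Nat.exists_eq_add_of_le h2s
      have h1 : 2 * s + q - 2 * s = q := by omega
      have h2 : 2 * s + q - s - q = s := by omega
      rw [h1, h2]
      simp only [show M + 4 - 1 = M + 3 by omega, show M + 4 - 2 = M + 2 by omega,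
        show 2 * (M + 4) - 3 = 2 * M + 5 by omega]
      nlinarith [Nat.zero_le (s * M)]
    · have h1 : n - 2 * s = 0 := by omega
      obtain ⟨q, rfl⟩ := Nat.exists_eq_add_of_le hs
      have h2 : s + q - s - 0 = q := by omega
      rw [h1, h2]
      simp only [show M + 4 - 1 = M + 3 by omega, show M + 4 - 2 = M + 2 by omega,
        show 2 * (M + 4) - 3 = 2 * M + 5 by omega]
      nlinarith [Nat.zero_le (s * M)]
  calc _ ≤ _ := trRank_mono_algCl hsub
    _ ≤ _ := e3
    _ ≤ trRank k S + (n * (N - 1) : ℕ) + s + _ := by gcongr; exact e2.trans (by gcongr)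
    _ = trRank k S + (n * (N - 1) + s + ((n - 2 * s) * (N - 2) +
        (n - s - (n - 2 * s)) * (N - 1)) : ℕ) := by push_cast; ring
    _ ≤ _ := by gcongr

/-- Two vectors of jets spanning an isotropic subspace satisfy the expected number of
conditions. -/
theorem trRank_union_jets_le [CharZero k] (hι : 4 ≤ Fintype.card ι) (S : Set K) (n : ℕ)
    (a b : ι → PowerSeries K) (haa : X ^ n ∣ ∑ i, a i * a i) (hab : X ^ n ∣ ∑ i, a i * b i)
    (hbb : X ^ n ∣ ∑ i, b i * b i) :
    trRank k (S ∪ entries n a ∪ entries n b) ≤ trRank k S + (n * (2 * Fintype.card ι - 3) : ℕ) := by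
  induction n using Nat.strong_induction_on generalizing a b with
  | _ n ih =>
  by_cases ha0 : (fun i => coeff 0 (a i)) = 0
  swap
  · exact trRank_union_jets_le_of_ne_zero hι S n a b haa hab hbb ha0
  by_cases hb0 : (fun i => coeff 0 (b i)) = 0
  swap
  · rw [Set.union_right_comm]
    simp only [mul_comm (a _)] at hab
    exact trRank_union_jets_le_of_ne_zero hι S n b a hbb hab haa hb0
  have hdiv : ∀ v : ι → PowerSeries K, (fun i => coeff 0 (v i)) = 0 →
      ∃ v' : ι → PowerSeries K, ∀ i, v i = X * v' i := fun v hv => by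
    have : ∀ i, X ∣ v i := fun i => by
      rw [PowerSeries.X_dvd_iff]
      simpa using congrFun hv i
    choose v' hv' using this
    exact ⟨v', hv'⟩
  obtain ⟨a', ha'⟩ := hdiv a ha0
  obtain ⟨b', hb'⟩ := hdiv b hb0
  have hent : ∀ v v' : ι → PowerSeries K, (∀ i, v i = X * v' i) → ∀ T : Set K,
      (entries n v' ⊆ algCl k T → entries (n + 1) v ⊆ algCl k T) := by
    rintro v v' hv T hT _ ⟨j, hj, i, rfl⟩
    rw [hv]
    cases j with
    | zero => simp [zero_mem]
    | succ j =>
      rw [PowerSeries.coeff_succ_X_mul]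
      exact hT ⟨j, by omega, i, rfl⟩
  have hentz : ∀ v : ι → PowerSeries K, (fun i => coeff 0 (v i)) = 0 → ∀ T : Set K,
      entries 1 v ⊆ algCl k T := by
    rintro v hv T _ ⟨j, hj, i, rfl⟩
    obtain rfl : j = 0 := by omega
    rw [show coeff 0 (v i) = 0 from congrFun hv i]
    exact zero_mem _
  match n, ih, haa, hab, hbb, hent with
  | 0, _, _, _, _, _ => simp [entries_zero]
  | 1, _, _, _, _, _ =>
    refine (trRank_mono_algCl (T := S) (Set.union_subset (Set.union_subset (subset_algCl _) ?_)
      ?_)).trans le_self_add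
    · exact hentz a ha0 S
    · exact hentz b hb0 S
  -- Both vectors are divisible by X. The quotients satisfy the equations modulo X^n, with their
  -- order n coefficients left free. This gives 2N extra parameters against an allowance of 2(2N -
  -- 3).
  | n + 2, ih, haa, hab, hbb, hent =>
    have hX2 : (X : PowerSeries K) ^ 2 ≠ 0 := pow_ne_zero _ PowerSeries.X_ne_zero
    have hshift : ∀ u v u' v' : ι → PowerSeries K, (∀ i, u i = X * u' i) → (∀ i, v i = X * v' i) →
        X ^ (n + 2) ∣ ∑ i, u i * v i → X ^ n ∣ ∑ i, u' i * v' i := fun u v u' v' hu hv h => by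
      have h1 : ∑ i, u i * v i = X ^ 2 * ∑ i, u' i * v' i := by
        rw [Finset.mul_sum]
        exact Finset.sum_congr rfl fun i _ => by rw [hu, hv]; ring
      rwa [h1, add_comm, pow_add, mul_dvd_mul_iff_left hX2] at h
    have h := ih n (by omega) a' b' (hshift a a a' a' ha' ha' haa) (hshift a b a' b' ha' hb' hab)
      (hshift b b b' b' hb' hb' hbb)
    set T := S ∪ entries n a' ∪ entries n b'
    have hle : ∀ v : ι → PowerSeries K, (Set.range fun i => coeff n (v i)).encard ≤
        Fintype.card ι := fun v => by
      have := Set.encard_image_le (fun i => coeff n (v i)) Set.univ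
      rw [Set.image_univ, Set.encard_univ] at this
      simpa using this
    have h2 : S ∪ entries (n + 2) a ∪ entries (n + 2) b ⊆
        algCl k (T ∪ ((Set.range fun i => coeff n (a' i)) ∪ Set.range fun i => coeff n (b' i))) := by
      have h3 : ∀ v v' : ι → PowerSeries K, (∀ i, v i = X * v' i) → ∀ T : Set K,
          entries (n + 1) v' ⊆ T → entries (n + 2) v ⊆ algCl k T := by
        rintro v v' hv T hT _ ⟨j, hj, i, rfl⟩
        rw [hv]
        cases j with
        | zero => simp [zero_mem]
        | succ j =>
          rw [PowerSeries.coeff_succ_X_mul]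
          exact subset_algCl _ (hT ⟨j, by omega, i, rfl⟩)
      refine Set.union_subset (Set.union_subset ?_ (h3 a a' ha' _ ?_)) (h3 b b' hb' _ ?_)
      · exact fun x hx => subset_algCl _ (Or.inl (Or.inl (Or.inl hx)))
      · rw [entries_succ]
        rintro x (hx | hx)
        · exact Or.inl (Or.inl (Or.inr hx))
        · exact Or.inr (Or.inl hx)
      · rw [entries_succ]
        rintro x (hx | hx)
        · exact Or.inl (Or.inr hx)
        · exact Or.inr (Or.inr hx)
    calc _ ≤ _ := trRank_mono_algCl h2
      _ ≤ trRank k T + (Fintype.card ι + Fintype.card ι) :=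
        (trRank_union_le _ _).trans (by
          gcongr
          exact (Set.encard_union_le _ _).trans (add_le_add (hle _) (hle _)))
      _ ≤ trRank k S + (n * (2 * Fintype.card ι - 3) : ℕ) + (Fintype.card ι + Fintype.card ι) := by
        gcongr
      _ = trRank k S + (n * (2 * Fintype.card ι - 3) + (Fintype.card ι + Fintype.card ι) : ℕ) := by
        push_cast; ring
      _ ≤ _ := by
        gcongr
        rw [add_mul]
        omega

end Jets

end SOData

/-! ### Normal form of a self-adjoint operator for an alternating form -/

namespace SOData

open Module

section NormalForm

variable {F V : Type*} [Field F] [AddCommGroup V] [Module F V]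

/-- The sign of a vector of a hyperbolic pair. -/
def pairSign (F : Type*) [Field F] (ε : Bool) : F := if ε then -1 else 1

theorem pairSign_mul_self (ε : Bool) : pairSign F ε * pairSign F ε = 1 := by
  cases ε <;> simp [pairSign]

/-- Chains of generalized eigenvectors of a self-adjoint operator for an alternating form, in
hyperbolic position. -/
structure IsHyperbolicChains (ω : LinearMap.BilinForm F V) (B : End F V) {ι : Type*} (n : ι → ℕ)
    (lam : ι → F) (v : ι → Bool → V) : Prop where
  pos : ∀ j, 0 < n j
  pow_apply : ∀ j ε, ((B - algebraMap F (End F V) (lam j)) ^ n j) (v j ε) = 0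
  form_self : ∀ j a b ε ε', a < n j → b < n j →
    ω (((B - algebraMap F (End F V) (lam j)) ^ a) (v j ε))
      (((B - algebraMap F (End F V) (lam j)) ^ b) (v j ε')) =
      if ε ≠ ε' ∧ a + b + 1 = n j then pairSign F ε else 0
  form_ne : ∀ j j' a b ε ε', j ≠ j' →
    ω (((B - algebraMap F (End F V) (lam j)) ^ a) (v j ε))
      (((B - algebraMap F (End F V) (lam j')) ^ b) (v j' ε')) = 0

theorem form_pow_comm {ω : LinearMap.BilinForm F V} {N : End F V}
    (hN : ∀ x y, ω (N x) y = ω x (N y)) (a : ℕ) (x y : V) : ω ((N ^ a) x) y = ω x ((N ^ a) y) := by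
  induction a generalizing x y with
  | zero => rfl
  | succ a ih =>
    rw [pow_succ' N, Module.End.mul_apply, hN, ih, ← Module.End.mul_apply, ← pow_succ, pow_succ']

/-- Moving powers of N across gives (x, Nˢx) = (Nˢx, x), and alternation gives the opposite sign. -/
theorem form_pow_pow_self (h2 : (2 : F) ≠ 0) {ω : LinearMap.BilinForm F V} (hω : ω.IsAlt)
    {N : End F V} (hN : ∀ x y, ω (N x) y = ω x (N y)) (a b : ℕ) (x : V) :
    ω ((N ^ a) x) ((N ^ b) x) = 0 := by
  rw [form_pow_comm hN, ← Module.End.mul_apply, ← pow_add]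
  have h1 := form_pow_comm hN (a + b) x x
  rw [← hω.neg_eq] at h1
  have h3 : (2 : F) * ω x ((N ^ (a + b)) x) = 0 := by linear_combination -h1
  exact (mul_eq_zero.1 h3).resolve_left h2

/-- Take v generating a longest Jordan chain in the generalized kernel, and w₁ there pairing
nontrivially with the end of the chain. The pairings of w₁ with the chain form a unit power series
C, and w = C⁻¹(N)w₁ makes the Gram matrix standard. Pairings within one chain vanish automatically.
-/
theorem exists_hyperbolic_pair [FiniteDimensional F V] (h2 : (2 : F) ≠ 0)
    {ω : LinearMap.BilinForm F V} (hω : ω.IsAlt) (hnd : ω.Nondegenerate)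
    {N : End F V} (hN : ∀ x y, ω (N x) y = ω x (N y)) (hker : ∃ x ≠ 0, N x = 0) :
    ∃ (n : ℕ) (v : Bool → V), 0 < n ∧ (∀ ε, (N ^ n) (v ε) = 0) ∧
      ∀ a b ε ε', a < n → b < n → ω ((N ^ a) (v ε)) ((N ^ b) (v ε')) =
        if ε ≠ ε' ∧ a + b + 1 = n then pairSign F ε else 0 := by
  classical
  -- Fitting decomposition: N is nilpotent on the kernel of N^M, and n below is its nilpotency index
  -- there.
  obtain ⟨M, hM, hM1⟩ := (N.eventually_isCompl_ker_pow_range_pow.and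
    (Filter.eventually_ge_atTop 1)).exists
  have hex : ∃ n, ∀ x, (N ^ M) x = 0 → (N ^ n) x = 0 := ⟨M, fun _ h => h⟩
  obtain ⟨n, hn, hmin⟩ : ∃ n, (∀ x, (N ^ M) x = 0 → (N ^ n) x = 0) ∧
      ∀ m < n, ¬ ∀ x, (N ^ M) x = 0 → (N ^ m) x = 0 :=
    ⟨Nat.find hex, Nat.find_spec hex, fun _ => Nat.find_min hex⟩
  have hn0 : 0 < n := by
    obtain ⟨x, hx0, hx⟩ := hker
    rw [Nat.pos_iff_ne_zero]
    intro h
    have h1 : (N ^ M) x = 0 := by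
      obtain ⟨m, rfl⟩ := Nat.exists_eq_add_of_le' hM1
      rw [pow_succ, Module.End.mul_apply, hx, map_zero]
    have h3 := hn x h1
    rw [h] at h3
    exact hx0 h3
  obtain ⟨v, hvM, hv⟩ : ∃ v, (N ^ M) v = 0 ∧ (N ^ (n - 1)) v ≠ 0 := by
    have := hmin (n - 1) (Nat.sub_lt hn0 one_pos)
    push Not at this
    exact this
  obtain ⟨w0, hw0⟩ : ∃ w, ω ((N ^ (n - 1)) v) w ≠ 0 := by
    by_contra! h
    exact hv (hnd.1 _ h)
  obtain ⟨w1, hw1, w2, hw2, hw⟩ : ∃ w1 ∈ LinearMap.ker (N ^ M), ∃ w2 ∈ LinearMap.range (N ^ M),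
      w1 + w2 = w0 := by
    have : w0 ∈ LinearMap.ker (N ^ M) ⊔ LinearMap.range (N ^ M) := by
      rw [hM.sup_eq_top]; trivial
    exact Submodule.mem_sup.1 this
  obtain ⟨u, rfl⟩ := hw2
  have hvn := hn v hvM
  have hw1n := hn w1 hw1
  have hvz : ∀ s, n ≤ s → (N ^ s) v = 0 := fun s hs => by
    obtain ⟨q, rfl⟩ := Nat.exists_eq_add_of_le' hs
    rw [pow_add, Module.End.mul_apply, hvn, map_zero]
  -- The component of w0 in the range of N^M pairs to zero, since moving N^M across kills v; here M
  -- ≥ 1 is used.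
  have hw1' : ω ((N ^ (n - 1)) v) w1 ≠ 0 := by
    rw [← hw, map_add, ← form_pow_comm hN M, ← Module.End.mul_apply, ← pow_add,
      hvz (M + (n - 1)) (by omega)] at hw0
    simpa using hw0
  let C : PowerSeries F := PowerSeries.mk fun j => if j < n then ω ((N ^ (n - 1 - j)) v) w1 else 0
  have hC0 : PowerSeries.constantCoeff C ≠ 0 := by
    rw [← PowerSeries.coeff_zero_eq_constantCoeff_apply, PowerSeries.coeff_mk, if_pos hn0]
    exact hw1'
  let w : V := ∑ j ∈ Finset.range n, PowerSeries.coeff j C⁻¹ • (N ^ j) w1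
  have hvw : ∀ s < n, ω ((N ^ s) v) w = if s + 1 = n then 1 else 0 := by
    intro s hs
    have h3 := congrArg (PowerSeries.coeff (n - 1 - s)) (PowerSeries.inv_mul_cancel C hC0)
    rw [PowerSeries.coeff_mul, Finset.Nat.sum_antidiagonal_eq_sum_range_succ_mk,
      PowerSeries.coeff_one] at h3
    have h4 : (n - 1 - s = 0) ↔ s + 1 = n := by omega
    simp only [h4] at h3
    rw [← h3, map_sum]
    symm
    apply Finset.sum_subset_zero_on_sdiff
    · intro j; simp only [Finset.mem_range]; omega
    · intro j hj
      simp only [Finset.mem_sdiff, Finset.mem_range] at hj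
      rw [map_smul, ← form_pow_comm hN, ← Module.End.mul_apply, ← pow_add, hvz _ (by omega)]
      simp
    · intro j hj
      simp only [Finset.mem_range] at hj
      rw [map_smul, smul_eq_mul, ← form_pow_comm hN, ← Module.End.mul_apply, ← pow_add,
        PowerSeries.coeff_mk, if_pos (by omega),
        show n - 1 - (n - 1 - s - j) = j + s by omega]
  refine ⟨n, fun ε => if ε then w else v, hn0, ?_, ?_⟩
  · intro ε
    cases ε
    · simpa using hvn
    · simp only [if_true, w, map_sum, map_smul]
      refine Finset.sum_eq_zero fun j _ => ?_
      rw [← Module.End.mul_apply, ← pow_add, add_comm, pow_add, Module.End.mul_apply, hw1n,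
        map_zero, smul_zero]
  · have hvw' : ∀ a b, a < n → b < n → ω ((N ^ a) v) ((N ^ b) w) =
        if a + b + 1 = n then 1 else 0 := by
      intro a b ha hb
      rw [← form_pow_comm hN, ← Module.End.mul_apply, ← pow_add, add_comm b]
      rcases lt_or_ge (a + b) n with h | h
      · exact hvw _ h
      · rw [hvz _ h, if_neg (by omega)]; simp
    intro a b ε ε' ha hb
    cases ε <;> cases ε'
    · simp [form_pow_pow_self h2 hω hN]
    · simp [hvw' a b ha hb, pairSign]
    · have := hvw' b a hb ha
      rw [add_comm b] at this
      rw [← hω.neg_eq]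
      simp only [Bool.false_eq_true, if_false, if_true, this, pairSign]
      split_ifs <;> simp_all
    · simp [form_pow_pow_self h2 hω hN]

/-- Reversing a chain and exchanging the two chains of the pair gives a dual basis inside the same
span. The form is therefore nondegenerate on the span, which splits off orthogonally. -/
theorem form_pair_dual {ω : LinearMap.BilinForm F V} {N : End F V} {n : ℕ} {v : Bool → V}
    (h : ∀ a b ε ε', a < n → b < n → ω ((N ^ a) (v ε)) ((N ^ b) (v ε')) =
        if ε ≠ ε' ∧ a + b + 1 = n then pairSign F ε else 0) (x y : Fin n × Bool) :
    ω ((N ^ x.1.1) (v x.2)) (pairSign F y.2 • (N ^ (n - 1 - y.1.1)) (v (!y.2))) =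
      if x = y then 1 else 0 := by
  obtain ⟨a, ε⟩ := x
  obtain ⟨b, ε'⟩ := y
  have ha := a.2
  have hb := b.2
  dsimp only
  rw [map_smul, h _ _ _ _ ha (by omega), smul_eq_mul]
  by_cases h1 : ε = ε' ∧ a.1 = b.1
  · obtain ⟨rfl, h1⟩ := h1
    rw [if_pos ⟨by simp, by omega⟩, if_pos (by rw [Fin.ext h1]), pairSign_mul_self]
  · rw [if_neg, if_neg, mul_zero]
    · rintro h2
      exact h1 ⟨congrArg Prod.snd h2, congrArg (fun x => x.1.1) h2⟩
    · rintro ⟨h2, h3⟩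
      refine h1 ⟨?_, by omega⟩
      cases ε <;> cases ε' <;> simp_all

/-- The minimal polynomial has a root because it divides the split polynomial p, and a hyperbolic
pair of chains for that eigenvalue splits off. The orthogonal complement is stable under B and again
nondegenerate, so induction on the dimension applies. The field need not be algebraically closed. -/
theorem exists_isHyperbolicChains [FiniteDimensional F V] (h2 : (2 : F) ≠ 0)
    {ω : LinearMap.BilinForm F V} (hω : ω.IsAlt) (hnd : ω.Nondegenerate)
    {B : End F V} (hB : ∀ x y, ω (B x) y = ω x (B y)) {p : Polynomial F} (hp0 : p ≠ 0)
    (hp : p.Splits) (hpB : Polynomial.aeval B p = 0) :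
    ∃ (ι : Type) (_ : Fintype ι) (n : ι → ℕ) (lam : ι → F) (v : ι → Bool → V),
      IsHyperbolicChains ω B n lam v ∧ (∀ j, p.IsRoot (lam j)) ∧
      Submodule.span F (Set.range fun x : Σ j, Fin (n j) × Bool =>
        ((B - algebraMap F (End F V) (lam x.1)) ^ x.2.1.1) (v x.1 x.2.2)) = ⊤ := by
  classical
  obtain ⟨d, hd⟩ : ∃ d, finrank F V = d := ⟨_, rfl⟩
  induction d using Nat.strong_induction_on generalizing V with
  | _ d ih =>
  rcases subsingleton_or_nontrivial V with hV | hV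
  · exact ⟨Empty, inferInstance, Empty.rec, Empty.rec, Empty.rec,
      ⟨fun j => j.elim, fun j => j.elim, fun j => j.elim, fun j => j.elim⟩, fun j => j.elim,
      Subsingleton.elim _ _⟩
  obtain ⟨lam, hlam⟩ : ∃ a, (minpoly F B).IsRoot a := by
    refine (hp.of_dvd hp0 (minpoly.dvd F B hpB)).exists_eval_eq_zero ?_
    exact (minpoly.degree_pos (Algebra.IsIntegral.isIntegral B)).ne'
  obtain ⟨x0, hx0⟩ := (Module.End.hasEigenvalue_of_isRoot hlam).exists_hasEigenvector
  let N : End F V := B - algebraMap F _ lam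
  have hN : ∀ x y, ω (N x) y = ω x (N y) := fun x y => by
    simp [N, hB, Module.algebraMap_end_apply]
  obtain ⟨n, v, hn0, hvn, hgram⟩ := exists_hyperbolic_pair h2 hω hnd hN
    ⟨x0, hx0.2, by simp [N, hx0.apply_eq_smul, Module.algebraMap_end_apply]⟩
  let e : Fin n × Bool → V := fun x => (N ^ x.1.1) (v x.2)
  let f : Fin n × Bool → V := fun y => pairSign F y.2 • (N ^ (n - 1 - y.1.1)) (v (!y.2))
  have hef : ∀ x y, ω (e x) (f y) = if x = y then 1 else 0 := form_pair_dual hgram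
  let U : Submodule F V := Submodule.span F (Set.range e)
  have heU : ∀ x, e x ∈ U := fun x => Submodule.subset_span ⟨x, rfl⟩
  have hNv : ∀ a ε, (N ^ a) (v ε) ∈ U := fun a ε => by
    rcases lt_or_ge a n with h | h
    · exact heU ⟨⟨a, h⟩, ε⟩
    · obtain ⟨q, rfl⟩ := Nat.exists_eq_add_of_le' h
      rw [pow_add, Module.End.mul_apply, hvn, map_zero]
      exact zero_mem _
  have hfU : ∀ x, f x ∈ U := fun x => U.smul_mem _ (hNv _ _)
  let U' : Submodule F V :=
    { carrier := {z | ∀ a ε, ω z ((N ^ a) (v ε)) = 0}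
      add_mem' := fun hx hy a ε => by rw [map_add, LinearMap.add_apply, hx, hy, add_zero]
      zero_mem' := fun a ε => by simp
      smul_mem' := fun c x hx a ε => by rw [map_smul, LinearMap.smul_apply, hx, smul_zero] }
  have hU' : ∀ z ∈ U', ∀ u ∈ U, ω z u = 0 := by
    intro z hz u hu
    refine Submodule.span_induction (p := fun u _ => ω z u = 0) ?_ (by simp) ?_ ?_ hu
    · rintro _ ⟨x, rfl⟩; exact hz _ _
    · intro x y _ _ hx hy; rw [map_add, hx, hy, add_zero]
    · intro c x _ hx; rw [map_smul, hx, smul_zero]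
  have hfspan : ∀ z, (∀ y, ω z (f y) = 0) → z ∈ U' := by
    intro z hz a ε
    rcases lt_or_ge a n with h | h
    · have h1 := hz ⟨⟨n - 1 - a, by omega⟩, !ε⟩
      simp only [f, Bool.not_not, map_smul, smul_eq_mul] at h1
      rw [show n - 1 - (n - 1 - a) = a by omega] at h1
      refine (mul_eq_zero.1 h1).resolve_left ?_
      cases ε <;> simp [pairSign]
    · obtain ⟨q, rfl⟩ := Nat.exists_eq_add_of_le' h
      rw [pow_add, Module.End.mul_apply, hvn, map_zero, map_zero]
  have hdecomp : ∀ z, ∃ u ∈ U, ∃ y ∈ U', z = u + y := by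
    intro z
    refine ⟨∑ x, ω z (f x) • e x, sum_mem fun x _ => U.smul_mem _ (heU x),
      z - ∑ x, ω z (f x) • e x, hfspan _ fun y => ?_, by abel⟩
    rw [map_sub, LinearMap.sub_apply, map_sum, LinearMap.sum_apply]
    simp [hef]
  have hBU' : ∀ z ∈ U', B z ∈ U' := by
    intro z hz a ε
    have h1 : B z = N z + lam • z := by simp [N, Module.algebraMap_end_apply]
    rw [h1, map_add, map_smul, LinearMap.add_apply, LinearMap.smul_apply, hz, smul_zero, add_zero,
      hN, ← Module.End.mul_apply, ← pow_succ']
    exact hz _ _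
  let B' : End F U' := B.restrict hBU'
  let ω' : LinearMap.BilinForm F U' := ω.restrict U'
  have hω' : ∀ x y, ω' x y = ω x y := fun x y => rfl
  have hnd' : ω'.Nondegenerate := by
    have hleft : ∀ x : U', (∀ y, ω' x y = 0) → x = 0 := by
      intro x hx
      refine Subtype.ext (hnd.1 _ fun z => ?_)
      obtain ⟨u, hu, y, hy, rfl⟩ := hdecomp z
      rw [map_add, hU' _ x.2 u hu, zero_add]
      exact hx ⟨y, hy⟩
    refine ⟨hleft, fun y hy => hleft y fun x => ?_⟩
    rw [hω', ← hω.neg_eq, neg_eq_zero]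
    exact hy x
  have hlt : finrank F U' < d := by
    rw [← hd]
    refine Submodule.finrank_lt ?_
    intro htop
    have h1 : e (⟨0, hn0⟩, false) ∈ U' := htop ▸ Submodule.mem_top
    have h3 := hU' _ h1 _ (hfU (⟨0, hn0⟩, false))
    rw [hef, if_pos rfl] at h3
    exact one_ne_zero h3
  have hpB' : Polynomial.aeval B' p = 0 := by
    ext x
    have hcomm : (B.comp U'.subtype : U' →ₗ[F] V) = U'.subtype.comp B' := rfl
    have h1 := fun i => LinearMap.congr_fun (Module.End.commute_pow_left_of_commute hcomm i) x
    have h3 := LinearMap.congr_fun hpB (x : V)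
    rw [Polynomial.aeval_eq_sum_range, LinearMap.sum_apply] at h3 ⊢
    rw [Submodule.coe_sum]
    refine (Finset.sum_congr rfl fun i _ => ?_).trans h3
    exact congrArg (p.coeff i • ·) (h1 i).symm
  obtain ⟨ι, _, n', lam', v', hch, hroot, hspan⟩ := ih _ hlt (V := U') (ω := ω') (B := B') (fun x => hω x) hnd'
    (fun x y => hB x y) hpB' rfl
  have hcoe : ∀ (c : F) (a : ℕ) (x : U'), ((((B' - algebraMap F _ c) ^ a) x : U') : V) =
      ((B - algebraMap F _ c) ^ a) x := fun c a x => by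
    have hcomm : ((B - algebraMap F _ c).comp U'.subtype : U' →ₗ[F] V) =
      U'.subtype.comp (B' - algebraMap F _ c) := rfl
    exact (LinearMap.congr_fun (Module.End.commute_pow_left_of_commute hcomm a) x).symm
  refine ⟨Option ι, inferInstance, fun o => o.elim n n', fun o => o.elim lam lam',
    fun o ε => o.elim (v ε) fun j => (v' j ε : V), ⟨?_, ?_, ?_, ?_⟩, ?_, ?_⟩
  · rintro (_ | j)
    · exact hn0
    · exact hch.pos j
  · rintro (_ | j) ε
    · exact hvn ε
    · have := congrArg Subtype.val (hch.pow_apply j ε)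
      rw [hcoe] at this
      exact this
  · rintro (_ | j) a b ε ε' ha hb
    · exact hgram a b ε ε' ha hb
    · have := hch.form_self j a b ε ε' ha hb
      rw [hω', hcoe, hcoe] at this
      exact this
  · have hmix : ∀ j a b ε ε', ω (((B - algebraMap F (End F V) (lam' j)) ^ a) (v' j ε : V))
        ((N ^ b) (v ε')) = 0 := fun j a b ε ε' => by
      rw [← hcoe]
      exact hU' _ (Subtype.prop _) _ (hNv b ε')
    rintro (_ | j) (_ | j') a b ε ε' hne
    · exact absurd rfl hne
    · change ω ((N ^ a) (v ε)) (((B - algebraMap F (End F V) (lam' j')) ^ b) (v' j' ε' : V)) = 0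
      rw [← hω.neg_eq, hmix, neg_zero]
    · exact hmix j a b ε ε'
    · have := hch.form_ne j j' a b ε ε' (fun h => hne (congrArg some h))
      rw [hω', hcoe, hcoe] at this
      exact this
  · rintro (_ | j)
    · exact hlam.dvd (minpoly.dvd F B hpB)
    · exact hroot j
  · rw [eq_top_iff]
    rintro z -
    obtain ⟨u, hu, y, hy, rfl⟩ := hdecomp z
    refine add_mem ?_ ?_
    · refine Submodule.span_mono ?_ hu
      rintro _ ⟨x, rfl⟩
      exact ⟨⟨none, x⟩, rfl⟩
    · have h1 : (⟨y, hy⟩ : U') ∈ Submodule.span F _ := hspan ▸ Submodule.mem_top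
      have h3 := Submodule.mem_map_of_mem (f := U'.subtype) h1
      rw [Submodule.map_span] at h3
      refine Submodule.span_mono ?_ h3
      rintro _ ⟨_, ⟨x, rfl⟩, rfl⟩
      exact ⟨⟨some x.1, x.2⟩, (hcoe _ _ _).symm⟩

end NormalForm

end SOData

/-! ### Derivations in characteristic zero; self-adjoint and skew-adjoint matrices -/

namespace SOData

open Module

section Derivations

open scoped TensorProduct

variable {k F : Type*} [Field k] [Field F] [Algebra k F] [CharZero k]

/-- In characteristic zero there are derivations dual to a transcendence basis. -/
theorem exists_derivation_of_isTranscendenceBasis {ι : Type*} {y : ι → F}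
    (hy : IsTranscendenceBasis k y) (i : ι) :
    ∃ D : Derivation k F F, D (y i) = 1 ∧ ∀ j ≠ i, D (y j) = 0 := by
  classical
  let P := MvPolynomial ι k
  have hinj : Function.Injective (MvPolynomial.aeval y : P →ₐ[k] F) :=
    algebraicIndependent_iff_injective_aeval.1 hy.1
  let _ : Algebra P F := (MvPolynomial.aeval y : P →ₐ[k] F).toRingHom.toAlgebra
  have hmap : ∀ p : P, algebraMap P F p = MvPolynomial.aeval y p := fun _ => rfl
  have : IsScalarTower k P F := IsScalarTower.of_algebraMap_eq fun c => by
    rw [hmap]; exact ((MvPolynomial.aeval y).commutes c).symm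
  have hinj' : Function.Injective (algebraMap P F) := hinj
  let E := FractionRing P
  let _ : Algebra E F := (IsFractionRing.lift hinj' : E →+* F).toAlgebra
  have : IsScalarTower P E F := IsScalarTower.of_algebraMap_eq fun p =>
    (IsFractionRing.lift_algebraMap hinj' p).symm
  have halg : Algebra.IsAlgebraic P F := by
    have h1 := hy.isAlgebraic
    refine ⟨fun x => ?_⟩
    obtain ⟨q, hq0, hq⟩ := h1.isAlgebraic x
    let e : P ≃ₐ[k] Algebra.adjoin k (Set.range y) := hy.1.aevalEquiv
    refine ⟨q.map e.symm.toRingEquiv.toRingHom,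
      (Polynomial.map_ne_zero_iff e.symm.injective).2 hq0, ?_⟩
    rw [Polynomial.aeval_def, Polynomial.eval₂_map, ← hq, Polynomial.aeval_def]
    congr 1
    ext a
    change MvPolynomial.aeval y (e.symm a) = a
    rw [← hy.1.algebraMap_aevalEquiv]
    change algebraMap _ F (e (e.symm a)) = a
    rw [e.apply_symm_apply]
    rfl
  have : Algebra.IsAlgebraic E F := ⟨fun x => (IsFractionRing.isAlgebraic_iff P E F).1 (halg.isAlgebraic x)⟩
  have : CharZero E := charZero_of_injective_algebraMap (algebraMap k E).injective
  -- In characteristic zero an algebraic extension is separable, so F is formally étale over k[y].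
  -- Its differentials are then base-changed from k[y], and a partial derivative extends to F.
  have : Algebra.FormallyEtale E F := Algebra.FormallyEtale.of_isSeparable E F
  have : Algebra.FormallyEtale P E := Algebra.FormallyEtale.of_isLocalization (nonZeroDivisors P)
  have : Algebra.FormallyEtale P F := Algebra.FormallyEtale.comp P E F
  let d : Derivation k P F := MvPolynomial.mkDerivation k (Pi.single i 1)
  let φ : Ω[F⁄k] →ₗ[F] F := (d.liftKaehlerDifferential.liftBaseChange F).comp
    (KaehlerDifferential.tensorKaehlerEquivOfFormallyEtale k P F).symm.toLinearMap
  have hφ : ∀ j, φ.compDer (KaehlerDifferential.D k F) (y j) = Pi.single (M := fun _ => F) i 1 j := by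
    intro j
    have h1 : y j = algebraMap P F (MvPolynomial.X j) := by rw [hmap, MvPolynomial.aeval_X]
    rw [h1]
    refine (congrArg (d.liftKaehlerDifferential.liftBaseChange F)
      (KaehlerDifferential.tensorKaehlerEquivOfFormallyEtale_symm_D_algebraMap k P F
        (MvPolynomial.X j))).trans ?_
    rw [LinearMap.liftBaseChange_tmul, one_smul, Derivation.liftKaehlerDifferential_comp_D,
      MvPolynomial.mkDerivation_X]
  refine ⟨φ.compDer (KaehlerDifferential.D k F), ?_, fun j hj => ?_⟩
  · rw [hφ, Pi.single_eq_same]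
  · rw [hφ, Pi.single_eq_of_ne hj]

theorem exists_derivation_of_algebraicIndependent {ι : Type*} {y : ι → F}
    (hy : AlgebraicIndependent k y) (i : ι) :
    ∃ D : Derivation k F F, D (y i) = 1 ∧ ∀ j ≠ i, D (y j) = 0 := by
  obtain ⟨t, ht, htb⟩ := exists_isTranscendenceBasis_superset
    (s := Set.range y) (R := k) hy.coe_range
  obtain ⟨D, hD1, hD2⟩ := exists_derivation_of_isTranscendenceBasis htb ⟨y i, ht ⟨i, rfl⟩⟩
  refine ⟨D, hD1, fun j hj => hD2 ⟨y j, ht ⟨j, rfl⟩⟩ ?_⟩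
  intro h
  exact hj (hy.injective (congrArg Subtype.val h))

end Derivations

section MatrixSpaces

variable {F : Type*} [Field F] {m : Type*} [Fintype m] [DecidableEq m]

/-- The matrices self-adjoint for the form with matrix `J`. -/
def selfAdj (J : Matrix m m F) : Submodule F (Matrix m m F) where
  carrier := {Y | Y.transpose * J = J * Y}
  add_mem' hx hy := by
    simp only [Set.mem_ofPred_eq] at *
    rw [Matrix.transpose_add, add_mul, mul_add, hx, hy]
  zero_mem' := by simp
  smul_mem' c x hx := by
    simp only [Set.mem_ofPred_eq] at *
    rw [Matrix.transpose_smul, Matrix.smul_mul, hx, Matrix.mul_smul]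

/-- The matrices skew-adjoint for the form with matrix `J`. -/
def skewAdj (J : Matrix m m F) : Submodule F (Matrix m m F) where
  carrier := {Y | Y.transpose * J = -(J * Y)}
  add_mem' hx hy := by
    simp only [Set.mem_ofPred_eq] at *
    rw [Matrix.transpose_add, add_mul, mul_add, hx, hy, neg_add]
  zero_mem' := by simp
  smul_mem' c x hx := by
    simp only [Set.mem_ofPred_eq] at *
    rw [Matrix.transpose_smul, Matrix.smul_mul, hx, Matrix.mul_smul, smul_neg]

theorem mem_selfAdj {J Y : Matrix m m F} : Y ∈ selfAdj J ↔ Y.transpose * J = J * Y := Iff.rfl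

theorem mem_skewAdj {J Y : Matrix m m F} : Y ∈ skewAdj J ↔ Y.transpose * J = -(J * Y) := Iff.rfl

/-- The centralizer of a matrix, as a subspace. -/
def matrixCentralizer (B : Matrix m m F) : Submodule F (Matrix m m F) where
  carrier := {Y | B * Y = Y * B}
  add_mem' hx hy := by
    simp only [Set.mem_ofPred_eq] at *
    rw [mul_add, add_mul, hx, hy]
  zero_mem' := by simp
  smul_mem' c x hx := by
    simp only [Set.mem_ofPred_eq] at *
    rw [Matrix.mul_smul, hx, Matrix.smul_mul]

theorem mem_matrixCentralizer {B Y : Matrix m m F} : Y ∈ matrixCentralizer B ↔ B * Y = Y * B :=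
  Iff.rfl

/-- The symmetric matrix with given entries. -/
def symMatrix (F m : Type*) [Field F] : (Sym2 m → F) →ₗ[F] Matrix m m F where
  toFun f := Matrix.of fun i j => f s(i, j)
  map_add' _ _ := rfl
  map_smul' _ _ := rfl

/-- Since J is antisymmetric, Y ↦ JY identifies the skew-adjoint matrices with the symmetric ones.
-/
theorem finrank_skewAdj {J J' : Matrix m m F} (hJ : J.transpose = -J) (hJJ' : J * J' = 1) :
    finrank F (skewAdj J) = (Fintype.card m + 1).choose 2 := by
  have hJ'J : J' * J = 1 := mul_eq_one_comm.1 hJJ'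
  let ψ : Matrix m m F →ₗ[F] Matrix m m F := LinearMap.mulLeft F J'
  have hψ : Function.Injective (ψ.comp (symMatrix F m)) := by
    intro f f' h
    have h1 : J' * symMatrix F m f = J' * symMatrix F m f' := h
    have h2 := congrArg (J * ·) h1
    simp only [← mul_assoc, hJJ', one_mul] at h2
    ext z
    induction z with
    | _ i j => exact congrFun (congrFun h2 i) j
  have hrange : LinearMap.range (ψ.comp (symMatrix F m)) = skewAdj J := by
    ext Y
    rw [mem_skewAdj]
    constructor
    · rintro ⟨f, rfl⟩
      have hs : (symMatrix F m f).transpose = symMatrix F m f := by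
        ext i j
        exact congrArg f Sym2.eq_swap
      have hJ't : J'.transpose * J = -1 := by
        have h1 := congrArg Matrix.transpose hJJ'
        rw [Matrix.transpose_mul, hJ, Matrix.transpose_one, mul_neg] at h1
        rw [← h1, neg_neg]
      change (J' * symMatrix F m f).transpose * J = -(J * (J' * symMatrix F m f))
      rw [Matrix.transpose_mul, hs, mul_assoc, hJ't, ← mul_assoc, hJJ', one_mul, mul_neg, mul_one]
    · intro hY
      have hs : (J * Y).transpose = J * Y := by
        rw [Matrix.transpose_mul, hJ, mul_neg, hY, neg_neg]
      refine ⟨fun z => Sym2.lift ⟨fun i j => (J * Y) i j, fun i j => ?_⟩ z, ?_⟩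
      · exact (congrFun (congrFun hs i) j).symm
      · change J' * Matrix.of (fun i j => (J * Y) i j) = Y
        change J' * (J * Y) = Y
        rw [← mul_assoc, hJ'J, one_mul]
  rw [← hrange, LinearMap.finrank_range_of_inj hψ, finrank_fintype_fun_eq_card, Sym2.card]

theorem disjoint_selfAdj_skewAdj (h2 : (2 : F) ≠ 0) {J J' : Matrix m m F} (hJJ' : J * J' = 1) :
    Disjoint (selfAdj J) (skewAdj J) := by
  rw [Submodule.disjoint_def]
  intro Y h1 h3
  rw [mem_selfAdj] at h1
  rw [mem_skewAdj, h1] at h3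
  have h4 : (2 : F) • (J * Y) = 0 := by
    rw [two_smul]; nth_rewrite 1 [h3]; rw [neg_add_cancel]
  have h5 := (smul_eq_zero.1 h4).resolve_left h2
  have h6 := congrArg (J' * ·) h5
  simpa only [← mul_assoc, mul_eq_one_comm.1 hJJ', one_mul, mul_zero] using h6

/-- The two spaces are the eigenspaces of the adjoint involution Y ↦ J⁻¹YᵀJ, hence complementary. -/
theorem finrank_selfAdj_add (h2 : (2 : F) ≠ 0) {J J' : Matrix m m F} (hJ : J.transpose = -J)
    (hJJ' : J * J' = 1) :
    finrank F (selfAdj J) + finrank F (skewAdj J) = Fintype.card m * Fintype.card m := by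
  have hJ'J : J' * J = 1 := mul_eq_one_comm.1 hJJ'
  have hsup : selfAdj J ⊔ skewAdj J = ⊤ := by
    rw [eq_top_iff]
    rintro Y -
    have hJ't : J'.transpose * J = -1 := by
      have h1 := congrArg Matrix.transpose hJJ'
      rw [Matrix.transpose_mul, hJ, Matrix.transpose_one, mul_neg] at h1
      rw [← h1, neg_neg]
    let Z := J' * Y.transpose * J
    have hZ : Z.transpose * J = J * Y := by
      simp only [Z, Matrix.transpose_mul, Matrix.transpose_transpose, hJ]
      rw [neg_mul, neg_mul, mul_assoc, mul_assoc, hJ't, mul_neg, mul_neg, mul_one, neg_neg]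
    have hZ' : J * Z = Y.transpose * J := by
      simp only [Z, ← mul_assoc, hJJ', one_mul]
    have hY : Y = (2 : F)⁻¹ • (Y + Z) + (2 : F)⁻¹ • (Y - Z) := by
      rw [← smul_add, add_add_sub_cancel, ← two_smul F, smul_smul, inv_mul_cancel₀ h2, one_smul]
    rw [hY]
    refine Submodule.add_mem_sup (Submodule.smul_mem _ _ ?_) (Submodule.smul_mem _ _ ?_)
    · rw [mem_selfAdj, Matrix.transpose_add, add_mul, mul_add, hZ, hZ', add_comm]
    · rw [mem_skewAdj, Matrix.transpose_sub, sub_mul, mul_sub, hZ, hZ', neg_sub]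
  have h3 := Submodule.finrank_sup_add_finrank_inf_eq (selfAdj J) (skewAdj J)
  rw [hsup, (disjoint_selfAdj_skewAdj h2 hJJ').eq_bot, finrank_bot, finrank_top,
    Module.finrank_matrix, Module.finrank_self] at h3
  omega

/-- The bilinear form `tr (A B)`. -/
def traceMulForm (F m : Type*) [Field F] [Fintype m] : LinearMap.BilinForm F (Matrix m m F) :=
  (LinearMap.mul F (Matrix m m F)).compr₂ (Matrix.traceLinearMap m F F)

theorem traceMulForm_nondegenerate : (traceMulForm F m).Nondegenerate := by
  refine ⟨fun A hA => ?_, fun A hA => ?_⟩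
  · rw [Matrix.ext_iff_trace_mul_right]
    intro B
    rw [zero_mul, Matrix.trace_zero]
    exact hA B
  · rw [Matrix.ext_iff_trace_mul_left]
    intro B
    rw [mul_zero, Matrix.trace_zero]
    exact hA B

/-- Transposing the product and conjugating by J changes the sign of the trace. -/
theorem trace_mul_eq_zero_of_adj (h2 : (2 : F) ≠ 0) {J J' : Matrix m m F}
    (hJJ' : J * J' = 1) {M Z : Matrix m m F} (hM : M ∈ selfAdj J) (hZ : Z ∈ skewAdj J) :
    (Z * M).trace = 0 := by
  have hM' : M.transpose = J * M * J' := by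
    rw [← mem_selfAdj.1 hM, mul_assoc, hJJ', mul_one]
  have hZ' : Z.transpose = -(J * Z * J') := by
    rw [← neg_mul, ← mem_skewAdj.1 hZ, mul_assoc, hJJ', mul_one]
  have h1 : (Z * M).trace = -(Z * M).trace := by
    calc (Z * M).trace = (M.transpose * Z.transpose).trace := by
          rw [← Matrix.transpose_mul, Matrix.trace_transpose]
      _ = -(J * (M * (J' * J) * Z) * J').trace := by
          rw [hM', hZ', mul_neg, Matrix.trace_neg]; simp only [mul_assoc]
      _ = -(Z * M).trace := by
          rw [Matrix.trace_mul_comm, mul_eq_one_comm.1 hJJ', mul_one, ← mul_assoc,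
            mul_eq_one_comm.1 hJJ', one_mul, Matrix.trace_mul_comm]
  have h3 : (2 : F) * (Z * M).trace = 0 := by linear_combination h1
  exact (mul_eq_zero.1 h3).resolve_left h2

end MatrixSpaces

end SOData

/-! ### Transcendence degree bounded by the tangent space of a conjugacy class -/

namespace SOData

open Module

section Orbit

variable {k F : Type*} [Field k] [Field F] [Algebra k F]
variable {m X ι : Type*} [Fintype m] [Fintype X]

omit [Fintype X] in
theorem map_derivation_mul {l : Type*} (D : Derivation k F F) (A : Matrix l m F)
    (B : Matrix m X F) : (A * B).map D = A.map D * B + A * B.map D := by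
  ext i j
  simp only [Matrix.map_apply, Matrix.mul_apply, Matrix.add_apply, map_sum, Derivation.leibniz,
    smul_eq_mul, ← Finset.sum_add_distrib]
  exact Finset.sum_congr rfl fun _ _ => by ring

omit [Fintype m] in
theorem map_derivation_algebraMap {l : Type*} (D : Derivation k F F) (A : Matrix l m k) :
    (A.map (algebraMap k F)).map D = 0 := by
  ext i j
  simp

/-- The tangent space to a conjugacy class is orthogonal to the centralizer. -/
theorem card_add_finrank_le_of_normalForm [CharZero k] [DecidableEq m] [DecidableEq X]
    [Fintype ι] {J J₁ : Matrix m m k}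
    (hJ : J.transpose = -J) (hJJ : J * J₁ = 1) (N : Matrix X X k) {B : Matrix m m F}
    (hB : B ∈ selfAdj (J.map (algebraMap k F)))
    {g : Matrix m X F} {h : Matrix X m F} (hgh : g * h = 1)
    (hhg : h * g = 1)
    (hBg : B * g = g * N.map (algebraMap k F)) (T : ι → m × m)
    (hT : AlgebraicIndependent k fun i => B (T i).1 (T i).2) :
    Fintype.card ι +
      finrank F ↥(selfAdj (J.map (algebraMap k F)) ⊓ matrixCentralizer B) +
      (Fintype.card m + 1).choose 2 ≤ Fintype.card m * Fintype.card m := by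
  classical
  have : CharZero F := charZero_of_injective_algebraMap (algebraMap k F).injective
  set JF := J.map (algebraMap k F) with hJF
  have hJJF : JF * J₁.map (algebraMap k F) = 1 := by
    rw [hJF, ← Matrix.map_mul, hJJ, Matrix.map_one _ (map_zero _) (map_one _)]
  have hJFt : JF.transpose = -JF := by
    rw [hJF, ← Matrix.transpose_map, hJ]
    ext; simp
  choose D hD1 hD2 using exists_derivation_of_algebraicIndependent hT
  let M : ι → Matrix m m F := fun i => B.map (D i)
  let Z : ι → Matrix m m F := fun i => g.map (D i) * h
  -- Differentiate Bg = gN. The normal form N has entries in k, so its derivative is zero and the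
  -- derivative of B is a commutator with B.
  have hM : ∀ i, M i = Z i * B - B * Z i := by
    intro i
    have h1 := congrArg (fun A => A.map (D i)) hBg
    simp only [map_derivation_mul, map_derivation_algebraMap, Matrix.mul_zero, add_zero] at h1
    have h2 : h * B = N.map (algebraMap k F) * h := by
      rw [← Matrix.mul_one (h * B), ← hgh, ← Matrix.mul_assoc, Matrix.mul_assoc h B g, hBg,
        ← Matrix.mul_assoc h g, hhg, Matrix.one_mul]
    have h3 : M i = (B.map (D i) * g) * h := by rw [Matrix.mul_assoc, hgh, Matrix.mul_one]
    rw [h3, eq_sub_of_add_eq h1, Matrix.sub_mul, Matrix.mul_assoc (g.map (D i)), ← h2]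
    simp only [Z, Matrix.mul_assoc]
  have hMself : ∀ i, M i ∈ selfAdj JF := by
    intro i
    have h1 := congrArg (fun A => A.map (D i)) (mem_selfAdj.1 hB)
    simp only [map_derivation_mul, hJF, map_derivation_algebraMap, mul_zero, add_zero, zero_mul,
      zero_add] at h1
    rw [mem_selfAdj]
    exact h1
  have hli : LinearIndependent F M := by
    rw [Fintype.linearIndependent_iff]
    intro c hc j
    have h1 := congrFun (congrFun hc (T j).1) (T j).2
    rw [Matrix.sum_apply, Finset.sum_eq_single j] at h1
    · simpa [M, hD1] using h1
    · intro i _ hij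
      simp [M, hD2 i j (Ne.symm hij)]
    · simp
  let E := selfAdj JF ⊓ matrixCentralizer B
  have hdisj : E ⊓ skewAdj JF = ⊥ :=
    ((disjoint_selfAdj_skewAdj two_ne_zero hJJF).mono_left inf_le_left).eq_bot
  -- For the trace form, commutators with B are orthogonal to the centralizer of B, and self-adjoint
  -- matrices are orthogonal to skew-adjoint ones. The independent matrices M i thus lie in the
  -- complement of a direct sum of known dimension.
  have horth : Submodule.span F (Set.range M) ≤ (traceMulForm F m).orthogonal (E ⊔ skewAdj JF) := by
    rw [Submodule.span_le]
    rintro _ ⟨i, rfl⟩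
    rw [SetLike.mem_coe, LinearMap.BilinForm.mem_orthogonal_iff]
    intro Y hY
    obtain ⟨Y1, hY1, Y2, hY2, rfl⟩ := Submodule.mem_sup.1 hY
    change ((Y1 + Y2) * M i).trace = 0
    rw [add_mul, Matrix.trace_add, trace_mul_eq_zero_of_adj two_ne_zero hJJF (hMself i) hY2,
      add_zero, hM, mul_sub, Matrix.trace_sub, ← mul_assoc, ← mul_assoc,
      Matrix.trace_mul_comm (Y1 * Z i) B, ← mul_assoc, mem_matrixCentralizer.1 hY1.2, sub_self]
  have h1 := Submodule.finrank_mono horth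
  rw [LinearMap.BilinForm.finrank_orthogonal traceMulForm_nondegenerate,
    finrank_span_eq_card hli, Module.finrank_matrix, Module.finrank_self, mul_one] at h1
  have h2 := Submodule.finrank_sup_add_finrank_inf_eq E (skewAdj JF)
  rw [hdisj, finrank_bot, add_zero, finrank_skewAdj hJFt hJJF] at h2
  have h3 := Submodule.finrank_le (E ⊔ skewAdj JF)
  rw [Module.finrank_matrix, Module.finrank_self, mul_one] at h3
  change Fintype.card ι + finrank F E + _ ≤ _
  omega

end Orbit

end SOData

/-! ### The normal form in matrices -/

namespace SOData

open Module

section MatrixNormalForm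

/-- The index set of the basis of a normal form with hyperbolic pairs of chains of lengths `n`. -/
abbrev ChainIndex {ι : Type*} (n : ι → ℕ) : Type _ := Σ j, Fin (n j) × Bool

variable (k : Type*) [Field k] {ι : Type*} [DecidableEq ι] (n : ι → ℕ)

/-- The alternating form in a basis of hyperbolic pairs of chains. -/
def chainForm : Matrix (ChainIndex n) (ChainIndex n) k := fun x y =>
  if x.1 = y.1 ∧ x.2.2 ≠ y.2.2 ∧ x.2.1.1 + y.2.1.1 + 1 = n x.1 then pairSign k x.2.2 else 0

/-- The inverse of `chainForm`. -/
def chainFormInv : Matrix (ChainIndex n) (ChainIndex n) k := fun x y =>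
  if x = ⟨y.1, y.2.1.rev, !y.2.2⟩ then pairSign k y.2.2 else 0

variable {k}

/-- The operator acting on chains. -/
def chainMap (lam : ι → k) : Matrix (ChainIndex n) (ChainIndex n) k := fun x y =>
  (if x = y then lam y.1 else 0) +
    if x.1 = y.1 ∧ x.2.2 = y.2.2 ∧ x.2.1.1 = y.2.1.1 + 1 then 1 else 0

variable (k)

theorem chainForm_mul_chainFormInv [Fintype ι] : chainForm k n * chainFormInv k n = 1 := by
  ext x y
  rw [Matrix.mul_apply, Finset.sum_eq_single (⟨y.1, y.2.1.rev, !y.2.2⟩ : ChainIndex n)]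
  · obtain ⟨j, a, ε⟩ := x
    obtain ⟨j', b, ε'⟩ := y
    rw [chainFormInv, if_pos rfl, Matrix.one_apply, chainForm]
    by_cases h : j = j'
    · subst h
      have ha := a.2
      have hb := b.2
      have h1 : a.1 + b.rev.1 + 1 = n j ↔ a = b := by
        rw [Fin.val_rev, Fin.ext_iff]; omega
      have h2 : ε ≠ !ε' ↔ ε = ε' := by cases ε <;> cases ε' <;> simp
      simp only [h1, h2, true_and, Sigma.mk.injEq, heq_eq_eq, Prod.mk.injEq]
      by_cases h3 : a = b <;> by_cases h4 : ε = ε' <;> simp [h3, h4, pairSign_mul_self]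
    · have : (⟨j, a, ε⟩ : ChainIndex n) ≠ ⟨j', b, ε'⟩ := fun h' => h (congrArg Sigma.fst h')
      simp [h, this]
  · intro z _ hz
    rw [chainFormInv, if_neg hz, mul_zero]
  · simp

theorem chainFormInv_mul_chainForm [Fintype ι] : chainFormInv k n * chainForm k n = 1 :=
  mul_eq_one_comm.1 (chainForm_mul_chainFormInv k n)

variable {k}

theorem chainMap_mul_apply {Y : Type*} [Fintype ι] (lam : ι → k) (A : Matrix (ChainIndex n) Y k)
    (j : ι) (a : Fin (n j)) (ε : Bool) (y : Y) :
    (chainMap n lam * A) ⟨j, a, ε⟩ y = lam j * A ⟨j, a, ε⟩ y +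
      if 0 < a.1 then A ⟨j, ⟨a.1 - 1, by omega⟩, ε⟩ y else 0 := by
  simp only [Matrix.mul_apply, chainMap, add_mul, Finset.sum_add_distrib, ite_mul, zero_mul,
    one_mul, Finset.sum_ite_eq, Finset.mem_univ, if_true]
  congr 1
  split_ifs with h
  · rw [Finset.sum_eq_single (⟨j, ⟨a.1 - 1, by omega⟩, ε⟩ : ChainIndex n)]
    · rw [if_pos ⟨rfl, rfl, by dsimp only; omega⟩]
    · rintro ⟨j', b, ε'⟩ _ hne
      rw [if_neg]
      rintro ⟨h1, h2, h3⟩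
      dsimp only at h1 h2 h3
      subst h1 h2
      refine hne ?_
      congr 2
      exact Fin.ext (by dsimp only; omega)
    · simp
  · refine Finset.sum_eq_zero fun z _ => ?_
    rw [if_neg]
    rintro ⟨-, -, h3⟩
    omega

theorem mul_chainMap_apply {Y : Type*} [Fintype ι] (lam : ι → k) (A : Matrix Y (ChainIndex n) k)
    (j : ι) (a : Fin (n j)) (ε : Bool) (y : Y) :
    (A * chainMap n lam) y ⟨j, a, ε⟩ = A y ⟨j, a, ε⟩ * lam j +
      if h : a.1 + 1 < n j then A y ⟨j, ⟨a.1 + 1, h⟩, ε⟩ else 0 := by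
  simp only [Matrix.mul_apply, chainMap, mul_add, Finset.sum_add_distrib, mul_ite, mul_zero,
    mul_one, Finset.sum_ite_eq', Finset.mem_univ, if_true]
  congr 1
  split_ifs with h
  · rw [Finset.sum_eq_single (⟨j, ⟨a.1 + 1, h⟩, ε⟩ : ChainIndex n)]
    · rw [if_pos ⟨rfl, rfl, rfl⟩]
    · rintro ⟨j', b, ε'⟩ _ hne
      rw [if_neg]
      rintro ⟨h1, h2, h3⟩
      dsimp only at h1 h2 h3
      subst h1 h2
      refine hne ?_
      congr 2
      exact Fin.ext h3
    · simp
  · refine Finset.sum_eq_zero fun z _ => ?_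
    rw [if_neg]
    obtain ⟨j', b, ε'⟩ := z
    rintro ⟨h1, -, h3⟩
    dsimp only at h1 h3
    subst h1
    have := b.2
    omega

end MatrixNormalForm

section Existence

variable {k L : Type*} [Field k] [Field L] [Algebra k L] {m : Type*} [Fintype m] [DecidableEq m]

/-- The annihilating polynomial already splits over k, so the eigenvalues lie in k and only the
change of basis g needs the larger field L. Having the normal form over k is what allows it to be
treated as constant under derivations. -/
theorem exists_matrix_normalForm [CharZero k] {J J₁ : Matrix m m k}
    (hJ : J.transpose = -J) (hJJ : J * J₁ = 1) {B : Matrix m m L}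
    (hB : B ∈ selfAdj (J.map (algebraMap k L))) {p : Polynomial k} (hp0 : p ≠ 0) (hp : p.Splits)
    (hpB : Polynomial.aeval B p = 0) :
    ∃ (ι : Type) (_ : Fintype ι) (_ : DecidableEq ι) (n : ι → ℕ) (lam : ι → k)
      (g : Matrix m (ChainIndex n) L) (h : Matrix (ChainIndex n) m L),
      g * h = 1 ∧ h * g = 1 ∧
      g.transpose * J.map (algebraMap k L) * g = (chainForm k n).map (algebraMap k L) ∧
      B * g = g * (chainMap n lam).map (algebraMap k L) := by
  classical
  have : CharZero L := charZero_of_injective_algebraMap (algebraMap k L).injective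
  set JL := J.map (algebraMap k L) with hJL
  have hJJL : JL * J₁.map (algebraMap k L) = 1 := by
    rw [hJL, ← Matrix.map_mul, hJJ, Matrix.map_one _ (map_zero _) (map_one _)]
  have hJLt : JL.transpose = -JL := by
    rw [hJL, ← Matrix.transpose_map, hJ]
    ext; simp
  let ω : LinearMap.BilinForm L (m → L) := Matrix.toBilin' JL
  have hωap : ∀ v w, ω v w = v ⬝ᵥ JL.mulVec w := Matrix.toBilin'_apply' JL
  have hskew : ∀ v w, ω v w = -ω w v := fun v w => by
    rw [hωap, hωap, Matrix.dotProduct_mulVec, dotProduct_comm, ← Matrix.mulVec_transpose, hJLt,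
      Matrix.neg_mulVec, dotProduct_neg]
  have hω : ω.IsAlt := fun v => by
    have h1 := hskew v v
    have h3 : (2 : L) * ω v v = 0 := by linear_combination h1
    exact (mul_eq_zero.1 h3).resolve_left two_ne_zero
  have hnd : ω.Nondegenerate := by
    refine LinearMap.BilinForm.nondegenerate_toBilin'_iff_det_ne_zero.2 ?_
    exact (Matrix.isUnit_iff_isUnit_det _).1 (IsUnit.of_mul_eq_one _ hJJL) |>.ne_zero
  have hB' : ∀ x y, ω (Matrix.toLinAlgEquiv' B x) y = ω x (Matrix.toLinAlgEquiv' B y) := by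
    intro x y
    rw [hωap, hωap, Matrix.toLinAlgEquiv'_apply, Matrix.toLinAlgEquiv'_apply,
      Matrix.mulVec_mulVec, ← mem_selfAdj.1 hB, ← Matrix.mulVec_mulVec,
      Matrix.dotProduct_mulVec x, Matrix.vecMul_transpose]
  have hpB' : Polynomial.aeval (Matrix.toLinAlgEquiv' B) (p.map (algebraMap k L)) = 0 := by
    rw [Polynomial.aeval_map_algebraMap]
    have := congrArg (Matrix.toLinAlgEquiv' (R := L) (n := m)) hpB
    rw [map_zero] at this
    rw [← this]
    exact Polynomial.aeval_algHom_apply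
      ((Matrix.toLinAlgEquiv' (R := L) (n := m)).toAlgHom.restrictScalars k) B p
  obtain ⟨ι, _, n, lam', v, hch, hroot, hspan⟩ := exists_isHyperbolicChains two_ne_zero hω hnd hB'
    (Polynomial.map_ne_zero hp0) (hp.map _) hpB'
  have hlam : ∀ j, ∃ a : k, algebraMap k L a = lam' j := fun j =>
    hp.mem_range_of_isRoot hp0 (hroot j)
  choose lam hlam using hlam
  let T : End L (m → L) := Matrix.toLinAlgEquiv' B
  let e : ChainIndex n → m → L := fun x =>
    ((T - algebraMap L (End L (m → L)) (lam' x.1)) ^ x.2.1.1) (v x.1 x.2.2)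
  let g : Matrix m (ChainIndex n) L := Matrix.of fun p x => e x p
  have hgJ : g.transpose * JL * g = (chainForm k n).map (algebraMap k L) := by
    ext x y
    have h1 : (g.transpose * JL * g) x y = ω (e x) (e y) := by
      rw [hωap, Matrix.mul_assoc, Matrix.mul_apply, dotProduct]
      refine Finset.sum_congr rfl fun p _ => ?_
      congr 1
    rw [h1, Matrix.map_apply, chainForm]
    obtain ⟨j, a, ε⟩ := x
    obtain ⟨j', b, ε'⟩ := y
    by_cases h : j = j'
    · subst h
      refine (hch.form_self j a b ε ε' a.2 b.2).trans ?_
      simp only [true_and]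
      split_ifs
      · simp only [pairSign]; split_ifs <;> simp
      · simp
    · refine (hch.form_ne j j' a b ε ε' h).trans ?_
      simp [h]
  let h := (chainFormInv k n).map (algebraMap k L) * g.transpose * JL
  have hhg : h * g = 1 := by
    simp only [h]
    rw [Matrix.mul_assoc, Matrix.mul_assoc, ← Matrix.mul_assoc g.transpose, hgJ, ← Matrix.map_mul,
      chainFormInv_mul_chainForm, Matrix.map_one _ (map_zero _) (map_one _)]
  refine ⟨ι, inferInstance, inferInstance, n, lam, g, h, ?_, hhg, hgJ, ?_⟩
  · refine Matrix.toLin'.injective (LinearMap.ext fun y => ?_)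
    have hy : y ∈ LinearMap.range g.mulVecLin := by
      rw [Matrix.range_mulVecLin]
      have : y ∈ Submodule.span L (Set.range e) := by
        have h1 : Submodule.span L (Set.range e) = ⊤ := hspan
        rw [h1]; trivial
      exact this
    obtain ⟨c, rfl⟩ := hy
    simp only [Matrix.toLin'_apply, Matrix.mulVecLin_apply, Matrix.one_mulVec]
    rw [Matrix.mulVec_mulVec, Matrix.mul_assoc, hhg, Matrix.mul_one]
  · have hN : (chainMap n lam).map (algebraMap k L) = chainMap n lam' := by
      ext x y
      simp only [Matrix.map_apply, chainMap, map_add, apply_ite (algebraMap k L), map_zero,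
        map_one, hlam]
    rw [hN]
    ext p ⟨j, a, ε⟩
    rw [mul_chainMap_apply]
    have h1 : (B * g) p ⟨j, a, ε⟩ = T (e ⟨j, a, ε⟩) p := rfl
    have h3 : T (e ⟨j, a, ε⟩) = lam' j • e ⟨j, a, ε⟩ +
        ((T - algebraMap L (End L (m → L)) (lam' j)) ^ (a.1 + 1)) (v j ε) := by
      rw [pow_succ', Module.End.mul_apply]
      simp [e, Module.algebraMap_end_apply]
    rw [h1, h3, Pi.add_apply, Pi.smul_apply, smul_eq_mul, mul_comm]
    congr 1
    split_ifs with h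
    · rfl
    · obtain hh : a.1 + 1 = n j := by have := a.2; omega
      rw [hh, hch.pow_apply]; rfl

end Existence

end SOData

/-! ### The moment map equation on pairs of chains, and linear equations for B₂ -/

namespace SOData

open Module

/-- Both halves are the sum of c over the antidiagonal s - 1, and both are zero when s = 0. -/
theorem sum_antidiagonal_telescope {K : Type*} [AddCommGroup K] (c : ℕ → ℕ → K) (s : ℕ) :
    ∑ p ∈ Finset.HasAntidiagonal.antidiagonal s, ((if 0 < p.2 then c p.1 (p.2 - 1) else 0) -
      (if 0 < p.1 then c (p.1 - 1) p.2 else 0)) = 0 := by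
  cases s with
  | zero => simp
  | succ s =>
    rw [Finset.sum_sub_distrib, Finset.Nat.sum_antidiagonal_succ', Finset.Nat.sum_antidiagonal_succ]
    simp

section Blocks

variable {k K : Type*} [Field k] [Field K] [Algebra k K] {ι w : Type*} [Fintype ι] [DecidableEq ι]
  [Fintype w] {n : ι → ℕ}

/-- The rows of a chain as a vector of power series. -/
noncomputable def chainSeries (I : Matrix (ChainIndex n) w K) (j : ι) (ε : Bool) (i : w) :
    PowerSeries K :=
  PowerSeries.mk fun a => if h : a < n j then I ⟨j, ⟨a, h⟩, ε⟩ i else 0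

/-- On the block of two chains with the same eigenvalue, the scalar parts of the commutator cancel.
The entry of IIᵀ at (a, b) is then a difference of shifted entries of C. The coefficient of X^s sums
these along a + b = s, where they telescope; s < n j keeps both indices inside the chains. -/
theorem X_pow_dvd_sum_chainSeries {lam : ι → K} {C : Matrix (ChainIndex n) (ChainIndex n) K}
    {I : Matrix (ChainIndex n) w K}
    (h : chainMap n lam * C - C * (chainMap n lam).transpose + I * I.transpose = 0) (j : ι)
    (ε ε' : Bool) :
    PowerSeries.X ^ n j ∣ ∑ i, chainSeries I j ε i * chainSeries I j ε' i := by
  rw [PowerSeries.X_pow_dvd_iff]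
  intro s hs
  let c : ℕ → ℕ → K := fun a b =>
    if h : a < n j ∧ b < n j then C ⟨j, ⟨a, h.1⟩, ε⟩ ⟨j, ⟨b, h.2⟩, ε'⟩ else 0
  rw [map_sum, ← sum_antidiagonal_telescope c s]
  simp only [PowerSeries.coeff_mul]
  rw [Finset.sum_comm]
  refine Finset.sum_congr rfl fun p hp => ?_
  obtain ⟨a, b⟩ := p
  rw [Finset.HasAntidiagonal.mem_antidiagonal] at hp
  dsimp only at hp ⊢
  have ha : a < n j := by omega
  have hb : b < n j := by omega
  have h1 := congrFun (congrFun h ⟨j, ⟨a, ha⟩, ε⟩) ⟨j, ⟨b, hb⟩, ε'⟩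
  have h2 : (C * (chainMap n lam).transpose) ⟨j, ⟨a, ha⟩, ε⟩ ⟨j, ⟨b, hb⟩, ε'⟩ =
      (chainMap n lam * C.transpose) ⟨j, ⟨b, hb⟩, ε'⟩ ⟨j, ⟨a, ha⟩, ε⟩ := by
    rw [← Matrix.transpose_apply (chainMap n lam * C.transpose), Matrix.transpose_mul,
      Matrix.transpose_transpose]
  rw [Matrix.add_apply, Matrix.sub_apply, chainMap_mul_apply, h2, chainMap_mul_apply,
    Matrix.mul_apply, Matrix.zero_apply] at h1
  simp only [Matrix.transpose_apply] at h1
  have h3 : ∑ i, PowerSeries.coeff a (chainSeries I j ε i) *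
      PowerSeries.coeff b (chainSeries I j ε' i) =
      ∑ i, I ⟨j, ⟨a, ha⟩, ε⟩ i * I ⟨j, ⟨b, hb⟩, ε'⟩ i :=
    Finset.sum_congr rfl fun i _ => by
      rw [chainSeries, chainSeries, PowerSeries.coeff_mk, PowerSeries.coeff_mk, dif_pos ha,
        dif_pos hb]
  have h4 : (if 0 < b then c a (b - 1) else 0) =
      if 0 < b then C ⟨j, ⟨a, ha⟩, ε⟩ ⟨j, ⟨b - 1, by omega⟩, ε'⟩ else 0 := by
    split_ifs
    · exact dif_pos ⟨ha, by omega⟩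
    · rfl
  have h5 : (if 0 < a then c (a - 1) b else 0) =
      if 0 < a then C ⟨j, ⟨a - 1, by omega⟩, ε⟩ ⟨j, ⟨b, hb⟩, ε'⟩ else 0 := by
    split_ifs
    · exact dif_pos ⟨by omega, hb⟩
    · rfl
  rw [h3, h4, h5]
  linear_combination h1

/-- Only the equations inside each hyperbolic pair of chains are used, and the pairs are added one
at a time. Each costs at most n j (2N - 3) parameters, whatever the other pairs are. -/
theorem trRank_union_chain_entries_le [CharZero k] (hw : 4 ≤ Fintype.card w) (S : Set K)
    {lam : ι → K} {C : Matrix (ChainIndex n) (ChainIndex n) K}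
    {I : Matrix (ChainIndex n) w K}
    (h : chainMap n lam * C - C * (chainMap n lam).transpose + I * I.transpose = 0) :
    trRank k (S ∪ Set.range fun p : ChainIndex n × w => I p.1 p.2) ≤
      trRank k S + ((∑ j, n j) * (2 * Fintype.card w - 3) : ℕ) := by
  classical
  let U : Finset ι → Set K := fun s => S ∪ ⋃ j ∈ s, (entries (n j) (chainSeries I j false) ∪
    entries (n j) (chainSeries I j true))
  have key : ∀ s : Finset ι, trRank k (U s) ≤
      trRank k S + ((∑ j ∈ s, n j) * (2 * Fintype.card w - 3) : ℕ) := by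
    intro s
    induction s using Finset.induction_on with
    | empty => simp [U]
    | insert j s hj ih =>
      have h1 : U (insert j s) = U s ∪ entries (n j) (chainSeries I j false) ∪
          entries (n j) (chainSeries I j true) := by
        simp only [U, Finset.set_biUnion_insert]
        ext x
        simp only [Set.mem_union]
        tauto
      rw [h1, Finset.sum_insert hj, add_mul, add_comm (n j * _)]
      refine (trRank_union_jets_le hw _ _ _ _ (X_pow_dvd_sum_chainSeries h j false false)
        (X_pow_dvd_sum_chainSeries h j false true)
        (X_pow_dvd_sum_chainSeries h j true true)).trans ?_
      push_cast at ih ⊢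
      rw [← add_assoc]
      gcongr
  refine (trRank_mono ?_).trans (key Finset.univ)
  refine Set.union_subset_union_right S ?_
  rintro _ ⟨⟨⟨j, a, ε⟩, i⟩, rfl⟩
  have h1 : I ⟨j, a, ε⟩ i ∈ entries (n j) (chainSeries I j ε) :=
    ⟨a.1, a.2, i, by rw [chainSeries, PowerSeries.coeff_mk, dif_pos a.2]⟩
  refine Set.mem_biUnion (Finset.mem_coe.2 (Finset.mem_univ j)) ?_
  cases ε
  · exact Or.inl h1
  · exact Or.inr h1

end Blocks

section Bound

variable {k K : Type*} [Field k] [Field K] [Algebra k K] {m w : Type*} [Fintype m] [DecidableEq m]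
  [Fintype w]

/-- The set of entries of a matrix. -/
def matrixEntries {p q R : Type*} (A : Matrix p q R) : Set R := Set.range fun x : p × q => A x.1 x.2

omit [Fintype m] [DecidableEq m] [Fintype w] in
theorem exists_lift_matrix {L : IntermediateField k K} {A : Matrix m w K}
    (h : matrixEntries A ⊆ L) : ∃ A' : Matrix m w L, A'.map (algebraMap L K) = A :=
  ⟨fun i j => ⟨A i j, h ⟨(i, j), rfl⟩⟩, rfl⟩

/-- The entries of the second matrix satisfy the linear equations coming from the moment map. -/
theorem trRank_union_matrixEntries_le {J : Matrix m m k} (S : Set K)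
    {B : Matrix m m (algCl k S)} {B₂ : Matrix m m K}
    (hB₂ : B₂ ∈ selfAdj (J.map (algebraMap k K)))
    (hcomm : matrixEntries (B.map (algebraMap _ K) * B₂ - B₂ * B.map (algebraMap _ K)) ⊆
      algCl k S) :
    trRank k (S ∪ matrixEntries B₂) ≤ trRank k S + finrank (algCl k S)
      ↥(selfAdj (J.map (algebraMap k (algCl k S))) ⊓ matrixCentralizer B) := by
  let c : Matrix m m (algCl k S) ≃ₗ[algCl k S] (m × m → algCl k S) :=
    (LinearEquiv.curry (algCl k S) (algCl k S) m m).symm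
  let E := selfAdj (J.map (algebraMap k (algCl k S))) ⊓ matrixCentralizer B
  have hE : finrank (algCl k S) (E.map c.toLinearMap) = finrank (algCl k S) E :=
    LinearEquiv.finrank_eq (c.submoduleMap E).symm
  rw [← hE]
  refine trRank_union_range_le_finrank S (fun x : m × m => B₂ x.1 x.2) _ fun Y hY => ?_
  refine ⟨Matrix.of fun i j => Y (i, j), ⟨?_, ?_⟩, rfl⟩
  · rw [SetLike.mem_coe, mem_selfAdj]
    refine Matrix.ext fun p q => ?_
    -- The linear form giving the (p, q) entry of YᵀJ - JY.
    let v : m × m → algCl k S := fun x =>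
      (if x.2 = p then algebraMap k _ (J x.1 q) else 0) -
        (if x.2 = q then algebraMap k _ (J p x.1) else 0)
    have h1 := hY v (by
      have h2 := congrFun (congrFun (mem_selfAdj.1 hB₂) p) q
      simp only [Matrix.mul_apply, Matrix.transpose_apply, Matrix.map_apply] at h2
      have h3 : ∑ x : m × m, (v x : K) * B₂ x.1 x.2 = 0 := by
        rw [Fintype.sum_prod_type, ← sub_eq_zero.2 h2]
        simp only [v, AddSubgroupClass.coe_sub, apply_ite (fun z : algCl k S => (z : K)),
          ZeroMemClass.coe_zero, sub_mul, ite_mul, zero_mul, Finset.sum_sub_distrib,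
          Finset.sum_ite_eq', Finset.mem_univ, if_true]
        congr 1
        exact Finset.sum_congr rfl fun _ _ => mul_comm _ _
      rw [h3]
      exact zero_mem _)
    rw [Fintype.sum_prod_type] at h1
    simp only [v, sub_mul, ite_mul, zero_mul, Finset.sum_sub_distrib,
          Finset.sum_ite_eq', Finset.mem_univ, if_true] at h1
    simp only [Matrix.mul_apply, Matrix.transpose_apply, Matrix.map_apply, Matrix.of_apply]
    refine sub_eq_zero.1 (Eq.trans ?_ h1)
    congr 1
    exact Finset.sum_congr rfl fun _ _ => mul_comm _ _
  · rw [SetLike.mem_coe, mem_matrixCentralizer]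
    refine Matrix.ext fun p q => ?_
    -- The linear form giving the (p, q) entry of BY - YB; by `hcomm` its value at B₂ lies in the
    -- field.
    let v : m × m → algCl k S := fun x =>
      (if x.2 = q then B p x.1 else 0) - (if x.1 = p then B x.2 q else 0)
    have h1 := hY v (by
      have h2 := hcomm ⟨(p, q), rfl⟩
      simp only [Matrix.mul_apply, Matrix.sub_apply, Matrix.map_apply] at h2
      have h3 : ∑ x : m × m, (v x : K) * B₂ x.1 x.2 =
          ∑ j, algebraMap (algCl k S) K (B p j) * B₂ j q -
          ∑ j, B₂ p j * algebraMap (algCl k S) K (B j q) := by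
        simp only [v, AddSubgroupClass.coe_sub, apply_ite (fun z : algCl k S => (z : K)),
          ZeroMemClass.coe_zero, sub_mul, ite_mul, zero_mul, Finset.sum_sub_distrib]
        congr 1
        · rw [Fintype.sum_prod_type]
          simp only [Finset.sum_ite_eq', Finset.mem_univ, if_true]
          rfl
        · rw [Fintype.sum_prod_type_right]
          simp only [Finset.sum_ite_eq', Finset.mem_univ, if_true]
          exact Finset.sum_congr rfl fun _ _ => mul_comm _ _
      rw [h3]
      exact h2)
    simp only [v, sub_mul, ite_mul, zero_mul, Finset.sum_sub_distrib] at h1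
    rw [Fintype.sum_prod_type, Fintype.sum_prod_type_right] at h1
    simp only [Finset.sum_ite_eq', Finset.mem_univ, if_true] at h1
    simp only [Matrix.mul_apply, Matrix.of_apply]
    refine sub_eq_zero.1 (Eq.trans ?_ h1)
    congr 1
    exact Finset.sum_congr rfl fun _ _ => mul_comm _ _

end Bound

end SOData

/-! ### Parameter count for a point of the zero fibre -/

namespace SOData

open Module

section Bound

variable {k K : Type*} [Field k] [Field K] [Algebra k K] {m w : Type*} [Fintype m] [DecidableEq m]
  [Fintype w]

theorem map_algebraMap_tower {p q : Type*} (L : IntermediateField k K) (A : Matrix p q k) :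
    (A.map (algebraMap k L)).map (algebraMap L K) = A.map (algebraMap k K) := rfl

theorem matrix_map_injective {p q : Type*} (L : IntermediateField k K) :
    Function.Injective fun A : Matrix p q L => A.map (algebraMap L K) := fun _ _ h =>
  Matrix.map_injective (algebraMap L K).injective h

theorem mem_selfAdj_of_map {J : Matrix m m k} {L : IntermediateField k K} {B : Matrix m m L}
    (h : B.map (algebraMap L K) ∈ selfAdj (J.map (algebraMap k K))) :
    B ∈ selfAdj (J.map (algebraMap k L)) := by
  rw [mem_selfAdj] at h ⊢
  refine matrix_map_injective L ?_
  simp only [Matrix.map_mul, map_algebraMap_tower, Matrix.transpose_map]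
  exact h

theorem mul_mem_of_matrixEntries {p q r : Type*} [Fintype q] {L : IntermediateField k K}
    {A : Matrix p q K} {B : Matrix q r K} (hA : matrixEntries A ⊆ L) (hB : matrixEntries B ⊆ L) :
    matrixEntries (A * B) ⊆ L := by
  rintro _ ⟨⟨i, j⟩, rfl⟩
  exact sum_mem fun l _ => mul_mem (hA ⟨(i, l), rfl⟩) (hB ⟨(l, j), rfl⟩)

/-- The equation of the moment map in a basis of chains. -/
theorem chainMap_equation {ι : Type*} [Fintype ι] [DecidableEq ι] {n : ι → ℕ} {lam : ι → K}
    {J B₁ B₂ : Matrix m m K} {I : Matrix m w K} (hB₁ : B₁ ∈ selfAdj J)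
    (heq : B₁ * B₂ - B₂ * B₁ + I * I.transpose * J = 0)
    {g : Matrix m (ChainIndex n) K} {h : Matrix (ChainIndex n) m K} (hgh : g * h = 1)
    (hhg : h * g = 1) (hgJ : g.transpose * J * g = chainForm K n)
    (hBg : B₁ * g = g * chainMap n lam) :
    chainMap n lam * (h * B₂ * g * chainFormInv K n) -
      (h * B₂ * g * chainFormInv K n) * (chainMap n lam).transpose +
      (h * I) * (h * I).transpose = 0 := by
  set N := chainMap n lam
  set J' := chainForm K n with hJ'
  set P := chainFormInv K n with hP
  have hJP : J' * P = 1 := chainForm_mul_chainFormInv K n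
  have hPJ : P * J' = 1 := chainFormInv_mul_chainForm K n
  have hNJ : N.transpose * J' = J' * N := by
    calc N.transpose * J' = (g * N).transpose * J * g := by
          rw [← hgJ, Matrix.transpose_mul]; simp only [Matrix.mul_assoc]
      _ = g.transpose * (B₁.transpose * J) * g := by
          rw [← hBg, Matrix.transpose_mul]; simp only [Matrix.mul_assoc]
      _ = J' * N := by
          rw [mem_selfAdj.1 hB₁, ← hgJ]; simp only [Matrix.mul_assoc]; rw [hBg]
  -- Self-adjointness of N, rewritten with the inverse P of the form. It turns right multiplication
  -- by B₁ into right multiplication by Nᵀ once P has been attached to B₂.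
  have hPN : P * N.transpose = N * P := by
    calc P * N.transpose = P * (N.transpose * J') * P := by
          rw [Matrix.mul_assoc P, Matrix.mul_assoc _ J', hJP, Matrix.mul_one]
      _ = N * P := by rw [hNJ, ← Matrix.mul_assoc, hPJ, Matrix.one_mul]
  have hhB : h * B₁ = N * h := by
    rw [← Matrix.mul_one (h * B₁), ← hgh, ← Matrix.mul_assoc, Matrix.mul_assoc h B₁ g, hBg,
      ← Matrix.mul_assoc h g, hhg, Matrix.one_mul]
  have e1 : N * (h * B₂ * g * P) = h * (B₁ * B₂) * g * P := by
    simp only [← Matrix.mul_assoc]; rw [hhB]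
  have e2 : (h * B₂ * g * P) * N.transpose = h * (B₂ * B₁) * g * P := by
    rw [Matrix.mul_assoc _ P, hPN]
    simp only [Matrix.mul_assoc]
    rw [← Matrix.mul_assoc B₁ g, hBg, Matrix.mul_assoc g]
  have e3 : (h * I) * (h * I).transpose = h * (I * I.transpose * J) * g * P := by
    -- The inverse of g is its adjoint for the two forms, so IIᵀJ becomes (hI)(hI)ᵀ in the chain
    -- basis.
    have h1 : h.transpose = J * g * P := by
      calc h.transpose = h.transpose * (J' * P) := by rw [hJP, Matrix.mul_one]
        _ = (g * h).transpose * J * g * P := by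
            rw [← hgJ, Matrix.transpose_mul]; simp only [Matrix.mul_assoc]
        _ = J * g * P := by rw [hgh, Matrix.transpose_one, Matrix.one_mul]
    rw [Matrix.transpose_mul, h1]
    simp only [Matrix.mul_assoc]
  rw [e1, e2, e3, ← Matrix.sub_mul, ← Matrix.sub_mul, ← Matrix.mul_sub, ← Matrix.add_mul,
    ← Matrix.add_mul, ← Matrix.mul_add, heq, Matrix.mul_zero, Matrix.zero_mul, Matrix.zero_mul]

/-- Passing to chain coordinates costs no parameters: I = g(hI), and the entries of g are algebraic
over S. -/
theorem trRank_union_matrixEntries_vector_le [CharZero k] {ι : Type*} [Fintype ι] [DecidableEq ι]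
    {n : ι → ℕ} {lam : ι → k} (hw : 4 ≤ Fintype.card w) (S : Set K)
    {J : Matrix m m k} {B₁ B₂ : Matrix m m K} {I : Matrix m w K}
    (hB₁ : B₁ ∈ selfAdj (J.map (algebraMap k K)))
    (heq : B₁ * B₂ - B₂ * B₁ + I * I.transpose * J.map (algebraMap k K) = 0)
    {g : Matrix m (ChainIndex n) K} {h : Matrix (ChainIndex n) m K} (hgh : g * h = 1)
    (hhg : h * g = 1)
    (hgJ : g.transpose * J.map (algebraMap k K) * g = (chainForm k n).map (algebraMap k K))
    (hBg : B₁ * g = g * (chainMap n lam).map (algebraMap k K))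
    (hg : matrixEntries g ⊆ algCl k S) :
    trRank k (S ∪ matrixEntries I) ≤
      trRank k S + ((∑ j, n j) * (2 * Fintype.card w - 3) : ℕ) := by
  have hform : (chainForm k n).map (algebraMap k K) = chainForm K n := by
    ext x y
    simp only [Matrix.map_apply, chainForm, pairSign, apply_ite (algebraMap k K), map_zero,
      map_one, map_neg]
  have hmap : (chainMap n lam).map (algebraMap k K) = chainMap n fun j => algebraMap k K (lam j) := by
    ext x y
    simp only [Matrix.map_apply, chainMap, map_add, apply_ite (algebraMap k K), map_zero,
      map_one]
  have h1 := trRank_union_chain_entries_le (k := k) hw S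
    (chainMap_equation hB₁ heq hgh hhg (hgJ.trans hform) (hmap ▸ hBg))
  refine le_trans (trRank_mono_algCl ?_) h1
  refine Set.union_subset (Set.subset_union_left.trans (subset_algCl _)) ?_
  have h2 : I = g * (h * I) := by rw [← Matrix.mul_assoc, hgh, Matrix.one_mul]
  conv_lhs => rw [h2]
  exact mul_mem_of_matrixEntries (hg.trans (algCl_mono Set.subset_union_left))
    (Set.subset_union_right.trans (subset_algCl _))

/-- The transcendence degree of a self-adjoint matrix is at most the dimension of its
conjugacy class. -/
theorem trRank_matrixEntries_add_finrank_le [CharZero k] {X : Type*} [Fintype X] [DecidableEq X]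
    {J J₁ : Matrix m m k} (hJ : J.transpose = -J) (hJJ : J * J₁ = 1) (N : Matrix X X k)
    (L : IntermediateField k K) {b : Matrix m m L} (hb : b ∈ selfAdj (J.map (algebraMap k L)))
    {g : Matrix m X L} {h : Matrix X m L} (hgh : g * h = 1) (hhg : h * g = 1)
    (hbg : b * g = g * N.map (algebraMap k L)) :
    ∃ r : ℕ, trRank k (matrixEntries (b.map (algebraMap L K))) = r ∧
      r + finrank L ↥(selfAdj (J.map (algebraMap k L)) ⊓ matrixCentralizer b) +
        (Fintype.card m + 1).choose 2 ≤ Fintype.card m * Fintype.card m := by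
  classical
  set S₁ := matrixEntries (b.map (algebraMap L K))
  obtain ⟨I₀, hI₀⟩ := (AlgebraicIndependent.matroid k K).exists_isBasis' S₁
  have hfin : S₁.Finite := Set.finite_range _
  have : Fintype I₀ := (hfin.subset hI₀.subset).fintype
  have hT : ∀ x : I₀, ∃ t : m × m, algebraMap L K (b t.1 t.2) = x := fun x => hI₀.subset x.2
  choose T hT using hT
  have hind : AlgebraicIndependent k fun x => b (T x).1 (T x).2 := by
    have h1 : AlgebraicIndependent k ((↑) : I₀ → K) := by
      have := hI₀.indep
      rwa [AlgebraicIndependent.matroid_indep_iff] at this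
    have h2 : ((↑) : I₀ → K) = L.val ∘ fun x => b (T x).1 (T x).2 := by
      ext x
      rw [← hT x]
      rfl
    rw [h2] at h1
    exact h1.of_comp
  refine ⟨Fintype.card I₀, ?_, card_add_finrank_le_of_normalForm hJ hJJ N hb hgh hhg hbg T hind⟩
  rw [trRank, ← hI₀.encard_eq_eRk, Set.encard_eq_coe_toFinset_card, Set.toFinset_card]

theorem map_inclusion_map {p q : Type*} {L L' : IntermediateField k K} (hle : L ≤ L')
    (A : Matrix p q L) :
    (A.map (IntermediateField.inclusion hle)).map (algebraMap L' K) = A.map (algebraMap L K) := rfl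

theorem map_map_inclusion {p q : Type*} {L L' : IntermediateField k K} (hle : L ≤ L')
    (A : Matrix p q k) :
    (A.map (algebraMap k L)).map (IntermediateField.inclusion hle) = A.map (algebraMap k L') :=
  Matrix.ext fun _ _ => (IntermediateField.inclusion hle).commutes _

theorem aeval_lift_matrix {L : IntermediateField k K} {b : Matrix m m L} {p : Polynomial k}
    (hp : Polynomial.aeval (b.map (algebraMap L K)) p = 0) : Polynomial.aeval b p = 0 := by
  refine matrix_map_injective L ?_
  have h1 := Polynomial.aeval_algHom_apply
    (AlgHom.mapMatrix (m := m) (IsScalarTower.toAlgHom k L K)) b p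
  have h2 : AlgHom.mapMatrix (m := m) (IsScalarTower.toAlgHom k L K) b =
    b.map (algebraMap L K) := rfl
  rw [h2, hp] at h1
  dsimp only
  rw [Matrix.map_zero _ (map_zero _)]
  exact h1.symm

/-- The bound for the transcendence degree of a point of the zero fibre of the moment map, over
a field which contains the eigenvalues of the first matrix. -/
theorem trRank_datum_le [CharZero k] (hw : 4 ≤ Fintype.card w) {J J₁ : Matrix m m k}
    (hJ : J.transpose = -J) (hJJ : J * J₁ = 1) {B₁ B₂ : Matrix m m K} {I : Matrix m w K}
    (hB₁ : B₁ ∈ selfAdj (J.map (algebraMap k K))) (hB₂ : B₂ ∈ selfAdj (J.map (algebraMap k K)))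
    (heq : B₁ * B₂ - B₂ * B₁ + I * I.transpose * J.map (algebraMap k K) = 0)
    {p : Polynomial k} (hp0 : p ≠ 0) (hp : p.Splits) (hpB : Polynomial.aeval B₁ p = 0) :
    trRank k (matrixEntries B₁ ∪ matrixEntries I ∪ matrixEntries B₂) +
      ((Fintype.card m + 1).choose 2 : ℕ) ≤
      (Fintype.card m * Fintype.card m + Fintype.card m / 2 * (2 * Fintype.card w - 3) : ℕ) := by
  classical
  set S₁ := matrixEntries B₁
  set S₂ := S₁ ∪ matrixEntries I
  obtain ⟨b₁, hb₁⟩ := exists_lift_matrix (L := algCl k S₁) (subset_algCl S₁)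
  have hb₁s : b₁ ∈ selfAdj (J.map (algebraMap k (algCl k S₁))) :=
    mem_selfAdj_of_map (hb₁ ▸ hB₁)
  have hpb : Polynomial.aeval b₁ p = 0 := aeval_lift_matrix (hb₁ ▸ hpB)
  -- The normal form is taken over the algebraic closure of the field generated by the entries of
  -- B₁, so that the base change is algebraic over those entries.
  obtain ⟨ι, _, _, n, lam, g, h, hgh, hhg, hgJ, hbg⟩ :=
    exists_matrix_normalForm hJ hJJ hb₁s hp0 hp hpb
  have hcard : 2 * ∑ j, n j = Fintype.card m := by
    have h1 : Fintype.card (ChainIndex n) = Fintype.card m :=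
      (Matrix.square_of_invertible _ _ hgh hhg).symm
    rw [← h1, Fintype.card_sigma, Finset.mul_sum]
    exact Finset.sum_congr rfl fun j _ => by simp [mul_comm]
  have hcard' : Fintype.card m / 2 = ∑ j, n j := by omega
  rw [hcard']
  have e1 := trRank_union_matrixEntries_vector_le hw S₁ hB₁ heq
    (g := g.map (algebraMap (algCl k S₁) K)) (h := h.map (algebraMap (algCl k S₁) K)) (lam := lam)
    (by rw [← Matrix.map_mul, hgh, Matrix.map_one _ (map_zero _) (map_one _)])
    (by rw [← Matrix.map_mul, hhg, Matrix.map_one _ (map_zero _) (map_one _)])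
    (by
      have := congrArg (fun A => A.map (algebraMap (algCl k S₁) K)) hgJ
      simp only [Matrix.map_mul, map_algebraMap_tower, Matrix.transpose_map] at this
      exact this)
    (by
      have := congrArg (fun A => A.map (algebraMap (algCl k S₁) K)) hbg
      simp only [Matrix.map_mul, map_algebraMap_tower, hb₁] at this
      exact this)
    (by
      rintro _ ⟨⟨i, j⟩, rfl⟩
      exact (g i j).2)
  obtain ⟨b₂, hb₂⟩ := exists_lift_matrix (L := algCl k S₂)
    (Set.subset_union_left.trans (subset_algCl S₂) : matrixEntries B₁ ⊆ _)
  have e2 : trRank k (S₂ ∪ matrixEntries B₂) ≤ trRank k S₂ + finrank (algCl k S₂)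
      ↥(selfAdj (J.map (algebraMap k (algCl k S₂))) ⊓ matrixCentralizer b₂) := by
    refine trRank_union_matrixEntries_le S₂ hB₂ ?_
    rw [hb₂, eq_neg_of_add_eq_zero_left heq]
    have hI : matrixEntries I ⊆ algCl k S₂ := Set.subset_union_right.trans (subset_algCl S₂)
    have h1 : matrixEntries (I * I.transpose * J.map (algebraMap k K)) ⊆ algCl k S₂ := by
      refine mul_mem_of_matrixEntries (mul_mem_of_matrixEntries hI ?_) ?_
      · rintro _ ⟨⟨i, j⟩, rfl⟩
        exact hI ⟨(j, i), rfl⟩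
      · rintro _ ⟨⟨i, j⟩, rfl⟩
        exact (algCl k S₂).algebraMap_mem _
    rintro _ ⟨⟨i, j⟩, rfl⟩
    exact neg_mem (h1 ⟨(i, j), rfl⟩)
  have hle : algCl k S₁ ≤ algCl k S₂ := algCl_mono Set.subset_union_left
  have hφb : b₁.map (IntermediateField.inclusion hle) = b₂ := by
    refine matrix_map_injective (algCl k S₂) ?_
    dsimp only
    rw [hb₂, ← hb₁, map_inclusion_map]
  -- The normal form is transported to the larger field of S₂, so that the centralizer dimension
  -- here is the same number as in `e2`.
  obtain ⟨r, hr, e3⟩ := trRank_matrixEntries_add_finrank_le hJ hJJ (chainMap n lam)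
    (algCl k S₂) (b := b₂) (mem_selfAdj_of_map (hb₂ ▸ hB₁))
    (g := g.map (IntermediateField.inclusion hle)) (h := h.map (IntermediateField.inclusion hle))
    (by rw [← Matrix.map_mul, hgh, Matrix.map_one _ (map_zero _) (map_one _)])
    (by rw [← Matrix.map_mul, hhg, Matrix.map_one _ (map_zero _) (map_one _)])
    (by
      have := congrArg (fun A => A.map (IntermediateField.inclusion hle)) hbg
      simp only [Matrix.map_mul, hφb, map_map_inclusion] at this
      exact this)
  rw [hb₂] at hr
  set d := finrank (algCl k S₂)
      ↥(selfAdj (J.map (algebraMap k (algCl k S₂))) ⊓ matrixCentralizer b₂)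
  -- The centralizer dimension d, gained from B₂, is exactly what the conjugacy class bound takes
  -- away from B₁.
  calc trRank k (S₂ ∪ matrixEntries B₂) + ((Fintype.card m + 1).choose 2 : ℕ)
      ≤ trRank k S₁ + ((∑ j, n j) * (2 * Fintype.card w - 3) : ℕ) + d +
        ((Fintype.card m + 1).choose 2 : ℕ) := by
        gcongr
        exact e2.trans (by gcongr)
    _ ≤ _ := by
        rw [hr]
        norm_cast
        omega

end Bound

end SOData

/-! ### Polynomial functions and flatness in coordinates -/

namespace SOData

open Module

section PolynomialFunctions

variable {X : Type*} [AddCommGroup X] [Module ℂ X]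

/-- A linear functional, as a polynomial function. -/
def linFun (l : Dual ℂ X) : polyFun X := ⟨fun x => l x, Algebra.subset_adjoin ⟨l, rfl⟩⟩

@[simp] theorem linFun_apply (l : Dual ℂ X) (x : X) : (linFun l : X → ℂ) x = l x := rfl

/-- Evaluation of polynomial functions at a point. -/
def evalAt (x : X) : polyFun X →ₐ[ℂ] ℂ := (Pi.evalAlgHom ℂ (fun _ : X => ℂ) x).comp (polyFun X).val

@[simp] theorem evalAt_apply (x : X) (f : polyFun X) : evalAt x f = (f : X → ℂ) x := rfl

theorem polyFun_ext {f g : polyFun X} (h : ∀ x, evalAt x f = evalAt x g) : f = g :=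
  Subtype.ext (funext h)

theorem adjoin_range_linFun {κ : Type*} (l : κ → Dual ℂ X)
    (hl : Submodule.span ℂ (Set.range l) = ⊤) :
    Algebra.adjoin ℂ (Set.range fun j => linFun (l j)) = ⊤ := by
  rw [eq_top_iff]
  have h1 : ∀ a : Dual ℂ X, linFun a ∈ Algebra.adjoin ℂ (Set.range fun j => linFun (l j)) := by
    intro a
    have ha : a ∈ Submodule.span ℂ (Set.range l) := hl ▸ Submodule.mem_top
    induction ha using Submodule.span_induction with
    | mem a ha =>
      obtain ⟨j, rfl⟩ := ha
      exact Algebra.subset_adjoin ⟨j, rfl⟩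
    | zero => exact zero_mem (Algebra.adjoin ℂ (Set.range fun j => linFun (l j)))
    | add a b _ _ ha hb => exact add_mem ha hb
    | smul c a _ ha => exact Subalgebra.smul_mem _ ha c
  rintro ⟨f, hf⟩ -
  induction hf using Algebra.adjoin_induction with
  | mem f hf =>
    obtain ⟨a, rfl⟩ := hf
    exact h1 a
  | algebraMap r => exact Subalgebra.algebraMap_mem _ r
  | add f g hf hg ihf ihg => exact add_mem ihf ihg
  | mul f g hf hg ihf ihg => exact mul_mem ihf ihg

section Basis

variable {ι : Type*} (b : Basis ι ℂ X)

theorem evalAt_aeval_coord [Fintype ι] (F : MvPolynomial ι ℂ) (x : X) :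
    evalAt x (MvPolynomial.aeval (fun i => linFun (b.coord i)) F) =
      MvPolynomial.eval (b.repr x) F := by
  induction F using MvPolynomial.induction_on with
  | C a => rw [MvPolynomial.aeval_C, AlgHom.commutes, MvPolynomial.eval_C]; rfl
  | add p q hp hq => rw [map_add, map_add, map_add, hp, hq]
  | mul_X p i hp => rw [map_mul, map_mul, map_mul, hp, MvPolynomial.aeval_X, MvPolynomial.eval_X]; rfl

/-- Polynomial functions are polynomials in the coordinates with respect to a basis. -/
noncomputable def polyFunEquiv [Fintype ι] : MvPolynomial ι ℂ ≃ₐ[ℂ] polyFun X :=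
  AlgEquiv.ofBijective (MvPolynomial.aeval fun i => linFun (b.coord i)) <| by
    constructor
    · intro F G h
      refine MvPolynomial.funext fun v => ?_
      have h1 := congrArg (evalAt (b.equivFun.symm v)) h
      simp only [evalAt_aeval_coord] at h1
      have h2 : (b.repr (b.equivFun.symm v) : ι → ℂ) = v := b.equivFun.apply_symm_apply v
      rwa [h2] at h1
    · rw [← AlgHom.range_eq_top, ← Algebra.adjoin_range_eq_range_aeval]
      refine adjoin_range_linFun _ (eq_top_iff.2 fun a _ => ?_)
      rw [← b.sum_dual_apply_smul_coord a]
      exact Submodule.sum_mem _ fun i _ => Submodule.smul_mem _ _ (Submodule.subset_span ⟨i, rfl⟩)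

theorem evalAt_polyFunEquiv [Fintype ι] (F : MvPolynomial ι ℂ) (x : X) :
    evalAt x (polyFunEquiv b F) = MvPolynomial.eval (b.repr x) F := evalAt_aeval_coord b F x

end Basis

/-- Substituting 2X multiplies the coefficient of a monomial of degree e by 2^e, and distinct powers
of 2 are distinct. Scaling by the single number 2 therefore detects homogeneity. -/
theorem isHomogeneous_of_eval {σ : Type*} (F : MvPolynomial σ ℂ) (d : ℕ)
    (h : ∀ x : σ → ℂ, MvPolynomial.eval ((2 : ℂ) • x) F = 2 ^ d * MvPolynomial.eval x F) :
    F.IsHomogeneous d := by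
  have h1 : ∀ G : MvPolynomial σ ℂ, ∀ s,
      (MvPolynomial.aeval (fun i => MvPolynomial.C (2 : ℂ) * MvPolynomial.X i) G).coeff s =
        2 ^ s.degree * G.coeff s := by
    classical
    intro G s
    induction G using MvPolynomial.induction_on' with
    | monomial t a =>
      have h3 : MvPolynomial.aeval (fun i => MvPolynomial.C (2 : ℂ) * MvPolynomial.X i)
          (MvPolynomial.monomial t a) = MvPolynomial.monomial t (2 ^ t.degree * a) := by
        rw [MvPolynomial.aeval_monomial, MvPolynomial.monomial_eq (s := t) (a := 2 ^ t.degree * a),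
          map_mul]
        simp only [mul_pow, Finsupp.prod_mul, MvPolynomial.algebraMap_eq]
        simp only [Finsupp.prod, ← map_pow, ← map_prod, Finset.prod_pow_eq_pow_sum]
        have h4 : t.degree = ∑ i ∈ t.support, t i := rfl
        rw [h4]
        ring
      rw [h3, MvPolynomial.coeff_monomial, MvPolynomial.coeff_monomial]
      split_ifs with h4
      · rw [h4]
      · rw [mul_zero]
    | add p q hp hq => rw [map_add, MvPolynomial.coeff_add, hp, hq, MvPolynomial.coeff_add, mul_add]
  have h2 : MvPolynomial.aeval (fun i => MvPolynomial.C (2 : ℂ) * MvPolynomial.X i) F =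
      MvPolynomial.C (2 ^ d) * F := by
    refine MvPolynomial.funext fun x => ?_
    rw [map_mul, MvPolynomial.eval_C, ← h]
    clear h h1
    induction F using MvPolynomial.induction_on with
    | C a => simp
    | add p q hp hq => simp only [map_add, hp, hq]
    | mul_X p i hp =>
      rw [map_mul, map_mul, hp, MvPolynomial.aeval_X, map_mul, map_mul]
      simp
  intro s hs
  have h3 := h1 F s
  rw [h2, MvPolynomial.coeff_C_mul] at h3
  have h4 : (2 : ℂ) ^ d = 2 ^ s.degree := mul_right_cancel₀ hs h3
  have h5 : (2 : ℕ) ^ d = 2 ^ s.degree := by exact_mod_cast h4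
  have h6 : Finsupp.weight (1 : σ → ℕ) s = s.degree :=
    (DFunLike.congr_fun (Finsupp.degree_eq_weight_one (σ := σ) (R := ℕ)) s).symm
  rw [h6]
  exact (Nat.pow_right_injective le_rfl h5).symm

theorem isFlatMorphism_of_homogeneous [FiniteDimensional ℂ X] {Y : Type*}
    {B : Subalgebra ℂ (Y → ℂ)} {κ : Type*} [Fintype κ] (e : MvPolynomial κ ℂ ≃ₐ[ℂ] B) (φ : X → Y)
    (f : κ → polyFun X) (d : κ → ℕ)
    (hf : ∀ j x, evalAt x (f j) = (e (MvPolynomial.X j) : Y → ℂ) (φ x)) (hd : ∀ j, 0 < d j)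
    (hom : ∀ j x, evalAt ((2 : ℂ) • x) (f j) = 2 ^ d j * evalAt x (f j))
    (hdim : ringKrullDim (polyFun X ⧸ Ideal.span (Set.range f)) +
      (Fintype.card κ : WithBot ℕ∞) ≤ (finrank ℂ X : WithBot ℕ∞)) :
    IsFlatMorphism (polyFun X) B φ := by
  let b := finBasis ℂ X
  let E := polyFunEquiv b
  have hEx : ∀ j v, MvPolynomial.eval v (E.symm (f j)) = evalAt (b.equivFun.symm v) (f j) := by
    intro j v
    rw [← E.apply_symm_apply (f j), evalAt_polyFunEquiv, E.apply_symm_apply]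
    have h1 : (b.repr (b.equivFun.symm v) : _ → ℂ) = v := b.equivFun.apply_symm_apply v
    rw [h1]
  have hflat : (MvPolynomial.aeval (fun j => E.symm (f j)) :
      MvPolynomial κ ℂ →ₐ[ℂ] MvPolynomial (Fin (finrank ℂ X)) ℂ).toRingHom.Flat := by
    refine flat_aeval_of_isHomogeneous hd (fun j => isHomogeneous_of_eval _ _ fun v => ?_) ?_
    · rw [hEx, hEx, map_smul, hom]
    · rw [Fintype.card_fin]
      refine le_trans (add_le_add_left (le_of_eq ?_) _) hdim
      refine ringKrullDim_eq_of_ringEquiv (Ideal.quotientEquiv _ _ E.toRingEquiv ?_)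
      rw [Ideal.map_span, ← Set.range_comp]
      congr 2
      funext j
      exact (E.apply_symm_apply (f j)).symm
  let c : B →ₐ[ℂ] polyFun X := (MvPolynomial.aeval f).comp e.symm.toAlgHom
  have hc : c.toRingHom = (E.toRingEquiv.toRingHom.comp (MvPolynomial.aeval (fun j => E.symm (f j)) :
      MvPolynomial κ ℂ →ₐ[ℂ] MvPolynomial (Fin (finrank ℂ X)) ℂ).toRingHom).comp
        e.symm.toRingEquiv.toRingHom := by
    ext1 g
    change MvPolynomial.aeval f (e.symm g) = E (MvPolynomial.aeval (fun j => E.symm (f j)) (e.symm g))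
    rw [← AlgEquiv.coe_toAlgHom E, MvPolynomial.comp_aeval_apply]
    congr 2
    funext j
    exact (E.apply_symm_apply (f j)).symm
  refine ⟨c, fun g x => ?_, ?_⟩
  · obtain ⟨G, rfl⟩ := e.surjective g
    have h1 : (evalAt x).comp (MvPolynomial.aeval f) =
        ((Pi.evalAlgHom ℂ (fun _ : Y => ℂ) (φ x)).comp B.val).comp e.toAlgHom := by
      ext j
      simpa using hf j x
    have h2 := DFunLike.congr_fun h1 G
    have h3 : c (e G) = MvPolynomial.aeval f G := by
      change MvPolynomial.aeval f (e.symm (e G)) = _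
      rw [e.symm_apply_apply]
    rw [h3]
    exact h2
  · rw [hc]
    refine RingHom.Flat.comp (RingHom.Flat.of_bijective e.symm.bijective) ?_
    exact RingHom.Flat.comp hflat (RingHom.Flat.of_bijective E.bijective)

end PolynomialFunctions

end SOData

/-! ### The coordinate ring of a product with a symmetric product -/

namespace SOData

open Module

section SymmetricProduct

theorem eval_map_sumAlgEquiv {σ ι : Type*} (lam : σ → ℂ) (y : ι → ℂ) (F : MvPolynomial (σ ⊕ ι) ℂ) :
    MvPolynomial.eval lam (MvPolynomial.map (MvPolynomial.eval y)
      (MvPolynomial.sumAlgEquiv ℂ σ ι F)) = MvPolynomial.eval (Sum.elim lam y) F := by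
  induction F using MvPolynomial.induction_on with
  | C a =>
    rw [← MvPolynomial.algebraMap_eq, AlgEquiv.commutes, MvPolynomial.algebraMap_eq,
      MvPolynomial.algebraMap_apply, MvPolynomial.map_C]
    simp
  | add p q hp hq => simp only [map_add, hp, hq]
  | mul_X p i hp =>
    rw [map_mul, map_mul, map_mul, hp, map_mul, MvPolynomial.eval_X]
    congr 1
    rcases i with i | i <;> simp

variable {Y : Type*} [AddCommGroup Y] [Module ℂ Y] {ι : Type*} [Fintype ι] (b : Basis ι ℂ Y) (n : ℕ)

theorem multiset_map_comp_perm (lam : Fin n → ℂ) (σ : Equiv.Perm (Fin n)) :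
    Multiset.map (lam ∘ σ) Finset.univ.val = Multiset.map lam Finset.univ.val := by
  rw [← Multiset.map_map]
  congr 1
  exact Multiset.map_univ_val_equiv σ

theorem exists_enum {K : Type*} {n : ℕ} (s : Sym K n) :
    ∃ lam : Fin n → K, (s : Multiset K) = Multiset.map lam Finset.univ.val := by
  obtain ⟨⟨l⟩, h⟩ := s
  change l.length = n at h
  subst h
  refine ⟨l.get, ?_⟩
  change (l : Multiset K) = _
  rw [Fin.univ_val_map, List.ofFn_get]

/-- The coordinates on `Y × SⁿC`: elementary symmetric functions and linear coordinates. -/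
noncomputable def symCoord : Fin n ⊕ ι → Y × Sym ℂ n → ℂ
  | .inl i => fun p => (p.2 : Multiset ℂ).esymm (i + 1)
  | .inr j => fun p => b.coord j p.1

omit [Fintype ι] in
theorem symCoord_mem (i : Fin n ⊕ ι) : symCoord b n i ∈ polyFunProdSym Y n := by
  change symCoord b n i ∘ toSym Y n ∈ polyFun (Y × (Fin n → ℂ))
  rcases i with i | j
  · let x : Fin n → polyFun (Y × (Fin n → ℂ)) := fun a =>
      linFun ((LinearMap.proj a).comp (LinearMap.snd ℂ Y (Fin n → ℂ)))
    have h : symCoord b n (.inl i) ∘ toSym Y n =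
        (MvPolynomial.aeval x (MvPolynomial.esymm (Fin n) ℂ (i + 1)) : polyFun (Y × (Fin n → ℂ))) := by
      funext p
      have h1 : ∀ G : MvPolynomial (Fin n) ℂ, evalAt p (MvPolynomial.aeval x G) =
          MvPolynomial.aeval p.2 G := fun G => by
        rw [← AlgHom.comp_apply]
        congr 1
        ext a
        simp [x]
      refine Eq.trans ?_ (h1 _).symm
      rw [MvPolynomial.aeval_esymm_eq_multiset_esymm]
      rfl
    rw [h]
    exact Subtype.property _
  · exact (linFun ((b.coord j).comp (LinearMap.fst ℂ Y (Fin n → ℂ)))).2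

omit [Fintype ι] in
theorem aeval_symCoord_apply (F : MvPolynomial (Fin n ⊕ ι) ℂ) (p : Y × Sym ℂ n) :
    ((MvPolynomial.aeval (fun i => (⟨symCoord b n i, symCoord_mem b n i⟩ : polyFunProdSym Y n)) F :
      polyFunProdSym Y n) : Y × Sym ℂ n → ℂ) p =
      MvPolynomial.eval (Sum.elim (fun i : Fin n => (p.2 : Multiset ℂ).esymm (i + 1))
        (b.repr p.1)) F := by
  induction F using MvPolynomial.induction_on with
  | C a => rw [MvPolynomial.aeval_C, MvPolynomial.eval_C]; rfl
  | add p q hp hq =>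
    rw [map_add, map_add, ← hp, ← hq]
    rfl
  | mul_X q i hp =>
    rw [map_mul, map_mul, ← hp, MvPolynomial.aeval_X, MvPolynomial.eval_X]
    rcases i with i | i <;> rfl

/-- Take the roots of the monic polynomial whose coefficients are the prescribed values up to sign.
-/
theorem exists_sym_esymm (c : Fin n → ℂ) :
    ∃ s : Sym ℂ n, ∀ i : Fin n, (s : Multiset ℂ).esymm (i + 1) = c i := by
  let p : Polynomial ℂ := Polynomial.X ^ n +
    ∑ i : Fin n, Polynomial.C ((-1) ^ (i.1 + 1) * c i) * Polynomial.X ^ (n - (i.1 + 1))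
  have hdeg : (∑ i : Fin n, Polynomial.C ((-1) ^ (i.1 + 1) * c i) *
      Polynomial.X ^ (n - (i.1 + 1))).degree < (n : WithBot ℕ) := by
    refine lt_of_le_of_lt (Polynomial.degree_sum_le _ _) ?_
    refine (Finset.sup_lt_iff (WithBot.bot_lt_coe n)).2 fun i _ => ?_
    refine lt_of_le_of_lt (Polynomial.degree_C_mul_X_pow_le _ _) ?_
    have := i.2
    exact WithBot.coe_lt_coe.2 (by omega : n - (i.1 + 1) < n)
  have hp : p.Monic := Polynomial.monic_X_pow_add hdeg
  have hn : p.natDegree = n := Polynomial.natDegree_eq_of_degree_eq_some (by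
    rw [Polynomial.degree_add_eq_left_of_degree_lt (by rwa [Polynomial.degree_X_pow]),
      Polynomial.degree_X_pow])
  have hcard : Multiset.card p.roots = n := by
    rw [← hn]; exact (IsAlgClosed.splits p).natDegree_eq_card_roots.symm
  refine ⟨⟨p.roots, hcard⟩, fun i => ?_⟩
  have h1 := Polynomial.coeff_eq_esymm_roots_of_card (p := p) (by rw [hcard, hn])
    (k := n - (i.1 + 1)) (by omega)
  have hi := i.2
  rw [hp.leadingCoeff, one_mul, hn, Nat.sub_sub_self (by omega)] at h1
  have h2 : p.coeff (n - (i.1 + 1)) = (-1) ^ (i.1 + 1) * c i := by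
    simp only [p, Polynomial.coeff_add, Polynomial.coeff_X_pow, Polynomial.finsetSum_coeff,
      Polynomial.coeff_C_mul]
    rw [if_neg (by omega), zero_add, Finset.sum_eq_single i]
    · simp
    · intro j _ hj
      rw [if_neg, mul_zero]
      intro h
      have := j.2
      exact hj (Fin.ext (by omega))
    · simp
  rw [h2] at h1
  exact (mul_left_cancel₀ (pow_ne_zero _ (by norm_num)) h1).symm

theorem eval_map_aeval_esymm {ι : Type*} (lam : Fin n → ℂ) (y : ι → ℂ)
    (G : MvPolynomial (Fin n) (MvPolynomial ι ℂ)) :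
    MvPolynomial.eval lam (MvPolynomial.map (MvPolynomial.eval y) (MvPolynomial.aeval
      (fun i : Fin n => MvPolynomial.esymm (Fin n) (MvPolynomial ι ℂ) (i + 1)) G)) =
    MvPolynomial.eval (fun i : Fin n => (Multiset.map lam Finset.univ.val).esymm (i + 1))
      (MvPolynomial.map (MvPolynomial.eval y) G) := by
  induction G using MvPolynomial.induction_on with
  | C a => simp
  | add p q hp hq => simp only [map_add, hp, hq]
  | mul_X p i hp =>
    rw [map_mul, map_mul, map_mul, hp, map_mul, map_mul, MvPolynomial.aeval_X, MvPolynomial.map_X,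
      MvPolynomial.eval_X, MvPolynomial.map_esymm, ← MvPolynomial.coe_aeval_eq_eval,
      MvPolynomial.coe_aeval_eq_eval]
    congr 1
    exact MvPolynomial.aeval_esymm_eq_multiset_esymm (Fin n) ℂ (i.1 + 1) lam

/-- The coordinate ring of `Y × SⁿC` is a polynomial ring. -/
noncomputable def polyFunProdSymEquiv :
    MvPolynomial (Fin n ⊕ ι) ℂ ≃ₐ[ℂ] polyFunProdSym Y n :=
  AlgEquiv.ofBijective
    (MvPolynomial.aeval fun i => (⟨symCoord b n i, symCoord_mem b n i⟩ : polyFunProdSym Y n)) <| by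
    constructor
    · intro F G h
      refine MvPolynomial.funext fun v => ?_
      -- Injectivity: every tuple of values of the coordinates is attained, so a polynomial
      -- vanishing as a function is zero.
      obtain ⟨s, hs⟩ := exists_sym_esymm n (v ∘ Sum.inl)
      have h1 := congrFun (congrArg Subtype.val h) (b.equivFun.symm (v ∘ Sum.inr), s)
      rw [aeval_symCoord_apply, aeval_symCoord_apply] at h1
      have h2 : (b.repr (b.equivFun.symm (v ∘ Sum.inr)) : ι → ℂ) = v ∘ Sum.inr :=
        b.equivFun.apply_symm_apply _
      have h3 : (fun i : Fin n => (s : Multiset ℂ).esymm (i + 1)) = v ∘ Sum.inl := funext hs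
      simp only [h2, h3, Sum.elim_comp_inl_inr] at h1
      exact h1
    · rintro ⟨f, hf⟩
      let b' := ((Pi.basisFun ℂ (Fin n)).prod b).map (LinearEquiv.prodComm ℂ (Fin n → ℂ) Y)
      have hb' : ∀ (y : Y) (lam : Fin n → ℂ), (b'.repr (y, lam) : Fin n ⊕ ι → ℂ) =
          Sum.elim lam (b.repr y) := by
        intro y lam
        funext i
        rcases i with i | i <;> simp [b']
      obtain ⟨F, hF⟩ := (polyFunEquiv b').surjective ⟨f ∘ toSym Y n, hf⟩
      have hFx : ∀ (y : Y) (lam : Fin n → ℂ),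
          MvPolynomial.eval (Sum.elim lam (b.repr y)) F = f (toSym Y n (y, lam)) := by
        intro y lam
        rw [← hb', ← evalAt_polyFunEquiv, hF]
        rfl
      -- Surjectivity: the pulled back function depends only on the multiset of the n coordinates,
      -- so the fundamental theorem of symmetric polynomials applies over the polynomial ring of Y.
      have hsym : (MvPolynomial.sumAlgEquiv ℂ (Fin n) ι F).IsSymmetric := by
        intro σ
        refine (MvPolynomial.sumAlgEquiv ℂ (Fin n) ι).symm.injective (MvPolynomial.funext fun v => ?_)
        rw [← Sum.elim_comp_inl_inr v, ← eval_map_sumAlgEquiv, ← eval_map_sumAlgEquiv,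
          AlgEquiv.apply_symm_apply, AlgEquiv.apply_symm_apply, MvPolynomial.map_rename,
          MvPolynomial.eval_rename, eval_map_sumAlgEquiv, eval_map_sumAlgEquiv]
        have h2 : (b.repr (b.equivFun.symm (v ∘ Sum.inr)) : ι → ℂ) = v ∘ Sum.inr :=
          b.equivFun.apply_symm_apply _
        rw [← h2, hFx, hFx]
        congr 1
        refine Prod.ext rfl (Subtype.ext ?_)
        exact multiset_map_comp_perm n (v ∘ Sum.inl) σ
      obtain ⟨G, hG⟩ := (MvPolynomial.esymmAlgEquiv (Fin n) (MvPolynomial ι ℂ)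
        (Fintype.card_fin n)).surjective ⟨_, hsym⟩
      refine ⟨(MvPolynomial.sumAlgEquiv ℂ (Fin n) ι).symm G, Subtype.ext (funext ?_)⟩
      rintro ⟨y, s⟩
      obtain ⟨lam, hlam⟩ : ∃ lam : Fin n → ℂ, (s : Multiset ℂ) =
          Multiset.map lam Finset.univ.val := exists_enum s
      have hs : toSym Y n (y, lam) = (y, s) := Prod.ext rfl (Subtype.ext hlam.symm)
      have hG' : MvPolynomial.aeval
          (fun i : Fin n => MvPolynomial.esymm (Fin n) (MvPolynomial ι ℂ) (i + 1)) G =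
          MvPolynomial.sumAlgEquiv ℂ (Fin n) ι F := by
        rw [← MvPolynomial.esymmAlgHom_apply, ← MvPolynomial.esymmAlgEquiv_apply _ _ (Fintype.card_fin n), hG]
      rw [aeval_symCoord_apply, ← eval_map_sumAlgEquiv, AlgEquiv.apply_symm_apply]
      change _ = f (y, s)
      rw [← hs, ← hFx, ← eval_map_sumAlgEquiv, ← hG', hs]
      rw [eval_map_aeval_esymm, hlam]

theorem polyFunProdSymEquiv_X (i : Fin n ⊕ ι) :
    (polyFunProdSymEquiv b n (MvPolynomial.X i) : Y × Sym ℂ n → ℂ) = symCoord b n i := by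
  change ((MvPolynomial.aeval _ (MvPolynomial.X i) : polyFunProdSym Y n) : Y × Sym ℂ n → ℂ) = _
  rw [MvPolynomial.aeval_X]

end SymmetricProduct

end SOData

/-! ### Square roots of characteristic polynomials -/

namespace SOData

open Module

section SquareRoot

/-- The n lower coefficients of q are solved for one at a time from the top, which needs only that 2
is invertible. They remove the coefficients of f - q² down to degree n. -/
theorem exists_monic_sq_sub_degree_lt {R : Type*} [CommRing R] [Nontrivial R]
    (h2 : IsUnit (2 : R)) {f : Polynomial R} {n : ℕ} (hf : f.Monic) (hn : f.natDegree = 2 * n) :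
    ∃ q : Polynomial R, q.Monic ∧ q.natDegree = n ∧ (f - q ^ 2).degree < (n : WithBot ℕ) := by
  obtain ⟨u, hu⟩ := h2.exists_left_inv
  have key : ∀ j ≤ n, ∃ q : Polynomial R, q.Monic ∧ q.natDegree = n ∧
      (f - q ^ 2).degree < ((2 * n - j : ℕ) : WithBot ℕ) := by
    intro j
    induction j with
    | zero =>
      intro _
      refine ⟨Polynomial.X ^ n, Polynomial.monic_X_pow n, Polynomial.natDegree_X_pow n, ?_⟩
      rw [← pow_mul, mul_comm n 2, Nat.sub_zero]
      have h1 : f.degree = ((2 * n : ℕ) : WithBot ℕ) := by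
        rw [Polynomial.degree_eq_natDegree hf.ne_zero, hn]
      rw [← h1]
      refine Polynomial.degree_sub_lt_left ?_ hf.ne_zero ?_
      · rw [h1, Polynomial.degree_X_pow]
      · rw [hf.leadingCoeff, (Polynomial.monic_X_pow _).leadingCoeff]
    | succ j ih =>
      intro hj
      obtain ⟨q, hq, hqn, hlt⟩ := ih (by omega)
      rw [Polynomial.degree_lt_iff_coeff_zero] at hlt
      set c := (f - q ^ 2).coeff (2 * n - j - 1) with hc
      have hqd : q.degree = (n : WithBot ℕ) := by
        rw [Polynomial.degree_eq_natDegree hq.ne_zero, hqn]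
      have hdl : (Polynomial.C (u * c) * Polynomial.X ^ (n - j - 1)).degree < q.degree := by
        rw [hqd]
        refine lt_of_le_of_lt (Polynomial.degree_C_mul_X_pow_le _ _) ?_
        exact WithBot.coe_lt_coe.2 (by omega : n - j - 1 < n)
      -- With u = 1/2, the cross term 2q·ucX^{n-j-1} has leading term cX^{2n-j-1}, which is the
      -- coefficient to be removed. The square of the correction has lower degree.
      refine ⟨q + Polynomial.C (u * c) * Polynomial.X ^ (n - j - 1), hq.add_of_left hdl, ?_, ?_⟩
      · rw [Polynomial.natDegree_add_eq_left_of_degree_lt hdl, hqn]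
      · have h1 : f - (q + Polynomial.C (u * c) * Polynomial.X ^ (n - j - 1)) ^ 2 =
            (f - q ^ 2) - Polynomial.C c * (q * Polynomial.X ^ (n - j - 1)) -
              Polynomial.C ((u * c) ^ 2) * Polynomial.X ^ (2 * (n - j - 1)) := by
          have h3 : Polynomial.C (u * c) * 2 = Polynomial.C c := by
            rw [show (2 : Polynomial R) = Polynomial.C 2 from (map_ofNat _ 2).symm,
              ← Polynomial.C_mul]
            congr 1
            linear_combination c * hu
          rw [← h3, mul_comm 2, pow_mul, Polynomial.C_pow]
          ring
        rw [h1, Polynomial.degree_lt_iff_coeff_zero]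
        intro a ha
        rw [Polynomial.coeff_sub, Polynomial.coeff_sub, Polynomial.coeff_C_mul,
          Polynomial.coeff_C_mul, Polynomial.coeff_X_pow, if_neg (by omega), mul_zero, sub_zero,
          Polynomial.coeff_mul_X_pow', if_pos (by omega)]
        rcases Nat.lt_or_ge a (2 * n - j) with h4 | h4
        · have h5 : a = 2 * n - j - 1 := by omega
          have h6 : a - (n - j - 1) = q.natDegree := by omega
          rw [h6, hq.coeff_natDegree, h5, ← hc]
          ring
        · rw [hlt a h4, Polynomial.coeff_eq_zero_of_natDegree_lt (by omega)]
          ring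
  obtain ⟨q, hq, hqn, hlt⟩ := key n le_rfl
  refine ⟨q, hq, hqn, ?_⟩
  rwa [show 2 * n - n = n by omega] at hlt

/-- In p² - q² = (p - q)(p + q) the second factor has degree n with leading coefficient 2, so the
first factor must vanish. This uniqueness identifies square roots found pointwise with
specializations of one found over a ring. -/
theorem eq_of_degree_sq_sub_sq_lt {K : Type*} [Field K] [CharZero K] {p q : Polynomial K} {n : ℕ}
    (hp : p.Monic) (hq : q.Monic) (hpn : p.natDegree = n) (hqn : q.natDegree = n)
    (h : (p ^ 2 - q ^ 2).degree < (n : WithBot ℕ)) : p = q := by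
  by_contra hne
  have h1 : p - q ≠ 0 := sub_ne_zero.2 hne
  have h2 : (p + q).coeff n = 2 := by
    rw [Polynomial.coeff_add]
    nth_rw 1 [← hpn]
    rw [← hqn, hp.coeff_natDegree, hq.coeff_natDegree]
    norm_num
  have h3 : (n : WithBot ℕ) ≤ (p + q).degree :=
    Polynomial.le_degree_of_ne_zero (by rw [h2]; exact two_ne_zero)
  have h4 : p ^ 2 - q ^ 2 = (p - q) * (p + q) := by ring
  rw [h4, Polynomial.degree_mul] at h
  have h5 : 0 ≤ (p - q).degree := Polynomial.zero_le_degree_iff.2 h1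
  exact absurd h (not_lt.2 (h3.trans (le_add_of_nonneg_left h5)))

end SquareRoot

section Charpoly

variable {m : Type*} [Fintype m] [DecidableEq m]

theorem charpoly_smul {K : Type*} [Field K] [Infinite K] (A : Matrix m m K) {c : K} (hc : c ≠ 0) :
    (c • A).charpoly = A.charpoly.scaleRoots c := by
  refine Polynomial.funext fun t => ?_
  obtain ⟨s, rfl⟩ : ∃ s, t = c * s := ⟨c⁻¹ * t, by rw [mul_inv_cancel_left₀ hc]⟩
  have h := Polynomial.scaleRoots_eval₂_mul (p := A.charpoly) (RingHom.id K) s c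
  rw [RingHom.id_apply] at h
  change Polynomial.eval _ _ = Polynomial.eval₂ _ _ _
  rw [h, Matrix.charpoly_natDegree_eq_dim, ← Polynomial.eval, Matrix.eval_charpoly,
    Matrix.eval_charpoly, ← Matrix.det_smul]
  congr 1
  ext i j
  simp [Matrix.scalar_apply, Matrix.diagonal_apply, mul_sub]

theorem charpoly_eq_of_mul_eq {K : Type*} [Field K] {p : Type*} [Fintype p] [DecidableEq p]
    {g : Matrix m p K} {h : Matrix p m K} (hgh : g * h = 1) (hhg : h * g = 1)
    {A : Matrix m m K} {B : Matrix p p K} (hAB : A * g = g * B) : A.charpoly = B.charpoly := by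
  have hcard : Fintype.card m = Fintype.card p := Matrix.square_of_invertible g h hgh hhg
  have h1 : A = g * (B * h) := by
    rw [← Matrix.mul_assoc, ← hAB, Matrix.mul_assoc, hgh, Matrix.mul_one]
  have h2 : B = (B * h) * g := by rw [Matrix.mul_assoc, hhg, Matrix.mul_one]
  have h3 := Matrix.charpoly_mul_comm' g (B * h)
  rw [← h1, ← h2, hcard] at h3
  exact mul_left_cancel₀ (pow_ne_zero _ Polynomial.X_ne_zero) h3

/-- The two halves of a hyperbolic basis. -/
def chainIndexEquiv {ι : Type*} (n : ι → ℕ) :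
    ChainIndex n ≃ (Σ j, Fin (n j)) ⊕ (Σ j, Fin (n j)) where
  toFun x := if x.2.2 then .inl ⟨x.1, x.2.1⟩ else .inr ⟨x.1, x.2.1⟩
  invFun := Sum.elim (fun x => ⟨x.1, x.2, true⟩) (fun x => ⟨x.1, x.2, false⟩)
  left_inv := by
    rintro ⟨j, a, ε⟩
    cases ε <;> rfl
  right_inv := by rintro (x | x) <;> rfl

/-- The operator preserves the two halves of the hyperbolic basis and acts on both by the same
matrix. -/
theorem charpoly_chainMap {K : Type*} [Field K] {ι : Type*} [Fintype ι] [DecidableEq ι]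
    (n : ι → ℕ) (lam : ι → K) :
    ∃ C : Matrix (Σ j, Fin (n j)) (Σ j, Fin (n j)) K,
      (chainMap n lam).charpoly = C.charpoly ^ 2 := by
  let C : Matrix (Σ j, Fin (n j)) (Σ j, Fin (n j)) K := fun x y =>
    chainMap n lam ⟨x.1, x.2, true⟩ ⟨y.1, y.2, true⟩
  refine ⟨C, ?_⟩
  rw [← Matrix.charpoly_reindex (chainIndexEquiv n)]
  have h : Matrix.reindex (chainIndexEquiv n) (chainIndexEquiv n) (chainMap n lam) =
      Matrix.fromBlocks C 0 0 C := by
    have hne : ∀ x y : Σ j, Fin (n j), ∀ ε ε' : Bool, ε ≠ ε' →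
        chainMap n lam ⟨x.1, x.2, ε⟩ ⟨y.1, y.2, ε'⟩ = 0 := by
      intro x y ε ε' hε
      have h1 : (⟨x.1, x.2, ε⟩ : ChainIndex n) ≠ ⟨y.1, y.2, ε'⟩ := fun h =>
        hε (congrArg (fun z : ChainIndex n => z.2.2) h)
      simp [chainMap, h1, hε]
    have heq : ∀ x y : Σ j, Fin (n j),
        chainMap n lam ⟨x.1, x.2, false⟩ ⟨y.1, y.2, false⟩ = C x y := by
      rintro ⟨j, a⟩ ⟨j', a'⟩
      by_cases h : j = j'
      · subst h
        simp [C, chainMap]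
      · have h1 : ∀ ε, (⟨j, a, ε⟩ : ChainIndex n) ≠ ⟨j', a', ε⟩ := fun ε h' =>
          h (congrArg Sigma.fst h')
        simp [C, chainMap, h, h1]
    ext (x | x) (y | y)
    · rfl
    · exact hne x y _ _ (by decide)
    · exact hne x y _ _ (by decide)
    · exact heq x y
  rw [h, Matrix.charpoly_fromBlocks_zero₁₂, sq]

variable {J J₁ : Matrix m m ℂ}

theorem exists_charpoly_eq_sq (hJ : J.transpose = -J) (hJJ : J * J₁ = 1) {B : Matrix m m ℂ}
    (hB : B ∈ selfAdj J) :
    ∃ p : Polynomial ℂ, p.Monic ∧ 2 * p.natDegree = Fintype.card m ∧ B.charpoly = p ^ 2 := by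
  obtain ⟨ι, _, _, n, lam, g, h, hgh, hhg, -, hBg⟩ := exists_matrix_normalForm (L := ℂ) hJ hJJ
    (B := B) (by simpa using hB) B.charpoly_monic.ne_zero (IsAlgClosed.splits _)
    B.aeval_self_charpoly
  obtain ⟨C, hC⟩ := charpoly_chainMap n lam
  have h1 : B.charpoly = C.charpoly ^ 2 := by
    rw [charpoly_eq_of_mul_eq hgh hhg hBg, ← hC]
    congr 1
  refine ⟨C.charpoly, C.charpoly_monic, ?_, h1⟩
  rw [← B.charpoly_natDegree_eq_dim, h1, C.charpoly_monic.natDegree_pow]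

/-- The normal form of the operator 0 is a symplectic basis. A diagonal operator with the same value
on both vectors of each hyperbolic pair is self-adjoint. -/
theorem exists_selfAdj_charpoly (hJ : J.transpose = -J) (hJJ : J * J₁ = 1) {n : ℕ}
    (hn : 2 * n = Fintype.card m) (d : Fin n → ℂ) :
    ∃ B ∈ selfAdj J, B.charpoly = (∏ i, (Polynomial.X - Polynomial.C (d i))) ^ 2 := by
  obtain ⟨ι, _, _, r, lam, g, h, hgh, hhg, hgJ, hBg⟩ := exists_matrix_normalForm (L := ℂ) hJ hJJ
    (B := 0) (zero_mem _) Polynomial.X_ne_zero (IsAlgClosed.splits _) (Polynomial.aeval_X _)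
  -- A chain of length 2 would put an entry 1 in the matrix of the zero operator.
  have hr : ∀ j, r j ≤ 1 := by
    intro j
    by_contra hj
    have h1 : (chainMap r lam).map (algebraMap ℂ ℂ) = 0 := by
      rw [← Matrix.one_mul ((chainMap r lam).map (algebraMap ℂ ℂ)), ← hhg, Matrix.mul_assoc, ← hBg,
        Matrix.zero_mul, Matrix.mul_zero]
    have h2 := congrFun (congrFun h1 ⟨j, ⟨1, by omega⟩, true⟩) ⟨j, ⟨0, by omega⟩, true⟩
    simp [chainMap] at h2
  have hcard : Fintype.card (Σ j, Fin (r j)) = n := by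
    have h1 : Fintype.card m = Fintype.card (ChainIndex r) :=
      Matrix.square_of_invertible g h hgh hhg
    rw [Fintype.card_congr (chainIndexEquiv r), Fintype.card_sum] at h1
    omega
  let e := Fintype.equivFinOfCardEq hcard
  let D : Matrix (ChainIndex r) (ChainIndex r) ℂ :=
    Matrix.diagonal fun x => d (e ⟨x.1, x.2.1⟩)
  have hgJ' : g.transpose * J * g = chainForm ℂ r := by simpa using hgJ
  have hDJ : D * chainForm ℂ r = chainForm ℂ r * D := by
    ext ⟨j, a, ε⟩ ⟨j', a', ε'⟩
    rw [Matrix.diagonal_mul, Matrix.mul_diagonal, mul_comm]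
    by_cases h : j = j'
    · subst h
      have : a = a' := by have := hr j; have := a.2; have := a'.2; exact Fin.ext (by omega)
      rw [this]
    · simp [chainForm, h]
  refine ⟨g * D * h, ?_, ?_⟩
  · rw [mem_selfAdj]
    have hJ' : J = h.transpose * chainForm ℂ r * h := by
      rw [← hgJ']
      have h3 : h.transpose * g.transpose = 1 := by
        rw [← Matrix.transpose_mul, hgh, Matrix.transpose_one]
      calc J = 1 * J * 1 := by simp
        _ = (h.transpose * g.transpose) * J * (g * h) := by rw [h3, hgh]
        _ = _ := by simp only [Matrix.mul_assoc]
    have h3 : g.transpose * h.transpose = 1 := by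
      rw [← Matrix.transpose_mul, hhg, Matrix.transpose_one]
    calc (g * D * h).transpose * J
        = h.transpose * D * (g.transpose * h.transpose) * chainForm ℂ r * h := by
          nth_rw 1 [hJ']
          simp only [Matrix.transpose_mul, D, Matrix.diagonal_transpose, Matrix.mul_assoc]
      _ = h.transpose * (D * chainForm ℂ r) * h := by
          rw [h3]; simp only [Matrix.mul_assoc, Matrix.one_mul]
      _ = h.transpose * chainForm ℂ r * (h * g) * D * h := by
          rw [hDJ, hhg]; simp only [Matrix.mul_assoc, Matrix.one_mul]
      _ = J * (g * D * h) := by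
          nth_rw 1 [hJ']
          simp only [Matrix.mul_assoc]
  · rw [charpoly_eq_of_mul_eq (A := g * D * h) (B := D) hgh hhg
      (by rw [Matrix.mul_assoc _ h, hhg, Matrix.mul_one]), Matrix.charpoly_diagonal,
      ← (chainIndexEquiv r).symm.prod_comp, Fintype.prod_sum_type, sq]
    congr 1 <;>
    · rw [← e.symm.prod_comp]
      refine Finset.prod_congr rfl fun i _ => ?_
      simp [chainIndexEquiv]

end Charpoly

end SOData

/-! ### Hankel determinants and the number of distinct roots -/

namespace SOData

open Module

section Hankel

variable {K : Type*} [Field K] {n : ℕ}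

/-- The Hankel determinant of power sums. -/
def hankelDet (lam : Fin n → K) (s : ℕ) : K :=
  (Matrix.of fun i j : Fin s => ∑ a, lam a ^ (i.1 + j.1)).det

theorem prod_X_sub_C_eq_multiset_prod (lam : Fin n → K) :
    ∏ i, (Polynomial.X - Polynomial.C (lam i)) =
      ((Multiset.map lam Finset.univ.val).map fun a => Polynomial.X - Polynomial.C a).prod := by
  rw [Multiset.map_map]; rfl

variable [DecidableEq K]

/-- The coefficients of the product of X - b over the distinct values b form a kernel vector. -/
theorem hankelDet_eq_zero (lam : Fin n → K) {s : ℕ} (h : (Finset.univ.image lam).card < s) :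
    hankelDet lam s = 0 := by
  let p : Polynomial K := ∏ b ∈ Finset.univ.image lam, (Polynomial.X - Polynomial.C b)
  have hp : p.Monic := Polynomial.monic_prod_of_monic _ _ fun b _ => Polynomial.monic_X_sub_C b
  have hpn : p.natDegree < s := by
    rwa [Polynomial.natDegree_finsetProd_X_sub_C_eq_card]
  rw [hankelDet, ← Matrix.exists_mulVec_eq_zero_iff]
  refine ⟨fun i => p.coeff i, fun h0 => ?_, ?_⟩
  · have h1 := congrFun h0 ⟨p.natDegree, hpn⟩
    simp only [hp.coeff_natDegree, Pi.zero_apply] at h1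
    exact one_ne_zero h1
  · funext i
    have h1 : ∀ a, ∑ j : Fin s, lam a ^ (i.1 + j.1) * p.coeff j = lam a ^ i.1 * p.eval (lam a) := by
      intro a
      rw [Polynomial.eval_eq_sum_range' hpn, Finset.mul_sum, ← Fin.sum_univ_eq_sum_range
        (fun j => lam a ^ i.1 * (p.coeff j * lam a ^ j))]
      refine Finset.sum_congr rfl fun j _ => ?_
      ring
    simp only [Matrix.mulVec, dotProduct, Matrix.of_apply, Finset.sum_mul, Pi.zero_apply]
    rw [Finset.sum_comm]
    refine Finset.sum_eq_zero fun a _ => ?_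
    rw [h1, Polynomial.eval_prod, Finset.prod_eq_zero (i := lam a)]
    · rw [mul_zero]
    · exact Finset.mem_image_of_mem _ (Finset.mem_univ a)
    · simp

/-- A kernel vector gives a polynomial p of degree less than s with Σ r(λₐ)p(λₐ) = 0 for every r of
degree less than s. Choosing r to vanish at all distinct values but one forces p to vanish there,
multiplicities being nonzero in characteristic zero. Then p has s distinct roots, hence is zero. -/
theorem hankelDet_ne_zero [CharZero K] (lam : Fin n → K) :
    hankelDet lam (Finset.univ.image lam).card ≠ 0 := by
  set s := (Finset.univ.image lam).card with hs
  rw [hankelDet, ne_eq, ← Matrix.exists_mulVec_eq_zero_iff]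
  rintro ⟨u, hu0, hu⟩
  let p : Polynomial K := ∑ j : Fin s, Polynomial.C (u j) * Polynomial.X ^ (j : ℕ)
  have hpd : p.degree < (s : WithBot ℕ) := Polynomial.degree_sum_fin_lt u
  have hpe : ∀ x, p.eval x = ∑ j : Fin s, u j * x ^ (j : ℕ) := fun x => by
    simp [p, Polynomial.eval_finsetSum]
  have h1 : ∀ i < s, ∑ a, lam a ^ i * p.eval (lam a) = 0 := by
    intro i hi
    have h2 := congrFun hu ⟨i, hi⟩
    simp only [Matrix.mulVec, dotProduct, Matrix.of_apply, Finset.sum_mul, Pi.zero_apply] at h2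
    rw [Finset.sum_comm] at h2
    rw [← h2]
    refine Finset.sum_congr rfl fun a _ => ?_
    rw [hpe, Finset.mul_sum]
    refine Finset.sum_congr rfl fun j _ => ?_
    ring
  have h3 : ∀ r : Polynomial K, r.natDegree < s →
      ∑ a, r.eval (lam a) * p.eval (lam a) = 0 := by
    intro r hr
    simp only [Polynomial.eval_eq_sum_range' hr, Finset.sum_mul]
    rw [Finset.sum_comm]
    refine Finset.sum_eq_zero fun i hi => ?_
    simp only [mul_assoc]
    rw [← Finset.mul_sum, h1 i (Finset.mem_range.1 hi), mul_zero]
  have h4 : ∀ b ∈ Finset.univ.image lam, p.eval b = 0 := by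
    intro b hb
    let r : Polynomial K := ∏ b' ∈ (Finset.univ.image lam).erase b, (Polynomial.X - Polynomial.C b')
    have hr : r.natDegree < s := by
      rw [Polynomial.natDegree_finsetProd_X_sub_C_eq_card, Finset.card_erase_of_mem hb, ← hs]
      have : 0 < s := Finset.card_pos.2 ⟨b, hb⟩
      omega
    have hr0 : r.eval b ≠ 0 := by
      rw [Polynomial.eval_prod, Finset.prod_ne_zero_iff]
      intro b' hb'
      simpa [sub_eq_zero] using (Finset.ne_of_mem_erase hb').symm
    have h5 := h3 r hr
    have h6 : ∀ a, r.eval (lam a) * p.eval (lam a) =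
        if lam a = b then r.eval b * p.eval b else 0 := by
      intro a
      split_ifs with h
      · rw [h]
      · rw [Polynomial.eval_prod, Finset.prod_eq_zero (i := lam a), zero_mul]
        · exact Finset.mem_erase.2 ⟨h, Finset.mem_image_of_mem _ (Finset.mem_univ a)⟩
        · simp
    rw [Finset.sum_congr rfl fun a _ => h6 a, ← Finset.sum_filter, Finset.sum_const,
      nsmul_eq_mul] at h5
    obtain ⟨a, -, ha⟩ := Finset.mem_image.1 hb
    have h7 : ((Finset.univ.filter fun a => lam a = b).card : K) ≠ 0 := by
      rw [Nat.cast_ne_zero]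
      exact (Finset.card_pos.2 ⟨a, by simp [ha]⟩).ne'
    exact (mul_eq_zero.1 ((mul_eq_zero.1 h5).resolve_left h7)).resolve_left hr0
  have hp0 : p = 0 := Polynomial.eq_zero_of_degree_lt_of_eval_finset_eq_zero _ hpd h4
  apply hu0
  funext j
  have h8 : p.coeff j = u j := by
    simp only [p, Polynomial.finsetSum_coeff, Polynomial.coeff_C_mul, Polynomial.coeff_X_pow]
    rw [Finset.sum_eq_single j]
    · simp
    · intro i _ hi
      rw [if_neg (fun h => hi (Fin.ext h.symm)), mul_zero]
    · simp
  rw [← h8, hp0, Polynomial.coeff_zero, Pi.zero_apply]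

theorem rootMultiplicity_prod_X_sub_C (lam : Fin n → K) (t : K) :
    (∏ i, (Polynomial.X - Polynomial.C (lam i))).rootMultiplicity t =
      (Finset.univ.filter fun a => lam a = t).card := by
  rw [← Polynomial.count_roots, prod_X_sub_C_eq_multiset_prod,
    Polynomial.roots_multiset_prod_X_sub_C, Multiset.count_map]
  simp only [eq_comm]
  rfl

/-- The hypothesis makes t a root of multiplicity greater than r, so the other values come from at
most n - r - 1 indices. -/
theorem card_image_add_le_of_iterate_derivative [CharZero K] (lam : Fin n → K) (t : K) (r : ℕ)
    (h : ∀ i ≤ r, (Polynomial.derivative^[i]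
      (∏ i, (Polynomial.X - Polynomial.C (lam i)))).IsRoot t) :
    (Finset.univ.image lam).card + r ≤ n := by
  have h1 : r < (∏ i, (Polynomial.X - Polynomial.C (lam i))).rootMultiplicity t :=
    Polynomial.lt_rootMultiplicity_of_isRoot_iterate_derivative
      (Polynomial.monic_prod_of_monic _ _ fun b _ => Polynomial.monic_X_sub_C _).ne_zero h
  rw [rootMultiplicity_prod_X_sub_C] at h1
  have h2 : Finset.univ.image lam ⊆
      insert t ((Finset.univ.filter fun a => ¬ lam a = t).image lam) := by
    intro b hb
    obtain ⟨a, -, rfl⟩ := Finset.mem_image.1 hb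
    by_cases h : lam a = t
    · simp [h]
    · exact Finset.mem_insert_of_mem (Finset.mem_image_of_mem _ (by simp [h]))
  have h3 := (Finset.card_le_card h2).trans (Finset.card_insert_le _ _)
  have h4 := Finset.card_image_le (s := Finset.univ.filter fun a => ¬ lam a = t) (f := lam)
  have h5 := Finset.card_filter_add_card_filter_not (s := (Finset.univ : Finset (Fin n)))
    (fun a => lam a = t)
  rw [Finset.card_univ, Fintype.card_fin] at h5
  omega

end Hankel

section SymmetricFunctions

variable {R : Type*} [CommRing R] [Algebra ℂ R] (q : Polynomial R) (n : ℕ)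

/-- The elementary symmetric functions of the roots of a monic polynomial of degree `n`. -/
def esymmRoots (i : Fin n) : R := (-1) ^ (i.1 + 1) * q.coeff (n - (i.1 + 1))

/-- The power sums of the roots of a monic polynomial of degree `n`. -/
noncomputable def psumRoots (j : ℕ) : R :=
  MvPolynomial.aeval (esymmRoots q n)
    ((MvPolynomial.esymmAlgEquiv (Fin n) ℂ (Fintype.card_fin n)).symm
      ⟨MvPolynomial.psum (Fin n) ℂ j, MvPolynomial.psum_isSymmetric (Fin n) ℂ j⟩)

/-- The Hankel determinant of the power sums of the roots of a monic polynomial of degree `n`. -/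
noncomputable def hankelRoots (s : ℕ) : R :=
  (Matrix.of fun i j : Fin s => psumRoots q n (i.1 + j.1)).det

variable {q n} {K : Type*} [Field K] [Algebra ℂ K] {χ : R →ₐ[ℂ] K} {lam : Fin n → K}

theorem map_esymmRoots
    (h : q.map (χ : R →+* K) = ∏ i, (Polynomial.X - Polynomial.C (lam i))) (i : Fin n) :
    χ (esymmRoots q n i) = (Multiset.map lam Finset.univ.val).esymm (i.1 + 1) := by
  have hi := i.2
  have h1 : (q.map (χ : R →+* K)).coeff (n - (i.1 + 1)) =
      (-1) ^ (i.1 + 1) * (Multiset.map lam Finset.univ.val).esymm (i.1 + 1) := by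
    rw [h, prod_X_sub_C_eq_multiset_prod,
      Multiset.prod_X_sub_C_coeff _ (by simp)]
    simp only [Multiset.card_map, Finset.card_val, Finset.card_univ, Fintype.card_fin]
    rw [Nat.sub_sub_self (by omega)]
  rw [Polynomial.coeff_map] at h1
  change χ (q.coeff _) = _ at h1
  rw [esymmRoots, map_mul, map_pow, map_neg, map_one, h1, ← mul_assoc, ← mul_pow]
  simp

theorem map_psumRoots
    (h : q.map (χ : R →+* K) = ∏ i, (Polynomial.X - Polynomial.C (lam i))) (j : ℕ) :
    χ (psumRoots q n j) = ∑ a, lam a ^ j := by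
  set G := (MvPolynomial.esymmAlgEquiv (Fin n) ℂ (Fintype.card_fin n)).symm
      ⟨MvPolynomial.psum (Fin n) ℂ j, MvPolynomial.psum_isSymmetric (Fin n) ℂ j⟩ with hG
  have h1 : MvPolynomial.aeval (fun i : Fin n => MvPolynomial.esymm (Fin n) ℂ (i + 1)) G =
      MvPolynomial.psum (Fin n) ℂ j := by
    rw [← MvPolynomial.esymmAlgHom_apply,
      ← MvPolynomial.esymmAlgEquiv_apply _ _ (Fintype.card_fin n), hG, AlgEquiv.apply_symm_apply]
  have h2 : χ.comp (MvPolynomial.aeval (esymmRoots q n)) = (MvPolynomial.aeval lam).comp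
      (MvPolynomial.aeval (fun i : Fin n => MvPolynomial.esymm (Fin n) ℂ (i + 1))) := by
    ext i
    rw [AlgHom.comp_apply, AlgHom.comp_apply, MvPolynomial.aeval_X, MvPolynomial.aeval_X,
      MvPolynomial.aeval_esymm_eq_multiset_esymm, map_esymmRoots h]
  have h3 := DFunLike.congr_fun h2 G
  rw [AlgHom.comp_apply, AlgHom.comp_apply, h1] at h3
  rw [psumRoots, h3]
  simp [MvPolynomial.psum]

theorem map_hankelRoots
    (h : q.map (χ : R →+* K) = ∏ i, (Polynomial.X - Polynomial.C (lam i))) (s : ℕ) :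
    χ (hankelRoots q n s) = hankelDet lam s := by
  rw [hankelRoots, AlgHom.map_det, hankelDet]
  congr 1
  ext i j
  simp [map_psumRoots h]

omit [Algebra ℂ R] [Algebra ℂ K] in
theorem exists_map_eq_prod [IsAlgClosed K] (hq : q.Monic) (hn : q.natDegree = n) (φ : R →+* K) :
    ∃ lam : Fin n → K, q.map φ = ∏ i, (Polynomial.X - Polynomial.C (lam i)) := by
  have h1 : Multiset.card (q.map φ).roots = n := by
    rw [← (IsAlgClosed.splits (q.map φ)).natDegree_eq_card_roots, hq.natDegree_map, hn]
  obtain ⟨lam, hlam⟩ := exists_enum (⟨(q.map φ).roots, h1⟩ : Sym K n)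
  refine ⟨lam, ?_⟩
  have h2 := (IsAlgClosed.splits (q.map φ)).eq_prod_roots_of_monic (hq.map φ)
  change (q.map φ).roots = _ at hlam
  rw [h2, hlam, Multiset.map_map]
  rfl

end SymmetricFunctions

end SOData

/-! ### Zariski dimension and chains of primes -/

namespace SOData

open Module

section Dimension

variable {X : Type*} [AddCommGroup X] [Module ℂ X] {S : Set X}

/-- The topology induced by the Zariski topology on a subset. -/
@[reducible] def zariskiInduced (S : Set X) : TopologicalSpace S :=
  (zariskiTopology X).induced Subtype.val

theorem isOpen_zariskiInduced (f : polyFun X) :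
    @IsOpen S (zariskiInduced S) {z : S | evalAt z.1 f ≠ 0} := by
  let _ : TopologicalSpace X := zariskiTopology X
  exact ⟨{x | evalAt x f ≠ 0}, TopologicalSpace.GenerateOpen.basic _ ⟨f.1, f.2, rfl⟩, rfl⟩

theorem exists_basic_of_isOpen {U : Set S} (hU : @IsOpen S (zariskiInduced S) U) {z : S} (hz : z ∈ U) :
    ∃ f : polyFun X, evalAt z.1 f ≠ 0 ∧ ∀ y : S, evalAt y.1 f ≠ 0 → y ∈ U := by
  obtain ⟨V, hV, rfl⟩ := hU
  have key : ∀ x ∈ V, ∃ f : polyFun X, evalAt x f ≠ 0 ∧ ∀ y, evalAt y f ≠ 0 → y ∈ V := by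
    clear hz
    induction hV with
    | basic U hU =>
      obtain ⟨f, hf, rfl⟩ := hU
      exact fun x hx => ⟨⟨f, hf⟩, hx, fun y hy => hy⟩
    | univ => exact fun x _ => ⟨1, by simp, fun y _ => trivial⟩
    | inter U V _ _ hU hV =>
      rintro x ⟨h1, h2⟩
      obtain ⟨f, hf, hf'⟩ := hU x h1
      obtain ⟨g, hg, hg'⟩ := hV x h2
      refine ⟨f * g, by rw [map_mul]; exact mul_ne_zero hf hg, fun y hy => ?_⟩
      rw [map_mul] at hy
      exact ⟨hf' y (left_ne_zero_of_mul hy), hg' y (right_ne_zero_of_mul hy)⟩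
    | sUnion T _ ih =>
      rintro x ⟨U, hU, hx⟩
      obtain ⟨f, hf, hf'⟩ := ih U hU x hx
      exact ⟨f, hf, fun y hy => ⟨U, hU, hf' y hy⟩⟩
  obtain ⟨f, hf, hf'⟩ := key z.1 hz
  exact ⟨f, hf, fun y hy => hf' y.1 hy⟩

/-- The ideal of functions vanishing on a set of points. -/
def vanishing (T : Set S) : Ideal (polyFun X) := ⨅ z ∈ T, RingHom.ker (evalAt z.1)

theorem mem_vanishing {T : Set S} {f : polyFun X} : f ∈ vanishing T ↔ ∀ z ∈ T, evalAt z.1 f = 0 := by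
  simp [vanishing, Submodule.mem_iInf, RingHom.mem_ker]

theorem vanishing_anti {T T' : Set S} (h : T ⊆ T') : vanishing T' ≤ vanishing T := fun _ hf =>
  mem_vanishing.2 fun z hz => mem_vanishing.1 hf z (h hz)

theorem vanishing_isPrime {T : Set S} (hT : @IsIrreducible S (zariskiInduced S) T) :
    (vanishing T).IsPrime := by
  let _ := zariskiInduced S
  refine Ideal.isPrime_iff.2 ⟨?_, ?_⟩
  · obtain ⟨z, hz⟩ := hT.nonempty
    rw [Ideal.ne_top_iff_one]
    intro h
    simpa using mem_vanishing.1 h z hz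
  · intro f g hfg
    by_contra! h
    simp only [mem_vanishing, not_forall] at h
    obtain ⟨⟨z, hz, hzf⟩, ⟨y, hy, hyg⟩⟩ := h
    obtain ⟨x, hx, hxf, hxg⟩ := hT.2 _ _ (isOpen_zariskiInduced f) (isOpen_zariskiInduced g)
      ⟨z, hz, hzf⟩ ⟨y, hy, hyg⟩
    have h1 := mem_vanishing.1 hfg x hx
    rw [map_mul] at h1
    exact mul_ne_zero hxf hxg h1

theorem mem_closure_iff_vanishing {T : Set S} {z : S} :
    z ∈ @closure S (zariskiInduced S) T ↔ ∀ f ∈ vanishing T, evalAt z.1 f = 0 := by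
  let _ := zariskiInduced S
  rw [mem_closure_iff]
  constructor
  · intro h f hf
    by_contra hz
    obtain ⟨y, hy, hyT⟩ := h _ (isOpen_zariskiInduced f) hz
    exact hy (mem_vanishing.1 hf y hyT)
  · intro h U hU hz
    obtain ⟨f, hf, hfU⟩ := exists_basic_of_isOpen hU hz
    by_contra hne
    refine hf (h f (mem_vanishing.2 fun y hy => ?_))
    by_contra hy0
    exact hne ⟨y, hfU y hy0, hy⟩

/-- Sending an irreducible closed subset to its vanishing ideal reverses inclusions strictly and
lands among the primes containing I. -/
theorem zariskiDim_le {I : Ideal (polyFun X)} (h : ∀ f ∈ I, ∀ x ∈ S, evalAt x f = 0) :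
    zariskiDim S ≤ ringKrullDim (polyFun X ⧸ I) := by
  let _ := zariskiInduced S
  rw [ringKrullDim_quotient, ← Order.krullDim_orderDual]
  let F : TopologicalSpace.IrreducibleCloseds S → (PrimeSpectrum.zeroLocus (I : Set (polyFun X)))ᵒᵈ :=
    fun Z => OrderDual.toDual ⟨⟨vanishing Z.carrier, vanishing_isPrime Z.isIrreducible'⟩,
      fun f hf => mem_vanishing.2 fun z _ => h f hf z.1 z.2⟩
  refine Order.krullDim_le_of_strictMono F fun Z Z' hlt => ?_
  have h1 : Z.carrier ⊆ Z'.carrier := hlt.le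
  have h2 : vanishing Z'.carrier < vanishing Z.carrier := by
    refine lt_of_le_of_ne (vanishing_anti h1) fun heq => hlt.not_ge ?_
    intro z hz
    have h3 := mem_closure_iff_vanishing.2 fun f hf => mem_vanishing.1 (heq ▸ hf) z hz
    rwa [Z.isClosed'.closure_eq] at h3
  exact h2

variable [FiniteDimensional ℂ X]

theorem exists_point_of_notMem {P : Ideal (polyFun X)} (hP : P.IsPrime) {f : polyFun X}
    (hf : f ∉ P) : ∃ x : X, (∀ g ∈ P, evalAt x g = 0) ∧ evalAt x f ≠ 0 := by
  let b := finBasis ℂ X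
  let E := polyFunEquiv b
  have hP' : (P.comap E.toRingEquiv).IsPrime := Ideal.comap_isPrime _ _
  have h1 : E.symm f ∉ MvPolynomial.vanishingIdeal ℂ (MvPolynomial.zeroLocus ℂ (P.comap E.toRingEquiv)) := by
    rw [MvPolynomial.vanishingIdeal_zeroLocus_eq_radical, hP'.radical, Ideal.mem_comap]
    change E (E.symm f) ∉ P
    rwa [E.apply_symm_apply]
  simp only [MvPolynomial.mem_vanishingIdeal_iff, not_forall] at h1
  obtain ⟨v, hv, hvf⟩ := h1
  have h2 : (b.repr (b.equivFun.symm v) : _ → ℂ) = v := b.equivFun.apply_symm_apply v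
  have h3 : ∀ g, evalAt (b.equivFun.symm v) g = MvPolynomial.aeval v (E.symm g) := by
    intro g
    rw [← E.apply_symm_apply g, evalAt_polyFunEquiv, E.apply_symm_apply, h2]
    rfl
  refine ⟨b.equivFun.symm v, fun g hg => ?_, ?_⟩
  · rw [h3]
    refine hv _ ?_
    change E (E.symm g) ∈ P
    rwa [E.apply_symm_apply]
  · rwa [h3]

/-- For each prime of the chain, its zeros with D ≠ 0 lie in S. Since D is outside the prime, the
Nullstellensatz shows that these points still have that prime as vanishing ideal and form an
irreducible set. Their closures in S form a chain of the same length. -/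
theorem le_zariskiDim (p : LTSeries (PrimeSpectrum (polyFun X))) (D : polyFun X)
    (hD : D ∉ p.last.asIdeal)
    (hS : ∀ x, (∀ f ∈ p.head.asIdeal, evalAt x f = 0) → evalAt x D ≠ 0 → x ∈ S) :
    (p.length : WithBot ℕ∞) ≤ zariskiDim S := by
  let _ := zariskiInduced S
  let T : Fin (p.length + 1) → Set S := fun i =>
    {z | (∀ f ∈ (p i).asIdeal, evalAt z.1 f = 0) ∧ evalAt z.1 D ≠ 0}
  have hT : ∀ i, ∀ f ∉ (p i).asIdeal, ∃ z ∈ T i, evalAt z.1 f ≠ 0 := by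
    intro i f hf
    have hDi : D ∉ (p i).asIdeal := fun h => hD (p.monotone (Fin.le_last i) h)
    obtain ⟨x, hx, hxf⟩ := exists_point_of_notMem (p i).isPrime
      (fun h => ((p i).isPrime.mem_or_mem h).elim hf hDi)
    rw [map_mul] at hxf
    have hxD := right_ne_zero_of_mul hxf
    exact ⟨⟨x, hS x (fun g hg => hx g (p.monotone (Fin.zero_le i) hg)) hxD⟩, ⟨hx, hxD⟩,
      left_ne_zero_of_mul hxf⟩
  have hvan : ∀ i, vanishing (T i) = (p i).asIdeal := by
    intro i
    refine le_antisymm (fun f hf => ?_) fun f hf => mem_vanishing.2 fun z hz => hz.1 f hf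
    by_contra h
    obtain ⟨z, hz, hzf⟩ := hT i f h
    exact hzf (mem_vanishing.1 hf z hz)
  have hirr : ∀ i, IsIrreducible (T i) := by
    intro i
    refine ⟨?_, ?_⟩
    · obtain ⟨z, hz, -⟩ := hT i 1 ((Ideal.ne_top_iff_one _).1 (p i).isPrime.ne_top)
      exact ⟨z, hz⟩
    · rintro U V hU hV ⟨y, hy, hyU⟩ ⟨z, hz, hzV⟩
      obtain ⟨f, hf, hfU⟩ := exists_basic_of_isOpen hU hyU
      obtain ⟨g, hg, hgV⟩ := exists_basic_of_isOpen hV hzV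
      obtain ⟨x, hx, hxfg⟩ := hT i (f * g) (fun h => ((p i).isPrime.mem_or_mem h).elim
        (fun h => hf (hy.1 f h)) (fun h => hg (hz.1 g h)))
      rw [map_mul] at hxfg
      exact ⟨x, hx, hfU x (left_ne_zero_of_mul hxfg), hgV x (right_ne_zero_of_mul hxfg)⟩
  let Z : Fin (p.length + 1) → TopologicalSpace.IrreducibleCloseds S := fun i =>
    ⟨closure (T i.rev), (hirr _).closure, isClosed_closure⟩
  have hZ : StrictMono Z := by
    intro i j hij
    have h1 : p j.rev < p i.rev := p.strictMono (Fin.rev_lt_rev.2 hij)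
    have h2 : closure (T i.rev) ⊆ closure (T j.rev) := fun z hz =>
      mem_closure_iff_vanishing.2 fun f hf =>
        mem_closure_iff_vanishing.1 hz f (by rw [hvan] at hf ⊢; exact h1.le hf)
    refine lt_of_le_of_ne h2 fun heq => ?_
    obtain ⟨f, hf, hfn⟩ := Set.exists_of_ssubset (show (p j.rev).asIdeal < (p i.rev).asIdeal from h1)
    obtain ⟨z, hz, hzf⟩ := hT j.rev f hfn
    have h3 : closure (T i.rev) = closure (T j.rev) :=
      congrArg TopologicalSpace.IrreducibleCloseds.carrier heq
    have h4 : z ∈ closure (T i.rev) := h3 ▸ subset_closure hz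
    exact hzf (mem_closure_iff_vanishing.1 h4 f (by rw [hvan]; exact hf))
  exact Order.LTSeries.length_le_krullDim (LTSeries.mk p.length Z hZ)

end Dimension

end SOData

/-! ### Lower bounds for dimensions from Krull's height theorem -/

namespace SOData

open Module

section Chains

/-- Dividing by the f j lowers the height of P by at most their number; a maximal chain below P in
the quotient is then pulled back. -/
theorem exists_ltSeries_above {A : Type*} [CommRing A] [IsNoetherianRing A] (P : Ideal A)
    [P.IsPrime] {κ : Type*} [Fintype κ] (f : κ → A) (hf : ∀ j, f j ∈ P) :
    ∃ p : LTSeries (PrimeSpectrum A), (∀ j, f j ∈ p.head.asIdeal) ∧ p.last.asIdeal = P ∧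
      P.height ≤ (p.length + Fintype.card κ : ℕ) := by
  set I := Ideal.span (Set.range f)
  have hIP : I ≤ P := Ideal.span_le.2 (by rintro _ ⟨j, rfl⟩; exact hf j)
  have h1 := Ideal.height_le_height_add_encard_of_subset (Set.range f) (p := P)
    (by rintro _ ⟨j, rfl⟩; exact hf j)
  have hprime : (P.map (Ideal.Quotient.mk I)).IsPrime :=
    Ideal.map_isPrime_of_surjective Ideal.Quotient.mk_surjective (by rwa [Ideal.mk_ker])
  have hcm : (P.map (Ideal.Quotient.mk I)).comap (Ideal.Quotient.mk I) = P := by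
    rw [Ideal.comap_map_of_surjective _ Ideal.Quotient.mk_surjective, ← RingHom.ker_eq_comap_bot,
      Ideal.mk_ker, sup_eq_left.2 hIP]
  obtain ⟨p, hp, hlen⟩ := (P.map (Ideal.Quotient.mk I)).exists_ltSeries_length_eq_height
  let F : PrimeSpectrum (A ⧸ I) → PrimeSpectrum A := PrimeSpectrum.comap (Ideal.Quotient.mk I)
  have hF : StrictMono F := by
    intro x y hxy
    refine lt_of_le_of_ne (Ideal.comap_mono hxy.le : _ ≤ _) fun h => hxy.ne ?_
    exact PrimeSpectrum.comap_injective_of_surjective _ Ideal.Quotient.mk_surjective h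
  refine ⟨p.map F hF, fun j => ?_, ?_, ?_⟩
  · rw [LTSeries.head_map]
    change Ideal.Quotient.mk I (f j) ∈ p.head.asIdeal
    rw [Ideal.Quotient.eq_zero_iff_mem.2 (Ideal.subset_span (Set.mem_range_self j))]
    exact zero_mem _
  · rw [LTSeries.last_map]
    change p.last.asIdeal.comap (Ideal.Quotient.mk I) = P
    rw [hp, hcm]
  · refine h1.trans ?_
    change (P.map (Ideal.Quotient.mk I)).height + _ ≤ _
    rw [← hlen]
    push_cast
    refine add_le_add le_rfl ?_
    rw [← Set.image_univ]
    refine (Set.encard_image_le f Set.univ).trans ?_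
    rw [Set.encard_univ, ENat.card_eq_coe_fintype_card]

/-- A[X]/(q) is integral over A, so comparable distinct primes containing q have distinct
contractions. -/
theorem comap_C_lt_comap_C {A : Type*} [CommRing A] {q : Polynomial A} (hq : q.Monic)
    {I J : Ideal (Polynomial A)} [I.IsPrime] (hIJ : I < J) (hqI : q ∈ I) :
    I.comap Polynomial.C < J.comap Polynomial.C := by
  obtain ⟨x, hxJ, hxI⟩ := Set.exists_of_ssubset hIJ
  have := hq.finite_adjoinRoot
  obtain ⟨P, hP, hPx⟩ := Algebra.IsIntegral.isIntegral (R := A) (AdjoinRoot.mk q x)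
  have hnt : Nontrivial (A ⧸ I.comap Polynomial.C) :=
    Ideal.Quotient.nontrivial_iff.2 (Ideal.IsPrime.ne_top (I := I.comap Polynomial.C) inferInstance)
  refine Ideal.comap_lt_comap_of_root_mem_sdiff hIJ.le ⟨hxJ, hxI⟩ (p := P) (hP.map _).ne_zero ?_
  have h1 : AdjoinRoot.mk q (P.eval₂ Polynomial.C x) = 0 := by
    rw [Polynomial.hom_eval₂]
    exact hPx
  exact I.mem_of_dvd (AdjoinRoot.mk_eq_zero.1 h1) hqI

/-- The locus where q has a root of multiplicity greater than r is the image of the common zeros of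
q and its first r derivatives in A[X]. These are r + 1 equations in a ring whose relevant prime has
height one more, and contraction along the finite projection keeps the chain strict. The net loss is
r. -/
theorem exists_ltSeries_polynomial {A L : Type*} [CommRing A] [IsNoetherianRing A] [Field L]
    {φ : A →+* L} (hφ : Function.Surjective φ) {κ : Type*} [Fintype κ] (f : κ → A)
    (hf : ∀ j, φ (f j) = 0) {q : Polynomial A} (hq : q.Monic) (t : L) (r : ℕ)
    (ht : ∀ i ≤ r, (Polynomial.derivative^[i] q).eval₂ φ t = 0) :
    ∃ (p : LTSeries (PrimeSpectrum A)) (Q : PrimeSpectrum (Polynomial A)),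
      (∀ j, f j ∈ p.head.asIdeal) ∧ p.last.asIdeal = RingHom.ker φ ∧
      (RingHom.ker φ).height ≤ (p.length + Fintype.card κ + r : ℕ) ∧
      p.head.asIdeal = Q.asIdeal.comap Polynomial.C ∧
      ∀ i ≤ r, Polynomial.derivative^[i] q ∈ Q.asIdeal := by
  let ev : Polynomial A →+* L := Polynomial.eval₂RingHom φ t
  have hevC : ∀ a, ev (Polynomial.C a) = φ a := fun a => Polynomial.eval₂_C _ _
  have hM : (RingHom.ker ev).IsMaximal :=
    RingHom.ker_isMaximal_of_surjective _ fun c => by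
      obtain ⟨a, rfl⟩ := hφ c
      exact ⟨Polynomial.C a, hevC a⟩
  have hMp := hM.isPrime
  have hcomap : (RingHom.ker ev).comap Polynomial.C = RingHom.ker φ := by
    ext a
    rw [Ideal.mem_comap, RingHom.mem_ker, hevC, RingHom.mem_ker]
  have hlo : (RingHom.ker ev).LiesOver (RingHom.ker φ) := ⟨hcomap.symm⟩
  have hheight : (RingHom.ker ev).height = (RingHom.ker φ).height + 1 :=
    Polynomial.height_eq_height_add_one (RingHom.ker φ) (RingHom.ker ev)
  obtain ⟨P, hP, hlast, hlen⟩ := exists_ltSeries_above (RingHom.ker ev)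
    (Sum.elim (fun j => Polynomial.C (f j)) fun i : Fin (r + 1) => Polynomial.derivative^[i.1] q)
    (by
      rintro (j | i)
      · rw [Sum.elim_inl, RingHom.mem_ker, hevC, hf]
      · exact ht i.1 (by omega))
  have hd : ∀ i ≤ r, Polynomial.derivative^[i] q ∈ P.head.asIdeal := fun i hi =>
    hP (.inr ⟨i, by omega⟩)
  have hqP : ∀ i, q ∈ (P i).asIdeal := fun i =>
    P.monotone (Fin.zero_le i) (hd 0 (Nat.zero_le _))
  let p : LTSeries (PrimeSpectrum A) :=
    LTSeries.mk P.length (fun i => PrimeSpectrum.comap Polynomial.C (P i)) fun i j hij =>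
      comap_C_lt_comap_C hq (P.strictMono hij) (hqP i)
  refine ⟨p, P.head, fun j => hP (.inl j), ?_, ?_, rfl, hd⟩
  · change P.last.asIdeal.comap Polynomial.C = _
    rw [hlast, hcomap]
  · rw [hheight, Fintype.card_sum, Fintype.card_fin] at hlen
    change _ ≤ ((P.length + Fintype.card κ + r : ℕ) : ℕ∞)
    have h1 : (RingHom.ker φ).height + 1 ≤ ((P.length + Fintype.card κ + r : ℕ) : ℕ∞) + 1 := by
      refine hlen.trans (le_of_eq ?_)
      push_cast
      ring
    exact (ENat.add_le_add_iff_right (by simp)).1 h1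

variable {X : Type*} [AddCommGroup X] [Module ℂ X] [FiniteDimensional ℂ X]

instance : IsNoetherianRing (polyFun X) :=
  isNoetherianRing_of_ringEquiv _ (polyFunEquiv (finBasis ℂ X)).toRingEquiv

omit [FiniteDimensional ℂ X] in
theorem ker_evalAt_isMaximal (x : X) : (RingHom.ker (evalAt x)).IsMaximal :=
  RingHom.ker_isMaximal_of_surjective _ fun c => ⟨algebraMap ℂ _ c, by simp⟩

theorem height_ker_evalAt (x : X) : (RingHom.ker (evalAt x)).height = finrank ℂ X := by
  let b := finBasis ℂ X
  rw [← RingEquiv.height_comap (polyFunEquiv b).toRingEquiv]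
  have h1 : (RingHom.ker (evalAt x)).comap (polyFunEquiv b).toRingEquiv =
      RingHom.ker (MvPolynomial.aeval (b.repr x) : MvPolynomial _ ℂ →ₐ[ℂ] ℂ) := by
    ext F
    rw [Ideal.mem_comap, RingHom.mem_ker, RingHom.mem_ker]
    change evalAt x (polyFunEquiv b F) = 0 ↔ _
    rw [evalAt_polyFunEquiv]
    rfl
  rw [h1, height_ker_aeval, Nat.card_eq_fintype_card, Fintype.card_fin]

theorem exists_ltSeries_at_point {κ : Type*} [Fintype κ] (f : κ → polyFun X) (x : X)
    (hf : ∀ j, evalAt x (f j) = 0) :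
    ∃ p : LTSeries (PrimeSpectrum (polyFun X)), (∀ j, f j ∈ p.head.asIdeal) ∧
      p.last.asIdeal = RingHom.ker (evalAt x) ∧ finrank ℂ X ≤ p.length + Fintype.card κ := by
  have := (ker_evalAt_isMaximal x).isPrime
  obtain ⟨p, hp, hl, hh⟩ := exists_ltSeries_above (RingHom.ker (evalAt x)) f hf
  refine ⟨p, hp, hl, ?_⟩
  rw [height_ker_evalAt] at hh
  exact_mod_cast hh

end Chains

end SOData

/-! ### Generic matrices and the uniform dimension bound -/

namespace SOData

open Module

section Generic

variable {X : Type*} [AddCommGroup X] [Module ℂ X] {p q : Type*}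

/-- The matrix of polynomial functions defined by a linear map to matrices. -/
def genericMatrix (L : X →ₗ[ℂ] Matrix p q ℂ) : Matrix p q (polyFun X) :=
  Matrix.of fun i j => linFun ((LinearMap.proj j ∘ₗ LinearMap.proj i) ∘ₗ L)

theorem genericMatrix_map (L : X →ₗ[ℂ] Matrix p q ℂ) (x : X) :
    (genericMatrix L).map (evalAt x) = L x := rfl

theorem matrix_polyFun_ext {A B : Matrix p q (polyFun X)}
    (h : ∀ x, A.map (evalAt x) = B.map (evalAt x)) : A = B :=
  Matrix.ext fun i j => polyFun_ext fun x => congrFun (congrFun (h x) i) j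

end Generic

/-- A linear family of matrix data, parametrized by a vector space `X`, over the data
`(B₁, B₂, I)` with `B₁, B₂` selfadjoint for an alternating form with matrix `J`. -/
structure MatrixDatum (X : Type*) [AddCommGroup X] [Module ℂ X] (m w : Type*) [Fintype m]
    [DecidableEq m] [Fintype w] where
  (J J₁ : Matrix m m ℂ)
  (B₁ B₂ : X →ₗ[ℂ] Matrix m m ℂ)
  (I : X →ₗ[ℂ] Matrix m w ℂ)
  transpose_J : J.transpose = -J
  J_mul : J * J₁ = 1
  B₁_mem : ∀ x, B₁ x ∈ selfAdj J
  B₂_mem : ∀ x, B₂ x ∈ selfAdj J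
  eq_zero : ∀ x, B₁ x = 0 → B₂ x = 0 → I x = 0 → x = 0
  exists_eq : ∀ B ∈ selfAdj J, ∃ x, B₁ x = B ∧ B₂ x = 0 ∧ I x = 0
  finrank_eq : finrank ℂ X = 2 * finrank ℂ (selfAdj J) + Fintype.card m * Fintype.card w

namespace MatrixDatum

variable {X : Type*} [AddCommGroup X] [Module ℂ X] {m w : Type*} [Fintype m]
  [DecidableEq m] [Fintype w] (D : MatrixDatum X m w)

/-- Half of the dimension of the symplectic space. -/
def n (_ : MatrixDatum X m w) : ℕ := Fintype.card m / 2

theorem two_mul_n : 2 * D.n = Fintype.card m := by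
  obtain ⟨p, -, hp, -⟩ := exists_charpoly_eq_sq D.transpose_J D.J_mul
    (zero_mem (selfAdj D.J))
  rw [n]
  omega

/-- The matrix of the moment map. -/
noncomputable def momentMatrix (x : X) : Matrix m m ℂ :=
  D.B₁ x * D.B₂ x - D.B₂ x * D.B₁ x + D.I x * (D.I x).transpose * D.J

/-- The matrix of the moment map, as a matrix of polynomial functions. -/
noncomputable def genericMoment : Matrix m m (polyFun X) :=
  genericMatrix D.B₁ * genericMatrix D.B₂ - genericMatrix D.B₂ * genericMatrix D.B₁ +
    genericMatrix D.I * (genericMatrix D.I).transpose * D.J.map (algebraMap ℂ (polyFun X))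

theorem map_algHom_map_algebraMap {A B p q : Type*} [CommRing A] [Algebra ℂ A] [CommRing B]
    [Algebra ℂ B] (χ : A →ₐ[ℂ] B) (M : Matrix p q ℂ) :
    (M.map (algebraMap ℂ A)).map χ = M.map (algebraMap ℂ B) := by
  ext i j
  exact χ.commutes _

theorem map_genericMoment {K : Type*} [CommRing K] [Algebra ℂ K] (χ : polyFun X →ₐ[ℂ] K) :
    D.genericMoment.map χ =
      (genericMatrix D.B₁).map χ * (genericMatrix D.B₂).map χ -
        (genericMatrix D.B₂).map χ * (genericMatrix D.B₁).map χ +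
      (genericMatrix D.I).map χ * ((genericMatrix D.I).map χ).transpose *
        D.J.map (algebraMap ℂ K) := by
  rw [genericMoment, Matrix.map_add _ (map_add χ), Matrix.map_sub _ (map_sub χ), Matrix.map_mul,
    Matrix.map_mul, Matrix.map_mul, Matrix.map_mul, Matrix.transpose_map,
    map_algHom_map_algebraMap]

theorem evalAt_genericMoment (x : X) : D.genericMoment.map (evalAt x) = D.momentMatrix x := by
  rw [map_genericMoment, genericMatrix_map, genericMatrix_map, genericMatrix_map, momentMatrix]
  congr 1

theorem genericMatrix_mem {L : X →ₗ[ℂ] Matrix m m ℂ} (hL : ∀ x, L x ∈ selfAdj D.J) {K : Type*}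
    [Field K] [Algebra ℂ K] (χ : polyFun X →ₐ[ℂ] K) :
    (genericMatrix L).map χ ∈ selfAdj (D.J.map (algebraMap ℂ K)) := by
  have h : (genericMatrix L).transpose * D.J.map (algebraMap ℂ (polyFun X)) =
      D.J.map (algebraMap ℂ (polyFun X)) * genericMatrix L := by
    refine matrix_polyFun_ext fun x => ?_
    rw [Matrix.map_mul, Matrix.map_mul, Matrix.transpose_map, genericMatrix_map,
      map_algHom_map_algebraMap]
    simpa using mem_selfAdj.1 (hL x)
  have h1 := congrArg (fun M : Matrix m m (polyFun X) => M.map χ) h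
  simp only [Matrix.map_mul, Matrix.transpose_map, map_algHom_map_algebraMap] at h1
  exact mem_selfAdj.2 h1

/-- A candidate q is computed over the ring of functions. At each point it must specialize to the
square root supplied by the normal form, by uniqueness, so the remainder vanishes at all points. -/
theorem exists_sqrt : ∃ q : Polynomial (polyFun X), q.Monic ∧ q.natDegree = D.n ∧
    (genericMatrix D.B₁).charpoly = q ^ 2 := by
  have h2 : IsUnit (2 : polyFun X) := by
    have : IsUnit (algebraMap ℂ (polyFun X) 2) := (isUnit_iff_ne_zero.2 two_ne_zero).map _
    rwa [map_ofNat] at this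
  have hnt : Nontrivial (polyFun X) := (evalAt (0 : X)).toRingHom.domain_nontrivial
  have hf := (genericMatrix D.B₁).charpoly_monic
  obtain ⟨q, hq, hqn, hlt⟩ := exists_monic_sq_sub_degree_lt h2 hf (n := D.n)
    (by rw [Matrix.charpoly_natDegree_eq_dim, two_mul_n])
  refine ⟨q, hq, hqn, sub_eq_zero.1 (Polynomial.ext fun i => polyFun_ext fun x => ?_)⟩
  obtain ⟨p, hp, hpn, hpB⟩ := exists_charpoly_eq_sq D.transpose_J D.J_mul (D.B₁_mem x)
  have hc : (genericMatrix D.B₁).charpoly.map (evalAt x : polyFun X →+* ℂ) = p ^ 2 := by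
    rw [← Matrix.charpoly_map, ← hpB]
    rfl
  have hqp : p = q.map (evalAt x : polyFun X →+* ℂ) := by
    refine eq_of_degree_sq_sub_sq_lt (n := D.n) hp (hq.map _) ?_ ?_ ?_
    · have := D.two_mul_n; omega
    · rw [hq.natDegree_map, hqn]
    · rw [← hc, ← Polynomial.map_pow, ← Polynomial.map_sub]
      exact Polynomial.degree_map_le.trans_lt hlt
  have h3 : ((genericMatrix D.B₁).charpoly - q ^ 2).map (evalAt x : polyFun X →+* ℂ) = 0 := by
    rw [Polynomial.map_sub, Polynomial.map_pow, hc, hqp, sub_self]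
  have h4 := congrArg (fun r => Polynomial.coeff r i) h3
  rw [Polynomial.coeff_map, Polynomial.coeff_zero] at h4
  exact h4

/-- The monic square root of the generic characteristic polynomial of `B₁`. -/
noncomputable def sqrtCharpoly : Polynomial (polyFun X) := D.exists_sqrt.choose

theorem sqrtCharpoly_monic : D.sqrtCharpoly.Monic := D.exists_sqrt.choose_spec.1

theorem natDegree_sqrtCharpoly : D.sqrtCharpoly.natDegree = D.n := D.exists_sqrt.choose_spec.2.1

theorem sqrtCharpoly_sq : (genericMatrix D.B₁).charpoly = D.sqrtCharpoly ^ 2 :=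
  D.exists_sqrt.choose_spec.2.2

theorem charpoly_map_genericMatrix {K : Type*} [Field K] [Algebra ℂ K] (χ : polyFun X →ₐ[ℂ] K) :
    ((genericMatrix D.B₁).map χ).charpoly = D.sqrtCharpoly.map (χ : polyFun X →+* K) ^ 2 := by
  rw [← Polynomial.map_pow, ← sqrtCharpoly_sq, ← Matrix.charpoly_map]
  rfl

theorem charpoly_B₁ (x : X) :
    (D.B₁ x).charpoly = D.sqrtCharpoly.map (evalAt x : polyFun X →+* ℂ) ^ 2 :=
  D.charpoly_map_genericMatrix (evalAt x)

theorem eq_map_sqrtCharpoly {x : X} {p : Polynomial ℂ} (hp : p.Monic)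
    (h : (D.B₁ x).charpoly = p ^ 2) : p = D.sqrtCharpoly.map (evalAt x : polyFun X →+* ℂ) := by
  have h1 : 2 * p.natDegree = Fintype.card m := by
    rw [← (D.B₁ x).charpoly_natDegree_eq_dim, h, hp.natDegree_pow]
  refine eq_of_degree_sq_sub_sq_lt (n := D.n) hp (D.sqrtCharpoly_monic.map _) ?_ ?_ ?_
  · have := D.two_mul_n; omega
  · rw [D.sqrtCharpoly_monic.natDegree_map, natDegree_sqrtCharpoly]
  · rw [← h, charpoly_B₁, sub_self, Polynomial.degree_zero]
    exact WithBot.bot_lt_coe _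

theorem map_sqrtCharpoly_smul (x : X) :
    D.sqrtCharpoly.map (evalAt ((2 : ℂ) • x) : polyFun X →+* ℂ) =
      (D.sqrtCharpoly.map (evalAt x : polyFun X →+* ℂ)).scaleRoots 2 := by
  refine (D.eq_map_sqrtCharpoly ?_ ?_).symm
  · rw [Polynomial.Monic, Polynomial.leadingCoeff_scaleRoots]
    exact D.sqrtCharpoly_monic.map _
  · rw [map_smul, charpoly_smul _ two_ne_zero, charpoly_B₁, sq, sq,
      Polynomial.mul_scaleRoots_of_noZeroDivisors]

/-- Doubling x doubles the eigenvalues, so the elementary symmetric function of index i + 1 has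
weight i + 1. -/
theorem evalAt_smul_esymmRoots (x : X) (i : Fin D.n) :
    evalAt ((2 : ℂ) • x) (esymmRoots D.sqrtCharpoly D.n i) =
      2 ^ (i.1 + 1) * evalAt x (esymmRoots D.sqrtCharpoly D.n i) := by
  have h := congrArg (fun r => Polynomial.coeff r (D.n - (i.1 + 1))) (D.map_sqrtCharpoly_smul x)
  simp only [Polynomial.coeff_scaleRoots, Polynomial.coeff_map, D.sqrtCharpoly_monic.natDegree_map,
    natDegree_sqrtCharpoly] at h
  rw [Nat.sub_sub_self (by omega)] at h
  simp only [esymmRoots, map_mul, map_pow, map_neg, map_one]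
  change evalAt ((2 : ℂ) • x) _ = evalAt x _ * _ at h
  rw [h]
  ring

/-- The entries of the generic data. -/
def entry : (m × m) ⊕ (m × m) ⊕ (m × w) → polyFun X :=
  Sum.elim (fun a => genericMatrix D.B₁ a.1 a.2)
    (Sum.elim (fun a => genericMatrix D.B₂ a.1 a.2) fun a => genericMatrix D.I a.1 a.2)

theorem range_comp_entry {K : Type*} (χ : polyFun X → K) :
    Set.range (χ ∘ D.entry) = matrixEntries ((genericMatrix D.B₁).map χ) ∪
      matrixEntries ((genericMatrix D.I).map χ) ∪ matrixEntries ((genericMatrix D.B₂).map χ) := by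
  rw [Set.union_assoc, Set.union_comm (matrixEntries ((genericMatrix D.I).map χ))]
  simp only [entry, Sum.comp_elim, Set.Sum.elim_range]
  rfl

theorem adjoin_range_entry [FiniteDimensional ℂ X] :
    Algebra.adjoin ℂ (Set.range D.entry) = ⊤ := by
  let l : (m × m) ⊕ (m × m) ⊕ (m × w) → Dual ℂ X :=
    Sum.elim (fun a => (LinearMap.proj a.2 ∘ₗ LinearMap.proj a.1) ∘ₗ D.B₁)
      (Sum.elim (fun a => (LinearMap.proj a.2 ∘ₗ LinearMap.proj a.1) ∘ₗ D.B₂)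
        fun a => (LinearMap.proj a.2 ∘ₗ LinearMap.proj a.1) ∘ₗ D.I)
  have hl : D.entry = fun a => linFun (l a) := by
    funext a
    rcases a with a | a | a <;> rfl
  rw [hl]
  refine adjoin_range_linFun l ?_
  by_contra hne
  obtain ⟨f, hf0, hf⟩ := Submodule.exists_le_ker_of_lt_top _ (lt_top_iff_ne_top.2 hne)
  obtain ⟨x, rfl⟩ := (evalEquiv ℂ X).surjective f
  have hx : ∀ a, l a x = 0 := fun a => hf (Submodule.subset_span ⟨a, rfl⟩)
  refine hf0 ?_
  rw [D.eq_zero x (Matrix.ext fun i j => hx (.inl (i, j)))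
    (Matrix.ext fun i j => hx (.inr (.inl (i, j)))) (Matrix.ext fun i j => hx (.inr (.inr (i, j)))),
    map_zero]

/-- With m = 2n these three identities say that dim 𝔭 + n(2N - 3) falls short of dim X by exactly
dim 𝔤 + n. -/
theorem finrank_add (hw : 4 ≤ Fintype.card w) :
    finrank ℂ X + 2 * D.n = 4 * D.n * D.n + 2 * D.n * Fintype.card w ∧
      (Fintype.card m + 1).choose 2 = 2 * D.n * D.n + D.n ∧
      Fintype.card m * Fintype.card m + Fintype.card m / 2 * (2 * Fintype.card w - 3) +
        3 * D.n = 4 * D.n * D.n + 2 * D.n * Fintype.card w := by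
  have h1 := finrank_selfAdj_add two_ne_zero D.transpose_J D.J_mul
  rw [finrank_skewAdj D.transpose_J D.J_mul] at h1
  have h2 := D.finrank_eq
  rw [← D.two_mul_n] at h1 h2 ⊢
  have h3 : (2 * D.n + 1).choose 2 = 2 * D.n * D.n + D.n := by
    rw [Nat.choose_two_right, Nat.add_sub_cancel,
      show (2 * D.n + 1) * (2 * D.n) = (2 * D.n * D.n + D.n) * 2 by ring, Nat.mul_div_cancel _ two_pos]
  rw [h3] at h1
  obtain ⟨c, hc⟩ := Nat.exists_eq_add_of_le hw
  rw [hc] at h2 ⊢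
  refine ⟨by nlinarith, h3, ?_⟩
  rw [Nat.mul_div_cancel_left _ two_pos, show 2 * (4 + c) - 3 = 2 * c + 5 by omega]
  ring

/-- The bound for the transcendence degree of a point of the zero fibre of the moment map. -/
theorem trRank_range_entry_le (hw : 4 ≤ Fintype.card w) {K : Type*} [Field K] [Algebra ℂ K]
    [DecidableEq K] (χ : polyFun X →ₐ[ℂ] K) (hχ : ∀ i j, χ (D.genericMoment i j) = 0)
    {lam : Fin D.n → K}
    (hlam : D.sqrtCharpoly.map (χ : polyFun X →+* K) =
      ∏ i, (Polynomial.X - Polynomial.C (lam i)))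
    (S : Finset K) (hS : ∀ i, lam i ∈ algCl ℂ (S : Set K)) :
    trRank ℂ (Set.range (χ ∘ D.entry)) + ((Fintype.card m + 1).choose 2 + D.n : ℕ) ≤
      (S.card + finrank ℂ X : ℕ) := by
  -- Over L the eigenvalues are constants and the characteristic polynomial splits; returning to ℂ
  -- costs at most the number of elements of S.
  let L := algCl ℂ (S : Set K)
  have hmom : D.genericMoment.map χ = 0 := Matrix.ext hχ
  rw [map_genericMoment] at hmom
  let p : Polynomial L := (∏ i, (Polynomial.X - Polynomial.C (⟨lam i, hS i⟩ : L))) ^ 2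
  have hpm : p.Monic := (Polynomial.monic_prod_of_monic _ _ fun i _ =>
    Polynomial.monic_X_sub_C _).pow 2
  have hpmap : p.map (algebraMap L K) = ((genericMatrix D.B₁).map χ).charpoly := by
    rw [charpoly_map_genericMatrix, hlam, Polynomial.map_pow, Polynomial.map_prod]
    simp
  have h1 := trRank_datum_le (k := L) hw (J := D.J.map (algebraMap ℂ L))
    (J₁ := D.J₁.map (algebraMap ℂ L)) (B₁ := (genericMatrix D.B₁).map χ)
    (B₂ := (genericMatrix D.B₂).map χ) (I := (genericMatrix D.I).map χ) (p := p)
    (by rw [← Matrix.transpose_map, D.transpose_J]; ext; simp)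
    (by rw [← Matrix.map_mul, D.J_mul, Matrix.map_one _ (map_zero _) (map_one _)])
    (by rw [map_algebraMap_tower]; exact D.genericMatrix_mem D.B₁_mem χ)
    (by rw [map_algebraMap_tower]; exact D.genericMatrix_mem D.B₂_mem χ)
    (by rw [map_algebraMap_tower]; exact hmom)
    hpm.ne_zero
    ((Polynomial.Splits.prod fun i _ => Polynomial.Splits.X_sub_C _).pow 2)
    (by rw [← Polynomial.aeval_map_algebraMap K, hpmap]; exact Matrix.aeval_self_charpoly _)
  rw [← range_comp_entry] at h1
  have h2 := (trRank_mono (k := ℂ) Set.subset_union_right).trans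
    (trRank_le_of_tower (k := ℂ) (S := (S : Set K)) (T := Set.range (χ ∘ D.entry)) L subset_rfl)
  rw [Set.encard_coe_eq_coe_finsetCard] at h2
  obtain ⟨h3, h4, h5⟩ := D.finrank_add hw
  rw [h4] at h1 ⊢
  have h6 : Fintype.card m * Fintype.card m + Fintype.card m / 2 * (2 * Fintype.card w - 3) + D.n =
      finrank ℂ X := by omega
  calc trRank ℂ (Set.range (χ ∘ D.entry)) + ((2 * D.n * D.n + D.n + D.n : ℕ) : ℕ∞)
      ≤ (S.card + trRank L (Set.range (χ ∘ D.entry))) + ((2 * D.n * D.n + D.n + D.n : ℕ) : ℕ∞) := by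
        gcongr
    _ = S.card + (trRank L (Set.range (χ ∘ D.entry)) + ((2 * D.n * D.n + D.n : ℕ) : ℕ∞)) + D.n := by
        push_cast; ring
    _ ≤ S.card + ((Fintype.card m * Fintype.card m +
          Fintype.card m / 2 * (2 * Fintype.card w - 3) : ℕ) : ℕ∞) + D.n := by gcongr
    _ = _ := by rw [← h6]; push_cast; ring

universe u

/-- Here d bounds the number of parameters of the eigenvalues along I. The codimension is then at
least dim 𝔤 + n - d, and different ideals enter only through d. -/
theorem ringKrullDim_quotient_add_le {X : Type u} [AddCommGroup X] [Module ℂ X]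
    [FiniteDimensional ℂ X] (D : MatrixDatum X m w) (hw : 4 ≤ Fintype.card w)
    (I : Ideal (polyFun X)) (hI : ∀ i j, D.genericMoment i j ∈ I) (d e : ℕ)
    (he : e + d = (Fintype.card m + 1).choose 2 + D.n)
    (h : ∀ (K : Type u) [Field K] [Algebra ℂ K] [IsAlgClosed K] [DecidableEq K]
      (χ : polyFun X →ₐ[ℂ] K) (lam : Fin D.n → K), I ≤ RingHom.ker χ →
      D.sqrtCharpoly.map (χ : polyFun X →+* K) = ∏ i, (Polynomial.X - Polynomial.C (lam i)) →
      ∃ S : Finset K, S.card ≤ d ∧ ∀ i, lam i ∈ algCl ℂ (S : Set K)) :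
    ringKrullDim (polyFun X ⧸ I) + (e : WithBot ℕ∞) ≤ (finrank ℂ X : WithBot ℕ∞) := by
  classical
  set c := (Fintype.card m + 1).choose 2 + D.n with hc
  have hcX : c ≤ finrank ℂ X := by
    obtain ⟨h3, h4, -⟩ := D.finrank_add hw
    rw [hc, h4]
    nlinarith
  have h1 : ringKrullDim (polyFun X ⧸ I) ≤ ((d + finrank ℂ X - c : ℕ) : WithBot ℕ∞) := by
    refine ringKrullDim_quotient_le_of_trRank D.adjoin_range_entry I _ fun K _ _ _ χ hχ => ?_
    obtain ⟨lam, hlam⟩ := exists_map_eq_prod D.sqrtCharpoly_monic D.natDegree_sqrtCharpoly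
      (χ : polyFun X →+* K)
    obtain ⟨S, hSd, hS⟩ := h K χ lam hχ hlam
    have h2 := D.trRank_range_entry_le hw χ (fun i j => hχ (hI i j)) hlam S hS
    have h3 : trRank ℂ (Set.range (χ ∘ D.entry)) + (c : ℕ) ≤
        ((d + finrank ℂ X - c : ℕ) : ℕ∞) + (c : ℕ) := by
      refine h2.trans ?_
      exact_mod_cast (by omega : S.card + finrank ℂ X ≤ d + finrank ℂ X - c + c)
    exact (ENat.add_le_add_iff_right (by simp)).1 h3
  refine (add_le_add_left h1 _).trans (le_of_eq ?_)
  exact_mod_cast (by omega : d + finrank ℂ X - c + e = finrank ℂ X)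

end MatrixDatum

end SOData

/-! ### Flatness and dimensions for matrix data -/

namespace SOData

open Module

universe u

namespace MatrixDatum

variable {X : Type u} [AddCommGroup X] [Module ℂ X] [FiniteDimensional ℂ X] {m w : Type*}
  [Fintype m] [DecidableEq m] [Fintype w] (D : MatrixDatum X m w)
  {Y : Type*} [AddCommGroup Y] [Module ℂ Y]
  {φ : X → Y} {Φ : Y →ₗ[ℂ] Matrix m m ℂ}

section Coordinates

omit [FiniteDimensional ℂ X] in
-- The components of φ in a basis of Y are linear combinations of the entries of the moment matrix.
-- Those entries are combinations of the components in turn, so the ideal of the components imposes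
-- the full matrix equation.
theorem exists_coord {ι : Type*} [Fintype ι] (b : Basis ι ℂ Y) (hΦ : Function.Injective Φ) (hφ : ∀ x, Φ (φ x) = D.momentMatrix x) :
    ∃ f : ι → polyFun X, (∀ j x, evalAt x (f j) = b.coord j (φ x)) ∧
      ∀ i j, D.genericMoment i j ∈ Ideal.span (Set.range f) := by
  obtain ⟨Ψ, hΨ⟩ := Φ.exists_leftInverse_of_injective (LinearMap.ker_eq_bot.2 hΦ)
  let f : ι → polyFun X := fun j => ∑ a : m × m,
    (b.coord j (Ψ (Matrix.single a.1 a.2 1))) • D.genericMoment a.1 a.2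
  have hf : ∀ j x, evalAt x (f j) = b.coord j (φ x) := by
    intro j x
    have h1 : φ x = Ψ (D.momentMatrix x) := by
      rw [← hφ]; exact (DFunLike.congr_fun hΨ _).symm
    have h2 : D.momentMatrix x = ∑ a : m × m,
        D.momentMatrix x a.1 a.2 • Matrix.single a.1 a.2 (1 : ℂ) := by
      rw [Fintype.sum_prod_type]
      conv_lhs => rw [Matrix.matrix_eq_sum_single (D.momentMatrix x)]
      simp
    rw [h1, h2, map_sum, map_sum, map_sum]
    refine Finset.sum_congr rfl fun a _ => ?_
    rw [map_smul, map_smul, map_smul, smul_eq_mul, smul_eq_mul, mul_comm, ← evalAt_genericMoment]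
    rfl
  refine ⟨f, hf, fun i j => ?_⟩
  have h3 : D.genericMoment i j = ∑ a, (algebraMap ℂ (polyFun X) (Φ (b a) i j)) * f a := by
    refine polyFun_ext fun x => ?_
    have h4 : evalAt x (D.genericMoment i j) = D.momentMatrix x i j := by
      rw [← evalAt_genericMoment]; rfl
    rw [h4, ← hφ, map_sum]
    conv_lhs => rw [← b.sum_repr (φ x)]
    rw [map_sum, Matrix.sum_apply]
    refine Finset.sum_congr rfl fun a _ => ?_
    rw [map_mul, AlgHom.commutes, hf, map_smul, Matrix.smul_apply, smul_eq_mul, mul_comm]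
    rfl
  rw [h3]
  exact Ideal.sum_mem _ fun a _ => Ideal.mul_mem_left _ _ (Ideal.subset_span ⟨a, rfl⟩)

omit [FiniteDimensional ℂ X] in
theorem eq_zero_iff_coord {ι : Type*} (b : Basis ι ℂ Y) {f : ι → polyFun X}
    (hf : ∀ j x, evalAt x (f j) = b.coord j (φ x)) (x : X) :
    φ x = 0 ↔ ∀ j, evalAt x (f j) = 0 := by
  simp only [hf]
  constructor
  · intro h j
    rw [h, map_zero]
  · exact fun h => b.ext_elem fun j => by simpa using h j

omit [FiniteDimensional ℂ X] in
theorem moment_smul (hΦ : Function.Injective Φ) (hφ : ∀ x, Φ (φ x) = D.momentMatrix x) (x : X) :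
    φ ((2 : ℂ) • x) = (2 : ℂ) ^ 2 • φ x := by
  apply hΦ
  rw [hφ, map_smul, hφ, momentMatrix, momentMatrix]
  simp only [map_smul, Matrix.transpose_smul, Matrix.smul_mul, Matrix.mul_smul, smul_smul, ← sq,
    smul_sub, smul_add]

/-- The eigenvalues are unconstrained, so the n of them serve as their own parameters. -/
theorem flat_moment [FiniteDimensional ℂ Y] (hw : 4 ≤ Fintype.card w) (hΦ : Function.Injective Φ)
    (hφ : ∀ x, Φ (φ x) = D.momentMatrix x)
    (hY : finrank ℂ Y = (Fintype.card m + 1).choose 2) :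
    IsFlatMorphism (polyFun X) (polyFun Y) φ := by
  let b := finBasis ℂ Y
  obtain ⟨f, hf, hfm⟩ := D.exists_coord b hΦ hφ
  refine isFlatMorphism_of_homogeneous (polyFunEquiv b) φ f (fun _ => 2) (fun j x => ?_)
    (fun _ => two_pos) (fun j x => ?_) ?_
  · rw [hf]
    change _ = evalAt (φ x) _
    rw [evalAt_polyFunEquiv, MvPolynomial.eval_X]
    rfl
  · rw [hf, hf, D.moment_smul hΦ hφ, map_smul, smul_eq_mul]
  · rw [Fintype.card_fin]
    refine D.ringKrullDim_quotient_add_le hw _ hfm D.n _ (by rw [hY]) fun K _ _ _ _ χ lam _ _ => ?_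
    exact ⟨Finset.univ.image lam, Finset.card_image_le.trans (by simp), fun i =>
      subset_algCl _ (by simp)⟩

omit [FiniteDimensional ℂ X] in
theorem esymm_eq_evalAt {E : X → Sym ℂ D.n}
    (hE : ∀ x, (E x : Multiset ℂ) + (E x : Multiset ℂ) = (D.B₁ x).charpoly.roots) (x : X)
    (i : Fin D.n) :
    (E x : Multiset ℂ).esymm (i + 1) = evalAt x (esymmRoots D.sqrtCharpoly D.n i) := by
  obtain ⟨lam, hlam⟩ := exists_enum (E x)
  have h1 : (D.B₁ x).charpoly = (∏ i, (Polynomial.X - Polynomial.C (lam i))) ^ 2 := by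
    rw [(IsAlgClosed.splits _).eq_prod_roots_of_monic (D.B₁ x).charpoly_monic, ← hE,
      Multiset.map_add, Multiset.prod_add, hlam, ← prod_X_sub_C_eq_multiset_prod, sq]
  have h2 := D.eq_map_sqrtCharpoly
    (Polynomial.monic_prod_of_monic _ _ fun i _ => Polynomial.monic_X_sub_C _) h1
  rw [map_esymmRoots h2.symm, hlam]

/-- On the zero fibre all lower coefficients of q vanish, so q becomes Xⁿ and every eigenvalue is 0;
no parameter is needed for them. -/
theorem flat_moment_prod [FiniteDimensional ℂ Y] (hw : 4 ≤ Fintype.card w) (hΦ : Function.Injective Φ)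
    (hφ : ∀ x, Φ (φ x) = D.momentMatrix x)
    (hY : finrank ℂ Y = (Fintype.card m + 1).choose 2) {n : ℕ} (hn : D.n = n) {E : X → Sym ℂ n}
    (hE : ∀ x, (E x : Multiset ℂ) + (E x : Multiset ℂ) = (D.B₁ x).charpoly.roots) :
    IsFlatMorphism (polyFun X) (polyFunProdSym Y n) fun x => (φ x, E x) := by
  subst hn
  let b := finBasis ℂ Y
  obtain ⟨f, hf, hfm⟩ := D.exists_coord b hΦ hφ
  refine isFlatMorphism_of_homogeneous (polyFunProdSymEquiv b D.n) _
    (Sum.elim (esymmRoots D.sqrtCharpoly D.n) f) (Sum.elim (fun i => i.1 + 1) fun _ => 2)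
    (fun j x => ?_) ?_ ?_ ?_
  · rw [polyFunProdSymEquiv_X]
    rcases j with j | j
    · exact (D.esymm_eq_evalAt hE x j).symm
    · exact hf j x
  · rintro (j | j) <;> simp
  · rintro (j | j) x
    · exact D.evalAt_smul_esymmRoots x j
    · simp only [Sum.elim_inr]
      rw [hf, hf, D.moment_smul hΦ hφ, map_smul, smul_eq_mul]
  · rw [Fintype.card_sum, Fintype.card_fin, Fintype.card_fin]
    refine D.ringKrullDim_quotient_add_le hw _ (fun i j => ?_) 0 _ (by rw [hY]; ring)
      fun K _ _ _ _ χ lam hχ hlam => ?_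
    · refine Ideal.span_mono ?_ (hfm i j)
      rintro _ ⟨a, rfl⟩
      exact ⟨.inr a, rfl⟩
    · have h1 : D.sqrtCharpoly.map (χ : polyFun X →+* K) = Polynomial.X ^ D.n := by
        ext i
        rw [Polynomial.coeff_X_pow]
        rcases lt_trichotomy i D.n with h | h | h
        · have h2 : esymmRoots D.sqrtCharpoly D.n ⟨D.n - (i + 1), by omega⟩ ∈ RingHom.ker χ :=
            hχ (Ideal.subset_span ⟨.inl _, rfl⟩)
          rw [RingHom.mem_ker, esymmRoots, map_mul, map_pow, map_neg, map_one] at h2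
          have h3 := (mul_eq_zero.1 h2).resolve_left (pow_ne_zero _ (by simp))
          rw [show D.n - (D.n - (i + 1) + 1) = i by omega] at h3
          rw [if_neg h.ne, Polynomial.coeff_map]
          exact h3
        · rw [if_pos h, h, ← D.natDegree_sqrtCharpoly, ← D.sqrtCharpoly_monic.natDegree_map
            (χ : polyFun X →+* K), (D.sqrtCharpoly_monic.map _).coeff_natDegree]
        · rw [if_neg h.ne', Polynomial.coeff_eq_zero_of_natDegree_lt]
          rwa [D.sqrtCharpoly_monic.natDegree_map, natDegree_sqrtCharpoly]
      refine ⟨∅, le_rfl, fun i => ?_⟩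
      have h4 := congrArg (Polynomial.eval (lam i)) (h1.symm.trans hlam)
      rw [Polynomial.eval_prod, Finset.prod_eq_zero (Finset.mem_univ i) (by simp),
        Polynomial.eval_pow, Polynomial.eval_X] at h4
      rw [eq_zero_of_pow_eq_zero h4]
      exact zero_mem _

/-- The dimension of the zero fibre. -/
theorem zariskiDim_zeroFibre [FiniteDimensional ℂ Y] (hw : 4 ≤ Fintype.card w) (hΦ : Function.Injective Φ)
    (hφ : ∀ x, Φ (φ x) = D.momentMatrix x)
    (hY : finrank ℂ Y = (Fintype.card m + 1).choose 2) :
    zariskiDim {x | φ x = 0} + (((Fintype.card m + 1).choose 2 : ℕ) : WithBot ℕ∞) =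
      (finrank ℂ X : WithBot ℕ∞) := by
  let b := finBasis ℂ Y
  obtain ⟨f, hf, hfm⟩ := D.exists_coord b hΦ hφ
  have hf0 : ∀ x, φ x = 0 ↔ ∀ j, evalAt x (f j) = 0 := eq_zero_iff_coord b hf
  refine le_antisymm ?_ ?_
  · refine le_trans (add_le_add_left (zariskiDim_le (I := Ideal.span (Set.range f)) ?_) _)
      (D.ringKrullDim_quotient_add_le hw _ hfm D.n _ rfl fun K _ _ _ _ χ lam _ _ =>
        ⟨Finset.univ.image lam, Finset.card_image_le.trans (by simp), fun i =>
          subset_algCl _ (by simp)⟩)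
    intro g hg x hx
    have h1 : Ideal.span (Set.range f) ≤ RingHom.ker (evalAt x) := Ideal.span_le.2 (by
      rintro _ ⟨j, rfl⟩
      exact (hf0 x).1 hx j)
    exact h1 hg
  -- The origin lies in the zero fibre, and Krull's height theorem there bounds the codimension by
  -- the number of equations.
  · have h0 : ∀ j, evalAt (0 : X) (f j) = 0 := by
      refine (hf0 0).1 (hΦ ?_)
      rw [hφ, map_zero, momentMatrix]
      simp
    obtain ⟨p, hp, -, hlen⟩ := exists_ltSeries_at_point f 0 h0
    have h1 := le_zariskiDim (S := {x | φ x = 0}) p 1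
      ((Ideal.ne_top_iff_one _).1 p.last.isPrime.ne_top)
      fun x hx _ => (hf0 x).2 fun j => hx _ (hp j)
    rw [Fintype.card_fin, hY] at hlen
    refine le_trans ?_ (add_le_add_left h1 _)
    exact_mod_cast hlen

omit [FiniteDimensional ℂ X] in
theorem rootSet_eq_image {x : X} {lam : Fin D.n → ℂ}
    (h : D.sqrtCharpoly.map (evalAt x : polyFun X →+* ℂ) =
      ∏ i, (Polynomial.X - Polynomial.C (lam i))) :
    {a : ℂ | (D.B₁ x).charpoly.IsRoot a} = (Finset.univ.image lam : Finset ℂ) := by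
  ext a
  rw [Set.mem_ofPred_eq, charpoly_B₁, h, Polynomial.IsRoot.def, Polynomial.eval_pow,
    Polynomial.eval_prod, pow_eq_zero_iff two_ne_zero, Finset.prod_eq_zero_iff]
  simp [sub_eq_zero, eq_comm]

omit [FiniteDimensional ℂ X] in
theorem exists_ncard_eq (x : X) : ∃ lam : Fin D.n → ℂ,
    D.sqrtCharpoly.map (evalAt x : polyFun X →+* ℂ) =
      ∏ i, (Polynomial.X - Polynomial.C (lam i)) ∧
    {a : ℂ | (D.B₁ x).charpoly.IsRoot a}.ncard = (Finset.univ.image lam).card := by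
  obtain ⟨lam, hlam⟩ := exists_map_eq_prod D.sqrtCharpoly_monic D.natDegree_sqrtCharpoly
    (evalAt x : polyFun X →+* ℂ)
  refine ⟨lam, hlam, ?_⟩
  rw [D.rootSet_eq_image hlam, Set.ncard_coe_finset]

omit [FiniteDimensional ℂ X] in
/-- The number of distinct eigenvalues lies between `1` and `n`. -/
theorem ncard_mem (x : X) (hn : 0 < D.n) : 1 ≤ {a : ℂ | (D.B₁ x).charpoly.IsRoot a}.ncard ∧
    {a : ℂ | (D.B₁ x).charpoly.IsRoot a}.ncard ≤ D.n := by
  obtain ⟨lam, -, hlam⟩ := D.exists_ncard_eq x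
  rw [hlam]
  refine ⟨Finset.card_pos.2 ⟨lam ⟨0, hn⟩, by simp⟩, Finset.card_image_le.trans (by simp)⟩

omit [FiniteDimensional ℂ X] in
/-- A point of the zero fibre with `l` distinct eigenvalues, all but one of them simple. -/
theorem exists_point_stratum (hΦ : Function.Injective Φ) (hφ : ∀ x, Φ (φ x) = D.momentMatrix x)
    {l : ℕ} (hl : 1 ≤ l) (hln : l ≤ D.n) : ∃ (x : X) (lam : Fin D.n → ℂ), φ x = 0 ∧
      D.sqrtCharpoly.map (evalAt x : polyFun X →+* ℂ) =
        ∏ i, (Polynomial.X - Polynomial.C (lam i)) ∧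
      (Finset.univ.image lam).card = l ∧
      D.n - l < (Finset.univ.filter fun a => lam a = 0).card := by
  -- Truncated subtraction gives the value 0 for the first n - l + 1 indices, followed by 1, …, l -
  -- 1 once each.
  let lam : Fin D.n → ℂ := fun i => ((i.1 - (D.n - l) : ℕ) : ℂ)
  obtain ⟨B, hB, hBl⟩ := exists_selfAdj_charpoly D.transpose_J D.J_mul D.two_mul_n lam
  obtain ⟨x, hx1, hx2, hx3⟩ := D.exists_eq B hB
  refine ⟨x, lam, hΦ ?_, ?_, ?_, ?_⟩
  · rw [hφ, map_zero, momentMatrix, hx2, hx3]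
    simp
  · refine (D.eq_map_sqrtCharpoly ?_ (hx1 ▸ hBl)).symm
    exact Polynomial.monic_prod_of_monic _ _ fun i _ => Polynomial.monic_X_sub_C _
  · have h1 : Finset.univ.image lam = (Finset.range l).image (fun i : ℕ => (i : ℂ)) := by
      ext a
      simp only [Finset.mem_image, Finset.mem_univ, true_and, Finset.mem_range, lam]
      constructor
      · rintro ⟨i, rfl⟩
        exact ⟨_, by have := i.2; omega, rfl⟩
      · rintro ⟨i, hi, rfl⟩
        exact ⟨⟨i + (D.n - l), by omega⟩, by simp⟩
    rw [h1, Finset.card_image_of_injective _ Nat.cast_injective, Finset.card_range]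
  · have h1 : (Finset.univ : Finset (Fin (D.n - l + 1))).map
        (Fin.castLEEmb (by omega : D.n - l + 1 ≤ D.n)) ⊆
        Finset.univ.filter fun a => lam a = 0 := by
      intro a ha
      obtain ⟨i, -, rfl⟩ := Finset.mem_map.1 ha
      have hi := i.2
      simp only [Finset.mem_filter, Finset.mem_univ, true_and, lam, Nat.cast_eq_zero]
      simp only [Fin.castLEEmb_apply, Fin.val_castLE]
      omega
    have h2 := Finset.card_le_card h1
    rw [Finset.card_map, Finset.card_univ, Fintype.card_fin] at h2
    omega

/-- The dimension of the strata. -/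
theorem zariskiDim_stratum [FiniteDimensional ℂ Y] (hw : 4 ≤ Fintype.card w)
    (hΦ : Function.Injective Φ) (hφ : ∀ x, Φ (φ x) = D.momentMatrix x)
    (hY : finrank ℂ Y = (Fintype.card m + 1).choose 2) {l : ℕ} (hl : 1 ≤ l) (hln : l ≤ D.n) :
    zariskiDim {x | φ x = 0 ∧ {a : ℂ | (D.B₁ x).charpoly.IsRoot a}.ncard = l} +
      (((Fintype.card m + 1).choose 2 + (D.n - l) : ℕ) : WithBot ℕ∞) =
      (finrank ℂ X : WithBot ℕ∞) := by
  let b := finBasis ℂ Y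
  obtain ⟨f, hf, hfm⟩ := D.exists_coord b hΦ hφ
  have hf0 : ∀ x, φ x = 0 ↔ ∀ j, evalAt x (f j) = 0 := eq_zero_iff_coord b hf
  set q := D.sqrtCharpoly with hq
  refine le_antisymm ?_ ?_
  -- The Hankel determinants of size greater than l vanish on the stratum. Conversely their
  -- vanishing at a point over any field leaves at most l distinct eigenvalues.
  · let I := Ideal.span (Set.range f) ⊔ Ideal.span {g | ∃ s, l < s ∧ g = hankelRoots q D.n s}
    refine le_trans (add_le_add_left (zariskiDim_le (I := I) ?_) _)
      (D.ringKrullDim_quotient_add_le hw I (fun i j => Ideal.mem_sup_left (hfm i j)) l _ (by omega)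
        fun K _ _ _ _ χ lam hχ hlam => ⟨Finset.univ.image lam, ?_, fun i =>
          subset_algCl _ (by simp)⟩)
    · rintro g hg x ⟨hx, hxl⟩
      have h1 : I ≤ RingHom.ker (evalAt x) := by
        refine sup_le (Ideal.span_le.2 ?_) (Ideal.span_le.2 ?_)
        · rintro _ ⟨j, rfl⟩
          exact (hf0 x).1 hx j
        · rintro _ ⟨s, hs, rfl⟩
          obtain ⟨lam, hlam, hcard⟩ := D.exists_ncard_eq x
          change evalAt x _ = 0
          rw [map_hankelRoots hlam, hankelDet_eq_zero]
          omega
      exact h1 hg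
    · by_contra! h
      have h1 : hankelRoots q D.n (Finset.univ.image lam).card ∈ RingHom.ker χ :=
        hχ (Ideal.mem_sup_right (Ideal.subset_span ⟨_, h, rfl⟩))
      rw [RingHom.mem_ker, map_hankelRoots hlam] at h1
      have : CharZero K := charZero_of_injective_algebraMap (algebraMap ℂ K).injective
      exact hankelDet_ne_zero lam h1
  -- The chain is built at a point whose root 0 of q has multiplicity greater than n - l, so q and
  -- its first n - l derivatives vanish at t = 0.
  · obtain ⟨x₀, lam₀, hx₀, hlam₀, hcard₀, hmult₀⟩ := D.exists_point_stratum hΦ hφ hl hln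
    obtain ⟨p, Q, hp, hlast, hlen, hhead, hder⟩ := exists_ltSeries_polynomial
      (φ := (evalAt x₀ : polyFun X →+* ℂ)) (fun c => ⟨algebraMap ℂ _ c, by simp⟩) f
      ((hf0 x₀).1 hx₀) D.sqrtCharpoly_monic 0 (D.n - l) (by
        intro i hi
        rw [← Polynomial.eval_map, ← Polynomial.iterate_derivative_map, hlam₀]
        refine Polynomial.isRoot_iterate_derivative_of_lt_rootMultiplicity ?_
        rw [rootMultiplicity_prod_X_sub_C]
        omega)
    have h1 : (p.length : WithBot ℕ∞) ≤
        zariskiDim {x | φ x = 0 ∧ {a : ℂ | (D.B₁ x).charpoly.IsRoot a}.ncard = l} := by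
      -- Where the Hankel determinant of size l is nonzero there are at least l distinct
      -- eigenvalues; it is nonzero at x₀.
      refine le_zariskiDim p (hankelRoots q D.n l) ?_ fun x hx hxD => ⟨?_, ?_⟩
      · rw [hlast, RingHom.mem_ker]
        change ¬ evalAt x₀ _ = 0
        rw [map_hankelRoots hlam₀, ← hcard₀]
        exact hankelDet_ne_zero lam₀
      · exact (hf0 x).2 fun j => hx _ (hp j)
      -- At the point given by Q, the polynomial q has a root of multiplicity greater than n - l,
      -- the image of the extra variable. Hence there are at most l distinct roots, and the larger
      -- Hankel determinants lie in the contraction of Q.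
      · have hD : ∀ s, l < s → hankelRoots q D.n s ∈ p.head.asIdeal := by
          intro s hs
          obtain ⟨K, _, _, _, ψ, hψ⟩ := exists_algHom_ker_eq (k := ℂ) Q
          classical
          have : CharZero K := charZero_of_injective_algebraMap (algebraMap ℂ K).injective
          let χ : polyFun X →ₐ[ℂ] K := ψ.comp Polynomial.CAlgHom
          obtain ⟨lam, hlam⟩ := exists_map_eq_prod D.sqrtCharpoly_monic D.natDegree_sqrtCharpoly
            (χ : polyFun X →+* K)
          have h2 : ∀ P : Polynomial (polyFun X),
              ψ P = (P.map (χ : polyFun X →+* K)).eval (ψ Polynomial.X) := by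
            intro P
            rw [Polynomial.eval_map]
            induction P using Polynomial.induction_on' with
            | add P P' h h' => rw [map_add, Polynomial.eval₂_add, h, h']
            | monomial i a =>
              rw [Polynomial.eval₂_monomial, ← Polynomial.C_mul_X_pow_eq_monomial, map_mul, map_pow]
              rfl
          have h3 : (Finset.univ.image lam).card + (D.n - l) ≤ D.n := by
            refine card_image_add_le_of_iterate_derivative lam (ψ Polynomial.X) _ fun i hi => ?_
            rw [← hlam, Polynomial.iterate_derivative_map, Polynomial.IsRoot.def, ← h2]
            have h4 := hder i hi
            rwa [← hψ, RingHom.mem_ker] at h4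
          rw [hhead, Ideal.mem_comap, ← hψ, RingHom.mem_ker]
          change χ _ = 0
          rw [map_hankelRoots hlam, hankelDet_eq_zero]
          omega
        obtain ⟨lam, hlam, hcard⟩ := D.exists_ncard_eq x
        rw [hcard]
        refine le_antisymm ?_ ?_
        · by_contra! h
          have h4 := hx _ (hD _ h)
          rw [map_hankelRoots hlam] at h4
          exact hankelDet_ne_zero lam h4
        · by_contra! h
          rw [map_hankelRoots hlam] at hxD
          exact hxD (hankelDet_eq_zero lam h)
    refine le_trans ?_ (add_le_add_left h1 _)
    have h5 : (RingHom.ker (evalAt x₀ : polyFun X →+* ℂ)).height = finrank ℂ X :=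
      height_ker_evalAt x₀
    rw [h5, Fintype.card_fin, hY] at hlen
    have h6 : finrank ℂ X ≤ p.length + (Fintype.card m + 1).choose 2 + (D.n - l) := by
      exact_mod_cast hlen
    exact_mod_cast h6.trans (by omega)

end Coordinates

end MatrixDatum

end SOData

/-! ### From vector spaces with forms to matrices -/

namespace SOData

open Module

section Bases

/-- Diagonalize the form and divide each basis vector by a square root of its nonzero value. -/
theorem exists_orthonormal_basis {W : Type*} [AddCommGroup W] [Module ℂ W]
    [FiniteDimensional ℂ W] {ωW : LinearMap.BilinForm ℂ W} (hW : ωW.Nondegenerate)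
    (hWs : ωW.IsSymm) :
    ∃ b : Basis (Fin (finrank ℂ W)) ℂ W, ∀ i j, ωW (b i) (b j) = if i = j then 1 else 0 := by
  have h2 : Invertible (2 : ℂ) := invertibleOfNonzero two_ne_zero
  obtain ⟨v, hv⟩ := LinearMap.BilinForm.exists_orthogonal_basis (B := ωW)
    (LinearMap.isSymm_def.2 fun x y => hWs.eq x y)
  have hne : ∀ i, ωW (v i) (v i) ≠ 0 := fun i =>
    LinearMap.IsOrthoᵢ.not_isOrtho_basis_self_of_separatingLeft hv hW.1 i
  have hr : ∀ i, ∃ r : ℂ, ωW (v i) (v i) = r * r := fun i => IsAlgClosed.exists_eq_mul_self _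
  choose r hr using hr
  have hr0 : ∀ i, r i ≠ 0 := fun i h => hne i (by rw [hr, h, mul_zero])
  refine ⟨v.isUnitSMul (w := fun i => (r i)⁻¹) fun i => (inv_ne_zero (hr0 i)).isUnit, fun i j => ?_⟩
  rw [Basis.isUnitSMul_apply, Basis.isUnitSMul_apply, map_smul, map_smul, LinearMap.smul_apply]
  split_ifs with h
  · subst h
    rw [hr, smul_eq_mul, smul_eq_mul]
    field_simp [hr0 i]
  · have : ωW (v i) (v j) = 0 := hv h
    rw [this]
    simp

variable {V : Type*} [AddCommGroup V] [Module ℂ V] {ι : Type*} [Fintype ι] [DecidableEq ι]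
  (b : Basis ι ℂ V) (ωV : LinearMap.BilinForm ℂ V)

omit [DecidableEq ι] in
theorem form_eq_sum_left (x y : V) : ωV x y = ∑ l, b.repr x l * ωV (b l) y := by
  conv_lhs => rw [← b.sum_repr x]
  rw [map_sum, LinearMap.sum_apply]
  exact Finset.sum_congr rfl fun l _ => by rw [map_smul, LinearMap.smul_apply, smul_eq_mul]

omit [DecidableEq ι] in
theorem form_eq_sum_right (x y : V) : ωV x y = ∑ l, ωV x (b l) * b.repr y l := by
  conv_lhs => rw [← b.sum_repr y]
  rw [map_sum]
  exact Finset.sum_congr rfl fun l _ => by rw [map_smul, smul_eq_mul, mul_comm]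

/-- The matrix of a bilinear form in a basis. -/
noncomputable def formMatrix : Matrix ι ι ℂ := Matrix.of fun i j => ωV (b i) (b j)

theorem transpose_toMatrix_mul_formMatrix (A : End ℂ V) (i j : ι) :
    ((LinearMap.toMatrix b b A).transpose * formMatrix b ωV) i j = ωV (A (b i)) (b j) := by
  rw [form_eq_sum_left b]
  simp [Matrix.mul_apply, formMatrix, LinearMap.toMatrix_apply]

theorem formMatrix_mul_toMatrix (A : End ℂ V) (i j : ι) :
    (formMatrix b ωV * LinearMap.toMatrix b b A) i j = ωV (b i) (A (b j)) := by
  rw [form_eq_sum_right b]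
  simp [Matrix.mul_apply, formMatrix, LinearMap.toMatrix_apply]

theorem toMatrix_mem_selfAdj {A : End ℂ V} :
    LinearMap.toMatrix b b A ∈ selfAdj (formMatrix b ωV) ↔ A ∈ symPart ωV := by
  rw [mem_selfAdj, LinearMap.mem_selfAdjointSubmodule, ← Matrix.ext_iff]
  simp only [transpose_toMatrix_mul_formMatrix, formMatrix_mul_toMatrix]
  constructor
  · intro h v w
    have h1 : ωV ∘ₗ A = ωV.compl₂ A := b.ext fun i => b.ext fun j => h i j
    exact DFunLike.congr_fun (DFunLike.congr_fun h1 v) w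
  · exact fun h i j => h _ _

theorem toMatrix_mem_skewAdj {A : End ℂ V} :
    LinearMap.toMatrix b b A ∈ skewAdj (formMatrix b ωV) ↔ A ∈ lieAlg ωV := by
  rw [mem_skewAdj, LinearMap.mem_skewAdjointSubmodule, ← Matrix.ext_iff]
  simp only [transpose_toMatrix_mul_formMatrix, Matrix.neg_apply, formMatrix_mul_toMatrix]
  constructor
  · intro h v w
    have h1 : ωV ∘ₗ A = ωV.compl₂ (-A) := b.ext fun i => b.ext fun j => by
      simpa using h i j
    exact DFunLike.congr_fun (DFunLike.congr_fun h1 v) w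
  · intro h i j
    have h1 := h (b i) (b j)
    simpa using h1

theorem finrank_symPart :
    finrank ℂ (symPart ωV) = finrank ℂ (selfAdj (formMatrix b ωV)) := by
  refine LinearEquiv.finrank_eq ((LinearMap.toMatrix b b).ofSubmodules _ _ ?_)
  ext M
  obtain ⟨A, rfl⟩ := (LinearMap.toMatrix b b).surjective M
  rw [toMatrix_mem_selfAdj]
  simp

theorem finrank_lieAlg :
    finrank ℂ (lieAlg ωV) = finrank ℂ (skewAdj (formMatrix b ωV)) := by
  refine LinearEquiv.finrank_eq ((LinearMap.toMatrix b b).ofSubmodules _ _ ?_)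
  ext M
  obtain ⟨A, rfl⟩ := (LinearMap.toMatrix b b).surjective M
  rw [toMatrix_mem_skewAdj]
  simp

variable {ωV}

omit [DecidableEq ι] in
omit [Fintype ι] in
theorem transpose_formMatrix (hVa : ωV.IsAlt) :
    (formMatrix b ωV).transpose = -formMatrix b ωV := by
  ext i j
  exact (hVa.neg_eq (b i) (b j)).symm

theorem exists_formMatrix_mul (hV : ωV.Nondegenerate) :
    ∃ J₁, formMatrix b ωV * J₁ = 1 := by
  have h := (LinearMap.BilinForm.nondegenerate_iff_det_ne_zero b).1 hV
  have h1 : LinearMap.BilinForm.toMatrix b ωV = formMatrix b ωV := by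
    ext i j
    rw [LinearMap.BilinForm.toMatrix_apply]
    rfl
  rw [h1] at h
  exact ⟨_, Matrix.mul_nonsing_inv _ (isUnit_iff_ne_zero.2 h)⟩

end Bases

section Datum

variable {V W : Type*} [AddCommGroup V] [Module ℂ V] [FiniteDimensional ℂ V]
  [AddCommGroup W] [Module ℂ W] [FiniteDimensional ℂ W]
  {ωV : LinearMap.BilinForm ℂ V} {ωW : LinearMap.BilinForm ℂ W}

omit [FiniteDimensional ℂ V] in
-- In an orthonormal basis of W coordinates are pairings with basis vectors, so i* has matrix IᵀJ.
-- This gives the matrix moment map its term IIᵀJ.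
theorem toMatrix_rightAdjoint {m w : Type*} [Fintype m] [DecidableEq m] [Fintype w]
    [DecidableEq w] (b : Basis m ℂ V) {c : Basis w ℂ W} (hW : ωW.Nondegenerate)
    (hc : ∀ i j, ωW (c i) (c j) = if i = j then 1 else 0) (i : W →ₗ[ℂ] V) :
    LinearMap.toMatrix b c (rightAdjoint ωV ωW hW i) =
      (LinearMap.toMatrix c b i).transpose * formMatrix b ωV := by
  ext a j
  have h1 : ∀ u : W, ωW (c a) u = c.repr u a := by
    intro u
    rw [form_eq_sum_right c]
    simp [hc]
  rw [LinearMap.toMatrix_apply, ← h1, rightAdjoint_spec]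
  rw [form_eq_sum_left b]
  simp [Matrix.mul_apply, formMatrix, LinearMap.toMatrix_apply]

/-- The matrix datum of the space of data. -/
noncomputable def toMatrixDatum {m w : Type*} [Fintype m] [DecidableEq m] [Fintype w]
    [DecidableEq w] (b : Basis m ℂ V) (c : Basis w ℂ W) (hV : ωV.Nondegenerate)
    (hVa : ωV.IsAlt) : MatrixDatum (DataSpace W ωV) m w where
  J := formMatrix b ωV
  J₁ := (exists_formMatrix_mul b hV).choose
  B₁ := (LinearMap.toMatrix b b).toLinearMap ∘ₗ (symPart ωV).subtype ∘ₗ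
    LinearMap.fst ℂ (symPart ωV) (symPart ωV × (W →ₗ[ℂ] V))
  B₂ := (LinearMap.toMatrix b b).toLinearMap ∘ₗ (symPart ωV).subtype ∘ₗ
    LinearMap.fst ℂ (symPart ωV) (W →ₗ[ℂ] V) ∘ₗ
    LinearMap.snd ℂ (symPart ωV) (symPart ωV × (W →ₗ[ℂ] V))
  I := (LinearMap.toMatrix c b).toLinearMap ∘ₗ LinearMap.snd ℂ (symPart ωV) (W →ₗ[ℂ] V) ∘ₗ
    LinearMap.snd ℂ (symPart ωV) (symPart ωV × (W →ₗ[ℂ] V))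
  transpose_J := transpose_formMatrix b hVa
  J_mul := (exists_formMatrix_mul b hV).choose_spec
  B₁_mem x := (toMatrix_mem_selfAdj b ωV).2 x.1.2
  B₂_mem x := (toMatrix_mem_selfAdj b ωV).2 x.2.1.2
  eq_zero x h1 h2 h3 := by
    refine Prod.ext (Subtype.ext ?_) (Prod.ext (Subtype.ext ?_) ?_)
    · exact (LinearMap.toMatrix b b).map_eq_zero_iff.1 h1
    · exact (LinearMap.toMatrix b b).map_eq_zero_iff.1 h2
    · exact (LinearMap.toMatrix c b).map_eq_zero_iff.1 h3
  exists_eq B hB := by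
    obtain ⟨A, rfl⟩ := (LinearMap.toMatrix b b).surjective B
    exact ⟨(⟨A, (toMatrix_mem_selfAdj b ωV).1 hB⟩, 0, 0), rfl,
      (LinearMap.toMatrix b b).map_zero, (LinearMap.toMatrix c b).map_zero⟩
  finrank_eq := by
    rw [Module.finrank_prod, Module.finrank_prod, finrank_symPart b, Module.finrank_linearMap,
      finrank_eq_card_basis b, finrank_eq_card_basis c]
    ring

/-- The inclusion of the Lie algebra into matrices. -/
noncomputable def lieAlgToMatrix {m : Type*} [Fintype m] [DecidableEq m] (b : Basis m ℂ V) :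
    lieAlg ωV →ₗ[ℂ] Matrix m m ℂ :=
  (LinearMap.toMatrix b b).toLinearMap ∘ₗ (lieAlg ωV).subtype

omit [FiniteDimensional ℂ V] in
theorem lieAlgToMatrix_injective {m : Type*} [Fintype m] [DecidableEq m] (b : Basis m ℂ V) :
    Function.Injective (lieAlgToMatrix (ωV := ωV) b) :=
  (LinearMap.toMatrix b b).injective.comp Subtype.val_injective

theorem lieAlgToMatrix_moment {m w : Type*} [Fintype m] [DecidableEq m] [Fintype w]
    [DecidableEq w] (b : Basis m ℂ V) {c : Basis w ℂ W} (hV : ωV.Nondegenerate) (hVa : ωV.IsAlt)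
    (hW : ωW.Nondegenerate) (hWs : ωW.IsSymm)
    (hc : ∀ i j, ωW (c i) (c j) = if i = j then 1 else 0) (x : DataSpace W ωV) :
    lieAlgToMatrix b (moment ωV hVa ωW hW hWs x) = (toMatrixDatum b c hV hVa).momentMatrix x := by
  change LinearMap.toMatrix b b ((x.1 : End ℂ V) * x.2.1 - (x.2.1 : End ℂ V) * x.1 +
    x.2.2 ∘ₗ rightAdjoint ωV ωW hW x.2.2) = _
  rw [map_add, map_sub, LinearMap.toMatrix_mul, LinearMap.toMatrix_mul,
    LinearMap.toMatrix_comp b c b, toMatrix_rightAdjoint b hW hc, ← Matrix.mul_assoc]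
  rfl

theorem charpoly_toMatrixDatum {m w : Type*} [Fintype m] [DecidableEq m] [Fintype w]
    [DecidableEq w] (b : Basis m ℂ V) (c : Basis w ℂ W) (hV : ωV.Nondegenerate) (hVa : ωV.IsAlt)
    (x : DataSpace W ωV) :
    ((toMatrixDatum b c hV hVa).B₁ x).charpoly = LinearMap.charpoly (x.1 : End ℂ V) :=
  LinearMap.charpoly_toMatrix _ b

theorem stratum_eq {m w : Type*} [Fintype m] [DecidableEq m] [Fintype w]
    [DecidableEq w] (b : Basis m ℂ V) (c : Basis w ℂ W) (hV : ωV.Nondegenerate) (hVa : ωV.IsAlt)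
    (hW : ωW.Nondegenerate) (hWs : ωW.IsSymm) (l : ℕ) :
    stratum ωV hVa ωW hW hWs l = {x | moment ωV hVa ωW hW hWs x = 0 ∧
      {a : ℂ | ((toMatrixDatum b c hV hVa).B₁ x).charpoly.IsRoot a}.ncard = l} := by
  simp only [charpoly_toMatrixDatum, ← End.hasEigenvalue_iff_isRoot_charpoly]
  rfl

/-- The halves of the multisets of eigenvalues. -/
theorem exists_half_eigenvalues {m : Type*} [Fintype m] [DecidableEq m] (b : Basis m ℂ V)
    (hV : ωV.Nondegenerate) (hVa : ωV.IsAlt) {n : ℕ} (hn : 2 * n = Fintype.card m)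
    (B : symPart ωV) : ∃ s : Sym ℂ n,
      (s : Multiset ℂ) + (s : Multiset ℂ) = (LinearMap.charpoly (B : End ℂ V)).roots := by
  obtain ⟨p, hp, hpn, hpB⟩ := exists_charpoly_eq_sq (transpose_formMatrix b hVa)
    (exists_formMatrix_mul b hV).choose_spec ((toMatrix_mem_selfAdj b ωV).2 B.2)
  rw [LinearMap.charpoly_toMatrix] at hpB
  refine ⟨⟨p.roots, ?_⟩, ?_⟩
  · rw [← (IsAlgClosed.splits p).natDegree_eq_card_roots]
    omega
  · rw [hpB, Polynomial.roots_pow, two_nsmul]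
    rfl

end Datum

end SOData

/-! ### The theorem for symplectic V and orthogonal W -/

theorem lemma2p1 {V W : Type*}
    [AddCommGroup V] [Module ℂ V] [FiniteDimensional ℂ V]
    [AddCommGroup W] [Module ℂ W] [FiniteDimensional ℂ W]
    (ωV : LinearMap.BilinForm ℂ V) (hV : ωV.Nondegenerate) (hVa : ωV.IsAlt)
    (ωW : LinearMap.BilinForm ℂ W) (hW : ωW.Nondegenerate) (hWs : ωW.IsSymm)
    (k N : ℕ) (hk : Module.finrank ℂ V = k) (hN : Module.finrank ℂ W = N) (hN4 : 4 ≤ N) :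
    -- the morphism `x ↦ (μ(x), E_k(B₁))` is flat, where `E_k(B₁)` is the point of `S^{k/2}C`
    -- whose double is the multiset of eigenvalues of `B₁`
    (∃ E : SOData.symPart ωV → Sym ℂ (k / 2),
      (∀ B : SOData.symPart ωV,
        (E B : Multiset ℂ) + (E B : Multiset ℂ) =
          (LinearMap.charpoly (B : Module.End ℂ V)).roots) ∧
      SOData.IsFlatMorphism (SOData.polyFun (SOData.DataSpace W ωV))
        (SOData.polyFunProdSym (SOData.lieAlg ωV) (k / 2))
        (fun x => (SOData.moment ωV hVa ωW hW hWs x, E x.1))) ∧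
    -- `μ` is flat
    SOData.IsFlatMorphism (SOData.polyFun (SOData.DataSpace W ωV))
      (SOData.polyFun (SOData.lieAlg ωV)) (SOData.moment ωV hVa ωW hW hWs) ∧
    -- `dim μ⁻¹(0) = dim 𝐍 - dim 𝔤(V)`
    SOData.zariskiDim (SOData.zeroFibre ωV hVa ωW hW hWs) +
        (Module.finrank ℂ (SOData.lieAlg ωV) : WithBot ℕ∞) =
      (Module.finrank ℂ (SOData.DataSpace W ωV) : WithBot ℕ∞) ∧
    -- `dim μ⁻¹(0)_l = dim 𝐍 - dim 𝔤(V) - (k/2 - l)` for `1 ≤ l ≤ k/2`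
    (∀ l : ℕ, 1 ≤ l → l ≤ k / 2 →
      SOData.zariskiDim (SOData.stratum ωV hVa ωW hW hWs l) +
          (Module.finrank ℂ (SOData.lieAlg ωV) : WithBot ℕ∞) + ((k / 2 - l : ℕ) : WithBot ℕ∞) =
        (Module.finrank ℂ (SOData.DataSpace W ωV) : WithBot ℕ∞)) ∧
    -- the other strata are empty
    (0 < k → ∀ l : ℕ, ¬ (1 ≤ l ∧ l ≤ k / 2) →
      SOData.stratum ωV hVa ωW hW hWs l = ∅) := by
  classical
  let b := Module.finBasisOfFinrankEq ℂ V hk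
  obtain ⟨c, hc⟩ := SOData.exists_orthonormal_basis hW hWs
  let D := SOData.toMatrixDatum b c hV hVa
  have hw : 4 ≤ Fintype.card (Fin (Module.finrank ℂ W)) := by rw [Fintype.card_fin, hN]; exact hN4
  have hn : D.n = k / 2 := by rw [SOData.MatrixDatum.n, Fintype.card_fin]
  have h2n : 2 * (k / 2) = Fintype.card (Fin k) := hn ▸ D.two_mul_n
  have hΦ := SOData.lieAlgToMatrix_injective (ωV := ωV) b
  have hφ := SOData.lieAlgToMatrix_moment b hV hVa hW hWs hc
  have hY : Module.finrank ℂ (SOData.lieAlg ωV) = (Fintype.card (Fin k) + 1).choose 2 := by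
    rw [SOData.finrank_lieAlg b]
    exact SOData.finrank_skewAdj D.transpose_J D.J_mul
  choose E hE using SOData.exists_half_eigenvalues b hV hVa h2n
  refine ⟨⟨E, hE, ?_⟩, D.flat_moment hw hΦ hφ hY, ?_, fun l hl hlk => ?_, fun hk0 l hl => ?_⟩
  · refine D.flat_moment_prod hw hΦ hφ hY hn (E := fun x => E x.1) fun x => ?_
    rw [hE, SOData.charpoly_toMatrixDatum]
  · have h := D.zariskiDim_zeroFibre hw hΦ hφ hY
    rw [← hY] at h
    exact h
  · have h := D.zariskiDim_stratum hw hΦ hφ hY hl (hlk.trans hn.ge)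
    rw [SOData.stratum_eq b c hV hVa hW hWs, ← h, hY, hn, add_assoc]
    push_cast
    rfl
  -- For k > 0 the polynomial q has positive degree k/2, so B₁ has at least one and at most k/2
  -- distinct eigenvalues.
  · refine Set.eq_empty_iff_forall_notMem.2 fun x hx => hl ?_
    rw [SOData.stratum_eq b c hV hVa hW hWs] at hx
    rw [← hx.2, ← hn]
    rw [Fintype.card_fin] at h2n
    exact D.ncard_mem x (by omega)
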